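/- Let $d\in\{1,2,3\}$ and $\mu>0$. Let $V\in L^1(\mathbb{R}^d)$ be real-valued and radial, with in addition $V\in L^{p}(\mathbb{R}^2)$ for some $p\in(1,\infty)$ if $d=2$, and $V\in L^{3/2}(\mathbb{R}^3)$ if $d=3$. Write $\hat f(p)=(2\pi)^{-d/2}\int_{\mathbb{R}^d}f(x)e^{-ip\cdot x}\,dx$ (extended to $L^2$), and assume that $V$ is of negative type: $\hat V\le 0$ and $\hat V(0)<0$. A BCS state $\Gamma\equiv(\gamma,\alpha)$ is given by $\hat\gamma:\mathbb{R}^d\to\mathbb{R}$ with $\hat\gamma\in L^1(\mathbb{R}^d,(1+p^2)\,dp)$ and $\alpha\in H^1(\mathbb{R}^d)$ with $\hat\alpha(-p)=\hat\alpha(p)$, such that $0\le\hat\Gamma(p)\le 1$ for almost every $p$, where $$\hat\Gamma(p)=\begin{pmatrix}\hat\gamma(p)&\hat\alpha(p)\\ \overline{\hat\alpha(p)}&1-\hat\gamma(p)\end{pmatrix}.$$ For $T\ge 0$ consider on these states the BCS functional $$\mathcal{F}_T[\Gamma]=\int_{\mathbb{R}^d}(p^2-\mu)\hat\gamma(p)\,dp+T\int_{\mathbb{R}^d}\mathrm{Tr}_{\mathbb{C}^2}\big[\hat\Gamma(p)\log\hat\Gamma(p)\big]\,dp+\int_{\mathbb{R}^d}V(x)|\alpha(x)|^2\,dx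 .$$ For a function $\Delta:\mathbb{R}^d\to\mathbb{C}$ let $E_\Delta(p)=\sqrt{(p^2-\mu)^2+|\Delta(p)|^2}$ and $K_T^\Delta(p)=E_\Delta(p)/\tanh\big(E_\Delta(p)/(2T)\big)$, understood as $E_\Delta(p)$ if $T=0$ and as $2T$ where $T>0$ and $E_\Delta(p)=0$. The operator $K_T^\Delta+V$ on $L^2(\mathbb{R}^d)$, with $K_T^\Delta$ acting by multiplication in momentum space and $V$ by multiplication in position space, is the one defined by its quadratic form on $H^1(\mathbb{R}^d)$. Let $T_c=\inf\{T>0:K_T^0+V\ge 0\}$, and let $0\le T<T_c$. Then: (i) Let $\Gamma\equiv(\gamma,\alpha)$ be any minimizer of $\mathcal{F}_T$, and set $\Delta=-2(2\pi)^{-d/2}\,\hat V\star\hat\alpha$. Then $K_T^\Delta+V\ge 0$, and $\alpha$ is its unique ground state, with eigenvalue $0$: $\alpha\neq0$, $(K_T^\Delta+V)\alpha=0$, and every ground state with eigenvalue $0$ is a scalar multiple of $\alpha$. (ii) There is a minimizer $\Gamma_*\equiv(\gamma_*,\alpha_*)$ of $\mathcal{F}_T$ such that $\hat\alpha_*$ is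 (almost everywhere equal to) a continuous, everywhere strictly positive function, and it is unique up to a phase of $\alpha_*$: a state $(\gamma,\alpha)$ is a minimizer if and only if $\gamma=\gamma_*$ and $\alpha=e^{i\theta}\alpha_*$ for some $\theta\in\mathbb{R}$. Moreover, for every minimizer $(\gamma,\alpha)$, both $\gamma$ and $\alpha$ (and their Fourier transforms) are radial functions. -/

import Mathlib

open MeasureTheory
open scoped ENNReal FourierTransform ComplexOrder

noncomputable section

namespace BCS

/-- Position (and momentum) space `ℝ^d`. -/
abbrev Space (d : ℕ) := EuclideanSpace ℝ (Fin d)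

/-- The complex Hilbert space `L²(ℝ^d)`. -/
abbrev L2 (d : ℕ) := Lp (α := Space d) ℂ 2 (volume : Measure (Space d))

/-- The normalization `(2π)^{-d/2}` of the unitary Fourier transform. -/
def fourierNorm (d : ℕ) : ℝ := (2 * Real.pi) ^ (-(d : ℝ) / 2)

/-- The unitary Fourier transform `ψ̂(p) = (2π)^{-d/2} ∫ ψ(x) e^{-ip·x} dx` of `ψ ∈ L²(ℝ^d)`,
obtained from Mathlib's `L²` Fourier transform (whose kernel is `e^{-2πi ξ·x}`)
by rescaling `ξ = p / (2π)`. -/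
def hat {d : ℕ} (ψ : L2 d) (p : Space d) : ℂ :=
  (fourierNorm d : ℂ) * (𝓕 ψ : L2 d) ((2 * Real.pi)⁻¹ • p)

/-- The Fourier transform `V̂(p) = (2π)^{-d/2} ∫ V(x) e^{-ip·x} dx` of a potential
`V ∈ L¹(ℝ^d)`. -/
def potentialHat {d : ℕ} (V : Space d → ℝ) (p : Space d) : ℂ :=
  (fourierNorm d : ℂ) * ∫ x, (V x : ℂ) * Complex.exp (-Complex.I * (inner ℝ p x : ℝ))

/-- `ψ ∈ H¹(ℝ^d)`, i.e. `∫ (1 + p²) |ψ̂(p)|² dp < ∞`. -/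
def MemH1 {d : ℕ} (ψ : L2 d) : Prop :=
  Integrable (fun p : Space d => (1 + ‖p‖ ^ 2) * ‖hat ψ p‖ ^ 2)

/-- A function on `ℝ^d` (modulo null sets) is radial: it depends on `|x|` only. -/
def IsRadial {d : ℕ} {β : Type*} (g : Space d → β) : Prop :=
  ∃ f : ℝ → β, g =ᵐ[volume] fun x => f ‖x‖

/-- Integrability of the potential: `V ∈ L¹(ℝ^d)`, and moreover `V ∈ L^p(ℝ²)` for some
`p ∈ (1, ∞)` if `d = 2`, and `V ∈ L^{3/2}(ℝ³)` if `d = 3`. -/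
structure IsAdmissible {d : ℕ} (V : Space d → ℝ) : Prop where
  memLp_one : MemLp V 1 volume
  two_dim : d = 2 → ∃ p : ℝ≥0∞, 1 < p ∧ p < ∞ ∧ MemLp V p volume
  three_dim : d = 3 → MemLp V (3 / 2) volume

/-- Radially symmetric potentials of negative type: `V̂ ≤ 0` and `V̂(0) < 0`.
(The order on `ℂ` includes that the values are real, which is automatic for radial `V`.) -/
structure IsNegativeType {d : ℕ} (V : Space d → ℝ) : Prop where
  radial : IsRadial V
  hat_nonpos : ∀ p, potentialHat V p ≤ 0
  hat_zero_neg : potentialHat V 0 < 0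

/-- The data of a BCS state: the momentum distribution `γ̂` and the Cooper pair
wave function `α`. -/
structure State (d : ℕ) where
  gammaHat : Space d → ℝ
  alpha : L2 d

/-- `α̂`, the Fourier transform of the Cooper pair wave function. -/
def State.alphaHat {d : ℕ} (Γ : State d) : Space d → ℂ := hat Γ.alpha

/-- `γ(x) = (2π)^{-d/2} ∫ γ̂(p) e^{ip·x} dp`. -/
def State.gamma {d : ℕ} (Γ : State d) (x : Space d) : ℂ :=
  (fourierNorm d : ℂ) *
    ∫ p, (Γ.gammaHat p : ℂ) * Complex.exp (Complex.I * (inner ℝ p x : ℝ))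

/-- The matrix `Γ̂(p)` with rows `(γ̂(p), α̂(p))` and `(conj α̂(p), 1 - γ̂(p))`. -/
def State.matrix {d : ℕ} (Γ : State d) (p : Space d) : Matrix (Fin 2) (Fin 2) ℂ :=
  !![(Γ.gammaHat p : ℂ), Γ.alphaHat p;
     star (Γ.alphaHat p), 1 - (Γ.gammaHat p : ℂ)]

/-- The variational domain `𝒟`: `0 ≤ Γ̂ ≤ 1`, `γ̂ ∈ L¹((1 + p²) dp)`, `α ∈ H¹` and
`α̂(-p) = α̂(p)`. -/
structure State.MemDomain {d : ℕ} (Γ : State d) : Prop where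
  nonneg : ∀ᵐ p, (Γ.matrix p).PosSemidef
  le_one : ∀ᵐ p, (1 - Γ.matrix p).PosSemidef
  integrable_gamma : Integrable (fun p : Space d => (1 + ‖p‖ ^ 2) * Γ.gammaHat p)
  alpha_mem : MemH1 Γ.alpha
  alpha_symm : ∀ᵐ p, Γ.alphaHat (-p) = Γ.alphaHat p

/-- The entropy `S[Γ] = -∫ Tr[Γ̂(p) log Γ̂(p)] dp`, with `0 log 0 = 0`. -/
def entropy {d : ℕ} (Γ : State d) : ℝ :=
  -∫ p, (Matrix.trace (Γ.matrix p * cfc Real.log (Γ.matrix p))).re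

/-- The BCS free energy functional
`F_T[Γ] = ∫ (p² - μ) γ̂(p) dp - T S[Γ] + ∫ V(x) |α(x)|² dx`. -/
def freeEnergy {d : ℕ} (μ T : ℝ) (V : Space d → ℝ) (Γ : State d) : ℝ :=
  (∫ p, (‖p‖ ^ 2 - μ) * Γ.gammaHat p) - T * entropy Γ + ∫ x, V x * ‖Γ.alpha x‖ ^ 2

/-- `Γ` minimizes `F_T` on `𝒟`. -/
def IsMinimizer {d : ℕ} (μ T : ℝ) (V : Space d → ℝ) (Γ : State d) : Prop :=
  Γ.MemDomain ∧ ∀ Γ' : State d, Γ'.MemDomain → freeEnergy μ T V Γ ≤ freeEnergy μ T V Γ'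

/-- The gap function `Δ = -2 (2π)^{-d/2} V̂ ⋆ α̂`. -/
def gap {d : ℕ} (V : Space d → ℝ) (Γ : State d) (p : Space d) : ℂ :=
  -2 * (fourierNorm d : ℂ) * ∫ q, potentialHat V (p - q) * Γ.alphaHat q

/-- `E_Δ(p) = √((p² - μ)² + |Δ(p)|²)`. -/
def dispersion {d : ℕ} (μ : ℝ) (Δ : Space d → ℂ) (p : Space d) : ℝ :=
  Real.sqrt ((‖p‖ ^ 2 - μ) ^ 2 + ‖Δ p‖ ^ 2)

/-- `K_T^Δ(p) = E_Δ(p) / tanh(E_Δ(p) / (2T))`, understood by continuity as `E_Δ(p)` for `T = 0`,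
and as `2T` where `E_Δ(p) = 0`. -/
def symbolK {d : ℕ} (μ T : ℝ) (Δ : Space d → ℂ) (p : Space d) : ℝ :=
  if T = 0 then dispersion μ Δ p
  else if dispersion μ Δ p = 0 then 2 * T
  else dispersion μ Δ p / Real.tanh (dispersion μ Δ p / (2 * T))

/-- The sesquilinear form `⟨φ, (K + V) ψ⟩` on `H¹(ℝ^d)`, where `K` acts by multiplication in
momentum space and `V` by multiplication in position space. -/
def form {d : ℕ} (K V : Space d → ℝ) (φ ψ : L2 d) : ℂ :=
  (∫ p, (K p : ℂ) * (star (hat φ p) * hat ψ p)) + ∫ x, (V x : ℂ) * (star (φ x) * ψ x)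

/-- `K + V ≥ 0` as an operator on `L²(ℝ^d)`, i.e. its form is non-negative on `H¹(ℝ^d)`. -/
def OperatorNonneg {d : ℕ} (K V : Space d → ℝ) : Prop :=
  ∀ ψ : L2 d, MemH1 ψ → 0 ≤ (form K V ψ ψ).re

/-- `ψ` lies in the domain of the operator `K + V` associated with the form on `H¹(ℝ^d)`, and
`(K + V) ψ = χ`. -/
def OperatorApplyEq {d : ℕ} (K V : Space d → ℝ) (ψ χ : L2 d) : Prop :=
  MemH1 ψ ∧ ∀ φ : L2 d, MemH1 φ → form K V φ ψ = inner ℂ φ χ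

/-- `ψ` is a ground state of `K + V` with eigenvalue `e`: `ψ ≠ 0`, `(K + V) ψ = e ψ`, and `e` is
the bottom of the spectrum, `K + V ≥ e`. -/
structure IsGroundState {d : ℕ} (K V : Space d → ℝ) (e : ℝ) (ψ : L2 d) : Prop where
  ne_zero : ψ ≠ 0
  eigen : OperatorApplyEq K V ψ ((e : ℂ) • ψ)
  lowest : ∀ φ : L2 d, MemH1 φ → e * ‖φ‖ ^ 2 ≤ (form K V φ φ).re

/-- The critical temperature `T_c = inf {T > 0 : K_T + V ≥ 0}`, where `K_T = K_T^0`. -/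
def criticalTemperature {d : ℕ} (μ : ℝ) (V : Space d → ℝ) : ℝ :=
  sInf {T : ℝ | 0 < T ∧ OperatorNonneg (symbolK μ T (fun _ => 0)) V}

end BCS

end

/-! ### The unitary Fourier transform on `L²` and its inversion formula. -/

noncomputable section

namespace BCS

variable {d : ℕ}

/-! Since `V̂ ≤ 0`, the potential acts in momentum space as `-k ⋆`, where the kernel `k =
-(2π)^{-d/2} V̂` is non-negative, continuous, bounded and positive near the origin. The whole
theorem follows from one strictly positive continuous solution `a` of the gap equation `K_T^{2b} a =
b`, `b = k ⋆ a`; no direct method or compactness argument for the functional is needed.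

Existence of `a` (`exists_gapSolution`). The map `b ↦ b / K_T^{2b}` is increasing and bounded by
`1/2`, so on each momentum ball the iteration started at the constant `1/2` decreases to a solution.
The iterates are positive supersolutions of linear problems. If their limit were zero, a Schur test
would give `K_T^0 + V ≥ 0` on functions with momenta in that ball
(`pairForm_le_of_gapBall_eq_zero`), and if this happened for every ball it would contradict `T <
T_c`. An a priori bound uniform in the radius (`wsq_gapBall_le`) allows the ball to exhaust the
space, and positivity of `k` near `0` spreads the positivity of `b` everywhere.

Linear part (`ground_state_representation`, `eq_const_mul`). For `K = K_T^{2b}` the form of `K + V`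
at `ψ` equals half of `∬ k(p-q) a(p) a(q) |ψ̂(p)/a(p) - ψ̂(q)/a(q)|²`. It is therefore non-negative,
and it vanishes only for multiples of `a`.

Nonlinear part (`freeEnergy_sub`, `excess_eq`, `entropy_convexity`). Let `Γ_*` have `α̂_* = a` and
the matching `γ̂_*`. Then `F(Γ) - F(Γ_*)` is the integral of a pointwise excess plus the form of `K
+ V` at `α`. After completing a square the excess is non-negative, because the entropy density is
convex as a function of the squared distance of the eigenvalues from `1/2`. Equality forces `γ̂ =
γ̂_*`, `|α̂| = a` and `α̂ = c a`, so the minimizers are exactly the phase rotations of `Γ_*`.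
Radiality holds because every step of the construction commutes with linear isometries. -/

lemma fourierNorm_pos (d : ℕ) : 0 < fourierNorm d := by
  unfold fourierNorm; positivity

/-- This cancels the Jacobian of the rescaling `ξ = p / (2π)` and thus makes `hat` unitary. -/
lemma fourierNorm_sq (d : ℕ) : fourierNorm d ^ 2 * (2 * Real.pi) ^ d = 1 := by
  unfold fourierNorm
  rw [← Real.rpow_natCast, ← Real.rpow_natCast, ← Real.rpow_mul (by positivity),
    ← Real.rpow_add (by positivity)]
  convert Real.rpow_zero (2 * Real.pi) using 2
  push_cast
  ring

/-- The inverse `L²` Fourier transform agrees almost everywhere with the integral if the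
transform is integrable. -/
theorem ae_eq_fourierInv_of_integrable (ψ : L2 d)
    (h : Integrable ((𝓕 ψ : L2 d) : Space d → ℂ)) :
    (ψ : Space d → ℂ) =ᵐ[volume] 𝓕⁻ ((𝓕 ψ : L2 d) : Space d → ℂ) := by
  have hcont : Continuous (𝓕⁻ ((𝓕 ψ : L2 d) : Space d → ℂ)) := by
    have := VectorFourier.fourierIntegral_continuous (μ := (volume : Measure (Space d)))
      Real.continuous_fourierChar (L := -innerₗ (Space d)) (f := ((𝓕 ψ : L2 d) : Space d → ℂ))
      (continuous_inner (𝕜 := ℝ) (E := Space d)).neg h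
    exact this
  -- Both sides are compared as distributions: the `L²` transform is the one of tempered
  -- distributions, and for the integrable transform the duality is Fubini.
  refine ae_eq_of_integral_contDiff_smul_eq
    ((Lp.memLp ψ).locallyIntegrable (by norm_num)) hcont.locallyIntegrable ?_
  intro g hg hgc
  have hgc' : HasCompactSupport (fun x => (g x : ℂ)) :=
    hgc.comp_left (g := fun r : ℝ => (r : ℂ)) Complex.ofReal_zero
  let φ : SchwartzMap (Space d) ℂ :=
    hgc'.toSchwartzMap (Complex.ofRealCLM.contDiff.comp hg)
  have hφ : ∀ x, φ x = (g x : ℂ) := fun x => rfl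
  have key : (Lp.toTemperedDistribution ψ) φ
      = (Lp.toTemperedDistribution (𝓕 ψ : L2 d)) (𝓕⁻ φ) := by
    rw [← TemperedDistribution.fourierInv_apply, Lp.fourierInv_toTemperedDistribution_eq,
      FourierTransform.fourierInv_fourier_eq]
  rw [Lp.toTemperedDistribution_apply, Lp.toTemperedDistribution_apply] at key
  have key2 : ∫ x, (𝓕⁻ φ) x • ((𝓕 ψ : L2 d) : Space d → ℂ) x
      = ∫ x, φ x • (𝓕⁻ ((𝓕 ψ : L2 d) : Space d → ℂ)) x := by
    have := VectorFourier.integral_fourierIntegral_smul_eq_flip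
      (μ := (volume : Measure (Space d))) (ν := (volume : Measure (Space d)))
      (L := -innerₗ (Space d)) (f := (φ : Space d → ℂ))
      (g := ((𝓕 ψ : L2 d) : Space d → ℂ)) Real.continuous_fourierChar
      (continuous_inner (𝕜 := ℝ) (E := Space d)).neg φ.integrable h
    have hfl : (-innerₗ (Space d)).flip = -innerₗ (Space d) := by
      ext x y
      simp [real_inner_comm]
    rw [hfl] at this
    rw [SchwartzMap.fourierInv_coe]
    exact this
  rw [key2] at key
  simpa [hφ, Complex.real_smul] using key

lemma hat_stronglyMeasurable (ψ : L2 d) : StronglyMeasurable (hat ψ) := by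
  unfold hat
  exact ((Lp.stronglyMeasurable _).comp_measurable (measurable_const_smul _)).const_mul _

lemma hat_measurable (ψ : L2 d) : Measurable (hat ψ) := (hat_stronglyMeasurable ψ).measurable

lemma integrable_norm_sq (ψ : L2 d) : Integrable fun x => ‖ψ x‖ ^ 2 :=
  (memLp_two_iff_integrable_sq_norm (Lp.aestronglyMeasurable ψ)).1 (Lp.memLp ψ)

lemma norm_sq_eq_integral (ψ : L2 d) : ‖ψ‖ ^ 2 = ∫ x, ‖ψ x‖ ^ 2 := by
  have h : inner ℂ ψ ψ = ((‖ψ‖ ^ 2 : ℝ) : ℂ) := by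
    rw [inner_self_eq_norm_sq_to_K]; norm_cast
  rw [L2.inner_def] at h
  have h2 : ∀ x, inner ℂ (ψ x) (ψ x) = ((‖ψ x‖ ^ 2 : ℝ) : ℂ) := fun x => by
    rw [inner_self_eq_norm_sq_to_K]; norm_cast
  simp_rw [h2] at h
  rw [integral_complex_ofReal] at h
  exact (Complex.ofReal_injective h).symm

lemma integrable_hat_sq (ψ : L2 d) : Integrable fun p => ‖hat ψ p‖ ^ 2 := by
  have h := (integrable_norm_sq (𝓕 ψ : L2 d)).comp_smul
    (R := (2 * Real.pi)⁻¹) (by positivity)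
  simpa [hat, mul_pow] using h.const_mul (fourierNorm d ^ 2)

lemma memLp_hat (ψ : L2 d) : MemLp (hat ψ) 2 :=
  (memLp_two_iff_integrable_sq_norm (hat_stronglyMeasurable ψ).aestronglyMeasurable).2
    (integrable_hat_sq ψ)

/-- Plancherel's theorem. -/
theorem integral_hat_sq (ψ : L2 d) : ∫ p, ‖hat ψ p‖ ^ 2 = ∫ x, ‖ψ x‖ ^ 2 := by
  have h := Measure.integral_comp_smul (volume : Measure (Space d))
    (fun x => ‖(𝓕 ψ : L2 d) x‖ ^ 2) (2 * Real.pi)⁻¹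
  have h1 : ∫ p, ‖hat ψ p‖ ^ 2
      = fourierNorm d ^ 2 * ∫ p, ‖(𝓕 ψ : L2 d) ((2 * Real.pi)⁻¹ • p)‖ ^ 2 := by
    rw [← integral_const_mul]
    simp [hat, mul_pow]
  rw [h1, h, ← norm_sq_eq_integral, ← norm_sq_eq_integral, Lp.norm_fourier_eq]
  have h2 := fourierNorm_sq d
  rw [finrank_euclideanSpace_fin, inv_pow, inv_inv, abs_of_pos (by positivity), smul_eq_mul,
    ← mul_assoc, h2, one_mul]

/-- Non-zero dilations preserve null sets. This is needed because `hat` evaluates an `L²` class at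
rescaled points. -/
lemma hat_ae_congr_smul {f g : Space d → ℂ} (h : f =ᵐ[volume] g) {r : ℝ} (hr : r ≠ 0) :
    (fun p => f (r • p)) =ᵐ[volume] fun p => g (r • p) :=
  (Measure.quasiMeasurePreserving_smul (volume : Measure (Space d)) hr).ae_eq_comp h

lemma hat_sub (ψ φ : L2 d) : hat (ψ - φ) =ᵐ[volume] fun p => hat ψ p - hat φ p := by
  have h : (𝓕 (ψ - φ) : L2 d) = 𝓕 ψ - 𝓕 φ := (Lp.fourierTransformₗᵢ (Space d) ℂ).map_sub ψ φ
  have h2 := hat_ae_congr_smul (Lp.coeFn_sub (𝓕 ψ : L2 d) (𝓕 φ)) (r := (2 * Real.pi)⁻¹)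
    (by positivity)
  filter_upwards [h2] with p hp
  simp only [hat, h, hp, Pi.sub_apply, mul_sub]

lemma hat_smul (c : ℂ) (ψ : L2 d) : hat (c • ψ) =ᵐ[volume] fun p => c * hat ψ p := by
  have h : (𝓕 (c • ψ) : L2 d) = c • 𝓕 ψ := (Lp.fourierTransformₗᵢ (Space d) ℂ).map_smul c ψ
  have h2 := hat_ae_congr_smul (Lp.coeFn_smul c (𝓕 ψ : L2 d)) (r := (2 * Real.pi)⁻¹)
    (by positivity)
  filter_upwards [h2] with p hp
  simp only [hat, h, hp, Pi.smul_apply, smul_eq_mul]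
  ring

lemma hat_injective {ψ φ : L2 d} (h : hat ψ =ᵐ[volume] hat φ) : ψ = φ := by
  have h1 : hat (ψ - φ) =ᵐ[volume] 0 := by
    filter_upwards [hat_sub ψ φ, h] with p h1 h2
    simp [h1, h2]
  have h2 : ‖ψ - φ‖ ^ 2 = 0 := by
    rw [norm_sq_eq_integral, ← integral_hat_sq]
    rw [integral_congr_ae (g := fun _ => (0 : ℝ))]
    · simp
    · filter_upwards [h1] with p hp
      simp [hp]
  rw [← sub_eq_zero]
  simpa using h2

/-- Every square-integrable function is a Fourier transform. -/
theorem exists_hat_eq {f : Space d → ℂ} (hf : MemLp f 2) : ∃ ψ : L2 d, hat ψ =ᵐ[volume] f := by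
  have hN := fourierNorm_pos d
  let g : Space d → ℂ := fun ξ => (fourierNorm d : ℂ)⁻¹ * f ((2 * Real.pi) • ξ)
  have hgm : AEStronglyMeasurable g :=
    (hf.1.comp_quasiMeasurePreserving
      (Measure.quasiMeasurePreserving_smul volume (by positivity))).const_mul _
  have hg : MemLp g 2 := by
    rw [memLp_two_iff_integrable_sq_norm hgm]
    have h := (((memLp_two_iff_integrable_sq_norm hf.1).1 hf).comp_smul
      (R := 2 * Real.pi) (by positivity)).const_mul ((fourierNorm d)⁻¹ ^ 2)
    simpa [g, mul_pow] using h
  refine ⟨𝓕⁻ (hg.toLp g), ?_⟩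
  have h1 := hat_ae_congr_smul hg.coeFn_toLp (r := (2 * Real.pi)⁻¹) (by positivity)
  filter_upwards [h1] with p hp
  have : (fourierNorm d : ℂ) ≠ 0 := by exact_mod_cast hN.ne'
  have h2 : (2 * Real.pi) • ((2 * Real.pi)⁻¹ • p) = p := by
    rw [smul_smul, mul_inv_cancel₀ (by positivity), one_smul]
  simp only [hat, FourierTransform.fourier_fourierInv_eq, hp, g, h2]
  field_simp

/-- Fourier inversion for functions with an integrable Fourier transform. -/
theorem ae_eq_integral_hat (ψ : L2 d) (h : Integrable (hat ψ)) :
    (ψ : Space d → ℂ) =ᵐ[volume] fun x =>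
      (fourierNorm d : ℂ) * ∫ p, hat ψ p * Complex.exp (Complex.I * (inner ℝ p x : ℝ)) := by
  have hN : (fourierNorm d : ℂ) ≠ 0 := by exact_mod_cast (fourierNorm_pos d).ne'
  have hpi : (2 * Real.pi) ≠ 0 := by positivity
  have hint : Integrable ((𝓕 ψ : L2 d) : Space d → ℂ) := by
    have h1 := h.const_mul (fourierNorm d : ℂ)⁻¹
    have h2 := h1.comp_smul hpi
    refine h2.congr (Filter.Eventually.of_forall fun p => ?_)
    simp only [hat, smul_smul, inv_mul_cancel₀ hpi, one_smul]
    field_simp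
  filter_upwards [ae_eq_fourierInv_of_integrable ψ hint] with x hx
  rw [hx, Real.fourierInv_eq']
  have h3 := Measure.integral_comp_smul (volume : Measure (Space d))
    (fun v => Complex.exp (((2 * Real.pi * inner ℝ v x : ℝ) : ℂ) * Complex.I)
      • (𝓕 ψ : L2 d) v) (2 * Real.pi)⁻¹
  have hsc : |(((2 * Real.pi)⁻¹ : ℝ) ^ Module.finrank ℝ (Space d))⁻¹| = (2 * Real.pi) ^ d := by
    rw [finrank_euclideanSpace_fin, inv_pow, inv_inv, abs_of_pos (by positivity)]
  rw [hsc] at h3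
  have h4 : ∫ p, hat ψ p * Complex.exp (Complex.I * (inner ℝ p x : ℝ))
      = (fourierNorm d : ℂ) * ∫ p : Space d,
        Complex.exp (((2 * Real.pi * inner ℝ ((2 * Real.pi)⁻¹ • p) x : ℝ) : ℂ) * Complex.I)
          • (𝓕 ψ : L2 d) ((2 * Real.pi)⁻¹ • p) := by
    rw [← integral_const_mul]
    refine integral_congr_ae (Filter.Eventually.of_forall fun p => ?_)
    simp only [hat, inner_smul_left, smul_eq_mul]
    have : (2 * Real.pi * ((starRingEnd ℝ) (2 * Real.pi)⁻¹ * inner ℝ p x) : ℝ) = inner ℝ p x := by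
      simp only [conj_trivial]; field_simp
    rw [this, mul_comm Complex.I]
    ring
  rw [h4, h3, Complex.real_smul, ← mul_assoc, ← mul_assoc]
  have h5 := fourierNorm_sq d
  have h6 : (fourierNorm d : ℂ) * (fourierNorm d : ℂ) * (((2 * Real.pi) ^ d : ℝ) : ℂ) = 1 := by
    rw [← Complex.ofReal_mul, ← Complex.ofReal_mul, ← sq, h5, Complex.ofReal_one]
  rw [h6, one_mul]

end BCS

end

/-! ### Momentum cutoffs and a Sobolev inequality from level sets. -/

noncomputable section

namespace BCS

variable {d : ℕ}

/-- The Cauchy–Schwarz inequality for real integrals. -/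
theorem integral_mul_le_sqrt {α : Type*} [MeasurableSpace α] {ν : Measure α} {f g : α → ℝ}
    (hf : 0 ≤ f) (hg : 0 ≤ g) (hfm : AEStronglyMeasurable f ν) (hgm : AEStronglyMeasurable g ν)
    (hf2 : Integrable (fun x => f x ^ 2) ν) (hg2 : Integrable (fun x => g x ^ 2) ν) :
    Integrable (fun x => f x * g x) ν ∧
      ∫ x, f x * g x ∂ν ≤ Real.sqrt (∫ x, f x ^ 2 ∂ν) * Real.sqrt (∫ x, g x ^ 2 ∂ν) := by
  have hfL : MemLp f 2 ν := (memLp_two_iff_integrable_sq hfm).2 hf2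
  have hgL : MemLp g 2 ν := (memLp_two_iff_integrable_sq hgm).2 hg2
  refine ⟨hfL.integrable_mul hgL, ?_⟩
  have h := integral_mul_le_Lp_mul_Lq_of_nonneg (μ := ν) (p := 2) (q := 2)
    (by constructor <;> norm_num) (Filter.Eventually.of_forall hf)
    (Filter.Eventually.of_forall hg) (by simpa using hfL) (by simpa using hgL)
  simpa [Real.sqrt_eq_rpow] using h

/-- The squared `H¹` norm `∫ (1 + p²) |ψ̂(p)|² dp`. -/
def h1sq (ψ : L2 d) : ℝ := ∫ p, (1 + ‖p‖ ^ 2) * ‖hat ψ p‖ ^ 2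

lemma h1sq_nonneg (ψ : L2 d) : 0 ≤ h1sq ψ := integral_nonneg fun p => by positivity

/-- Restriction of `ψ` to momenta `|p| ≤ A`. -/
def cutoff (ψ : L2 d) (A : ℝ) : L2 d :=
  (exists_hat_eq ((memLp_hat ψ).indicator (s := Metric.closedBall 0 A)
    Metric.isClosed_closedBall.measurableSet)).choose

lemma hat_cutoff (ψ : L2 d) (A : ℝ) :
    hat (cutoff ψ A) =ᵐ[volume] (Metric.closedBall 0 A).indicator (hat ψ) :=
  (exists_hat_eq ((memLp_hat ψ).indicator (s := Metric.closedBall 0 A)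
    Metric.isClosed_closedBall.measurableSet)).choose_spec

lemma integrableOn_hat (ψ : L2 d) (A : ℝ) :
    IntegrableOn (hat ψ) (Metric.closedBall 0 A) := by
  have : IsFiniteMeasure (volume.restrict (Metric.closedBall (0 : Space d) A)) :=
    ⟨by simpa using measure_closedBall_lt_top⟩
  exact ((memLp_hat ψ).restrict _).integrable (by norm_num)

lemma integrable_hat_cutoff (ψ : L2 d) (A : ℝ) : Integrable (hat (cutoff ψ A)) :=
  ((integrableOn_hat ψ A).integrable_indicator
    Metric.isClosed_closedBall.measurableSet).congr (hat_cutoff ψ A).symm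

lemma norm_le_integral_hat (ψ : L2 d) (h : Integrable (hat ψ)) :
    ∀ᵐ x, ‖ψ x‖ ≤ fourierNorm d * ∫ p, ‖hat ψ p‖ := by
  filter_upwards [ae_eq_integral_hat ψ h] with x hx
  rw [hx, norm_mul, Complex.norm_real, Real.norm_of_nonneg (fourierNorm_pos d).le]
  refine mul_le_mul_of_nonneg_left ((norm_integral_le_integral_norm _).trans_eq ?_)
    (fourierNorm_pos d).le
  refine integral_congr_ae (Filter.Eventually.of_forall fun p => ?_)
  simp only [norm_mul]
  rw [mul_comm Complex.I, Complex.norm_exp_ofReal_mul_I, mul_one]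

lemma norm_cutoff_le (ψ : L2 d) (A : ℝ) :
    ∀ᵐ x, ‖cutoff ψ A x‖ ≤ fourierNorm d * ∫ p in Metric.closedBall 0 A, ‖hat ψ p‖ := by
  have h : ∫ p, ‖hat (cutoff ψ A) p‖ = ∫ p in Metric.closedBall 0 A, ‖hat ψ p‖ := by
    rw [← integral_indicator Metric.isClosed_closedBall.measurableSet]
    refine integral_congr_ae ?_
    filter_upwards [hat_cutoff ψ A] with p hp
    rw [hp]
    by_cases h : p ∈ Metric.closedBall (0 : Space d) A <;> simp [h]
  rw [← h]
  exact norm_le_integral_hat _ (integrable_hat_cutoff ψ A)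

lemma hat_sub_cutoff (ψ : L2 d) (A : ℝ) :
    hat (ψ - cutoff ψ A) =ᵐ[volume] fun p => if A < ‖p‖ then hat ψ p else 0 := by
  filter_upwards [hat_sub ψ (cutoff ψ A), hat_cutoff ψ A] with p h1 h2
  rw [h1, h2]
  by_cases h : A < ‖p‖
  · have : p ∉ Metric.closedBall (0 : Space d) A := by simpa using h
    simp [h, this]
  · have : p ∈ Metric.closedBall (0 : Space d) A := by simpa using h
    simp [h, this]

/-- Absorbs intermediate powers of the momentum into the `H¹` weight. -/
lemma rpow_le_one_add_sq {y e : ℝ} (hy : 0 ≤ y) (he : 0 ≤ e) (he2 : e ≤ 2) :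
    y ^ e ≤ 1 + y ^ 2 := by
  rcases le_total y 1 with h | h
  · have := Real.rpow_le_one hy h he
    nlinarith
  · have := Real.rpow_le_rpow_of_exponent_le h he2
    rw [Real.rpow_two] at this
    linarith

/-- Cauchy–Schwarz on a momentum ball. -/
lemma integral_hat_closedBall_le (ψ : L2 d) (hψ : MemH1 ψ) (A : ℝ) :
    ∫ p in Metric.closedBall 0 A, ‖hat ψ p‖
      ≤ Real.sqrt (∫ p in Metric.closedBall (0 : Space d) A, (1 + ‖p‖ ^ 2)⁻¹)
        * Real.sqrt (h1sq ψ) := by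
  have : IsFiniteMeasure (volume.restrict (Metric.closedBall (0 : Space d) A)) :=
    ⟨by simpa using measure_closedBall_lt_top⟩
  have hpos : ∀ p : Space d, 0 < 1 + ‖p‖ ^ 2 := fun p => by positivity
  have hc : Continuous fun p : Space d => (Real.sqrt (1 + ‖p‖ ^ 2))⁻¹ :=
    (by fun_prop : Continuous fun p : Space d => Real.sqrt (1 + ‖p‖ ^ 2)).inv₀
      fun p => (Real.sqrt_pos.2 (hpos p)).ne'
  have hsq1 : ∀ p : Space d, ((Real.sqrt (1 + ‖p‖ ^ 2))⁻¹) ^ 2 = (1 + ‖p‖ ^ 2)⁻¹ := fun p => by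
    rw [inv_pow, Real.sq_sqrt (hpos p).le]
  have hsq2 : ∀ p : Space d, (Real.sqrt (1 + ‖p‖ ^ 2) * ‖hat ψ p‖) ^ 2
      = (1 + ‖p‖ ^ 2) * ‖hat ψ p‖ ^ 2 := fun p => by
    rw [mul_pow, Real.sq_sqrt (hpos p).le]
  have hc2 : Continuous fun p : Space d => (1 + ‖p‖ ^ 2)⁻¹ :=
    (by fun_prop : Continuous fun p : Space d => (1 + ‖p‖ ^ 2)).inv₀ fun p => (hpos p).ne'
  have hcs := (integral_mul_le_sqrt (ν := volume.restrict (Metric.closedBall (0 : Space d) A))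
    (f := fun p => (Real.sqrt (1 + ‖p‖ ^ 2))⁻¹)
    (g := fun p => Real.sqrt (1 + ‖p‖ ^ 2) * ‖hat ψ p‖)
    (fun p => by positivity) (fun p => by positivity) hc.aestronglyMeasurable
    ((by fun_prop : Continuous fun p : Space d => Real.sqrt (1 + ‖p‖ ^ 2)).aestronglyMeasurable.mul
      (hat_stronglyMeasurable ψ).norm.aestronglyMeasurable)
    (by
      simp_rw [hsq1]
      exact hc2.continuousOn.integrableOn_compact (isCompact_closedBall 0 A))
    (by simp_rw [hsq2]; exact hψ.integrableOn)).2
  simp_rw [hsq1, hsq2] at hcs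
  calc ∫ p in Metric.closedBall 0 A, ‖hat ψ p‖
      = ∫ p in Metric.closedBall 0 A, (Real.sqrt (1 + ‖p‖ ^ 2))⁻¹
          * (Real.sqrt (1 + ‖p‖ ^ 2) * ‖hat ψ p‖) := by
        refine integral_congr_ae (Filter.Eventually.of_forall fun p => ?_)
        have := (Real.sqrt_pos.2 (hpos p)).ne'
        field_simp
    _ ≤ _ := hcs
    _ ≤ _ := by
        refine mul_le_mul_of_nonneg_left (Real.sqrt_le_sqrt ?_) (Real.sqrt_nonneg _)
        exact setIntegral_le_integral hψ (Filter.Eventually.of_forall fun p => by positivity)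

/-- The level sets of `ψ` are controlled by its high-momentum part. -/
lemma volume_level_le (ψ : L2 d) (hψ : MemH1 ψ) {s C G t : ℝ} (hs : 0 < s)
    (hC : ∀ A : ℝ, 0 < A →
      ∫ p in Metric.closedBall (0 : Space d) A, (1 + ‖p‖ ^ 2)⁻¹ ≤ C ^ 2 * A ^ (2 * s))
    (hC0 : 0 ≤ C) (hG : 0 < G) (hGψ : 2 * fourierNorm d * C * Real.sqrt (h1sq ψ) ≤ G)
    (ht : 0 < t) :
    volume {x | t < ‖ψ x‖} ≤ ENNReal.ofReal (4 / t ^ 2) *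
      ∫⁻ p, ENNReal.ofReal (if t < G * ‖p‖ ^ s then ‖hat ψ p‖ ^ 2 else 0) := by
  -- The cutoff depends on the height `t` so that the part of `ψ` with momenta below `A` is at most
  -- `G * A ^ s / 2 = t / 2` everywhere. Where `|ψ|` exceeds `t`, the remainder `H` exceeds `t / 2`,
  -- and Chebyshev with Plancherel applies to `H`.
  set A : ℝ := (t / G) ^ (1 / s)
  have hA : 0 < A := by positivity
  have hAs : A ^ s = t / G := by
    rw [← Real.rpow_mul (by positivity), one_div_mul_cancel hs.ne', Real.rpow_one]
  set H := ψ - cutoff ψ A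
  have hlow : fourierNorm d * ∫ p in Metric.closedBall 0 A, ‖hat ψ p‖ ≤ t / 2 := by
    have h1 := integral_hat_closedBall_le ψ hψ A
    have h2 : Real.sqrt (∫ p in Metric.closedBall (0 : Space d) A, (1 + ‖p‖ ^ 2)⁻¹)
        ≤ C * A ^ s := by
      rw [Real.sqrt_le_left (by positivity)]
      refine (hC A hA).trans_eq ?_
      rw [mul_pow, ← Real.rpow_natCast (A ^ s), ← Real.rpow_mul hA.le]
      norm_num [mul_comm]
    have hN := fourierNorm_pos d
    calc fourierNorm d * ∫ p in Metric.closedBall 0 A, ‖hat ψ p‖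
        ≤ fourierNorm d * ((C * A ^ s) * Real.sqrt (h1sq ψ)) := by
          refine mul_le_mul_of_nonneg_left (h1.trans ?_) hN.le
          exact mul_le_mul_of_nonneg_right h2 (Real.sqrt_nonneg _)
      _ = (2 * fourierNorm d * C * Real.sqrt (h1sq ψ)) * (A ^ s / 2) := by ring
      _ ≤ G * (A ^ s / 2) := mul_le_mul_of_nonneg_right hGψ (by positivity)
      _ = t / 2 := by rw [hAs]; field_simp
  have hsub : volume {x | t < ‖ψ x‖}
      ≤ volume {x | ENNReal.ofReal ((t / 2) ^ 2) ≤ ENNReal.ofReal (‖H x‖ ^ 2)} := by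
    refine measure_mono_ae ?_
    filter_upwards [norm_cutoff_le ψ A, Lp.coeFn_sub ψ (cutoff ψ A)] with x h1 h2 h3
    have h3 : t < ‖ψ x‖ := h3
    change ENNReal.ofReal ((t / 2) ^ 2) ≤ ENNReal.ofReal (‖H x‖ ^ 2)
    refine ENNReal.ofReal_le_ofReal (pow_le_pow_left₀ (by positivity) ?_ 2)
    have h4 : H x = ψ x - cutoff ψ A x := h2
    rw [h4]
    have h5 := norm_sub_norm_le (ψ x) (cutoff ψ A x)
    linarith
  have hint : ∫⁻ x, ENNReal.ofReal (‖H x‖ ^ 2)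
      ≤ ∫⁻ p, ENNReal.ofReal (if t < G * ‖p‖ ^ s then ‖hat ψ p‖ ^ 2 else 0) := by
    rw [← ofReal_integral_eq_lintegral_ofReal (integrable_norm_sq H)
      (Filter.Eventually.of_forall fun x => by positivity), ← integral_hat_sq,
      ofReal_integral_eq_lintegral_ofReal (integrable_hat_sq H)
      (Filter.Eventually.of_forall fun x => by positivity)]
    refine lintegral_mono_ae ?_
    filter_upwards [hat_sub_cutoff ψ A] with p hp
    refine ENNReal.ofReal_le_ofReal ?_
    rw [hp]
    by_cases h : A < ‖p‖
    · have h2 : t < G * ‖p‖ ^ s := by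
        have := Real.rpow_lt_rpow hA.le h hs
        rw [hAs, div_lt_iff₀ hG] at this
        linarith
      simp [h, h2]
    · simp only [h, if_false, norm_zero]
      split_ifs <;> simp
  have hcheb := mul_meas_ge_le_lintegral₀ (μ := (volume : Measure (Space d)))
    (f := fun x => ENNReal.ofReal (‖H x‖ ^ 2))
    ((Lp.stronglyMeasurable H).measurable.norm.pow_const 2).ennreal_ofReal.aemeasurable
    (ENNReal.ofReal ((t / 2) ^ 2))
  have hinv : ENNReal.ofReal (4 / t ^ 2) * ENNReal.ofReal ((t / 2) ^ 2) = 1 := by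
    rw [← ENNReal.ofReal_mul (by positivity)]
    convert ENNReal.ofReal_one using 2
    field_simp
    norm_num
  calc volume {x | t < ‖ψ x‖}
      ≤ volume {x | ENNReal.ofReal ((t / 2) ^ 2) ≤ ENNReal.ofReal (‖H x‖ ^ 2)} := hsub
    _ = ENNReal.ofReal (4 / t ^ 2) * (ENNReal.ofReal ((t / 2) ^ 2) *
          volume {x | ENNReal.ofReal ((t / 2) ^ 2) ≤ ENNReal.ofReal (‖H x‖ ^ 2)}) := by
        rw [← mul_assoc, hinv, one_mul]
    _ ≤ _ := by gcongr; exact hcheb.trans hint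

/-- Sobolev inequality by splitting each level set of `ψ` into low and high momenta. -/
theorem lintegral_rpow_le (ψ : L2 d) (hψ : MemH1 ψ) {s C G r : ℝ} (hs : 0 < s) (hr : 2 < r)
    (hsr : s * (r - 2) ≤ 2)
    (hC : ∀ A : ℝ, 0 < A →
      ∫ p in Metric.closedBall (0 : Space d) A, (1 + ‖p‖ ^ 2)⁻¹ ≤ C ^ 2 * A ^ (2 * s))
    (hC0 : 0 ≤ C) (hG : 0 < G) (hGψ : 2 * fourierNorm d * C * Real.sqrt (h1sq ψ) ≤ G) :
    ∫⁻ x, ENNReal.ofReal (‖ψ x‖ ^ r)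
      ≤ ENNReal.ofReal (4 * r / (r - 2) * G ^ (r - 2) * h1sq ψ) := by
  have hm : Measurable fun x => ‖ψ x‖ := (Lp.stronglyMeasurable ψ).measurable.norm
  have hhm : Measurable fun p => ‖hat ψ p‖ := (hat_measurable ψ).norm
  rw [lintegral_rpow_eq_lintegral_meas_lt_mul volume
    (Filter.Eventually.of_forall fun x => norm_nonneg _) hm.aemeasurable (by linarith)]
  let F : ℝ → Space d → ℝ≥0∞ := fun t p =>
    ENNReal.ofReal (if t < G * ‖p‖ ^ s then 4 * t ^ (r - 3) * ‖hat ψ p‖ ^ 2 else 0)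
  have hFm : Measurable (Function.uncurry F) := by
    refine Measurable.ennreal_ofReal (Measurable.ite ?_ ?_ measurable_const)
    · refine measurableSet_lt measurable_fst ?_
      exact measurable_const.mul (measurable_snd.norm.pow_const s)
    · exact (measurable_const.mul (measurable_fst.pow_const _)).mul
        ((hhm.comp measurable_snd).pow_const 2)
  -- Layer cake formula with the level set bound inserted; the factor `t ^ (-2)` from Chebyshev
  -- turns `t ^ (r - 1)` into `t ^ (r - 3)`.
  have h1 : ∫⁻ t in Set.Ioi (0 : ℝ), volume {x | t < ‖ψ x‖} * ENNReal.ofReal (t ^ (r - 1))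
      ≤ ∫⁻ t in Set.Ioi (0 : ℝ), ∫⁻ p, F t p := by
    refine setLIntegral_mono' measurableSet_Ioi fun t ht => ?_
    have ht : 0 < t := ht
    refine (mul_le_mul_left (volume_level_le ψ hψ hs hC hC0 hG hGψ ht) _).trans_eq ?_
    rw [mul_right_comm, ← ENNReal.ofReal_mul (by positivity), ← lintegral_const_mul]
    · refine lintegral_congr fun p => ?_
      rw [← ENNReal.ofReal_mul (by positivity)]
      congr 1
      have : t ^ (r - 1) = t ^ (r - 3) * t ^ 2 := by
        rw [← Real.rpow_natCast t 2, ← Real.rpow_add ht]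
        norm_num
        ring_nf
      split_ifs
      · rw [this]; field_simp
      · simp
    · refine Measurable.ennreal_ofReal (Measurable.ite ?_ (hhm.pow_const 2) measurable_const)
      exact measurableSet_lt measurable_const (measurable_const.mul (measurable_norm.pow_const s))
  -- For fixed `p` only heights up to `G * ‖p‖ ^ s` contribute. Since `r > 2` the integral converges
  -- at `0`, and it produces `‖p‖ ^ (s * (r - 2))`, which `s * (r - 2) ≤ 2` bounds by the `H¹`
  -- weight.
  have h2 : ∀ p : Space d, ∫⁻ t in Set.Ioi (0 : ℝ), F t p
      ≤ ENNReal.ofReal (4 / (r - 2) * G ^ (r - 2) * ((1 + ‖p‖ ^ 2) * ‖hat ψ p‖ ^ 2)) := by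
    intro p
    set b := G * ‖p‖ ^ s
    have hb : 0 ≤ b := by positivity
    have hii : IntervalIntegrable (fun t : ℝ => t ^ (r - 3)) volume 0 b :=
      intervalIntegral.intervalIntegrable_rpow' (by linarith)
    have e1 : ∫⁻ t in Set.Ioi (0 : ℝ), F t p
        ≤ ∫⁻ t in Set.Ioc 0 b, ENNReal.ofReal (4 * t ^ (r - 3) * ‖hat ψ p‖ ^ 2) := by
      rw [← lintegral_indicator measurableSet_Ioi, ← lintegral_indicator measurableSet_Ioc]
      refine lintegral_mono fun t => ?_
      simp only [Set.indicator_apply, Set.mem_Ioi, Set.mem_Ioc, F]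
      by_cases h0 : 0 < t
      · by_cases h1 : t < G * ‖p‖ ^ s
        · have : t ≤ b := h1.le
          simp [h0, h1, this]
        · simp [h1]
      · simp [h0]
    have hint : Integrable (fun t : ℝ => 4 * t ^ (r - 3) * ‖hat ψ p‖ ^ 2)
        (volume.restrict (Set.Ioc 0 b)) :=
      (((intervalIntegrable_iff_integrableOn_Ioc_of_le hb).1 hii).const_mul 4).mul_const _
    refine e1.trans ?_
    rw [← ofReal_integral_eq_lintegral_ofReal hint]
    · refine ENNReal.ofReal_le_ofReal ?_
      rw [integral_mul_const, integral_const_mul, ← intervalIntegral.integral_of_le hb,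
        integral_rpow (Or.inl (by linarith)), Real.zero_rpow (by linarith)]
      have e2 : b ^ (r - 3 + 1) ≤ G ^ (r - 2) * (1 + ‖p‖ ^ 2) := by
        have : r - 3 + 1 = r - 2 := by ring
        rw [this, Real.mul_rpow hG.le (by positivity), ← Real.rpow_mul (norm_nonneg _)]
        refine mul_le_mul_of_nonneg_left ?_ (by positivity)
        exact rpow_le_one_add_sq (norm_nonneg _) (mul_nonneg hs.le (by linarith)) hsr
      have hr2 : 0 < r - 2 := by linarith
      have : r - 3 + 1 = r - 2 := by ring
      rw [this] at e2 ⊢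
      calc 4 * ((b ^ (r - 2) - 0) / (r - 2)) * ‖hat ψ p‖ ^ 2
          = 4 / (r - 2) * b ^ (r - 2) * ‖hat ψ p‖ ^ 2 := by ring
        _ ≤ 4 / (r - 2) * (G ^ (r - 2) * (1 + ‖p‖ ^ 2)) * ‖hat ψ p‖ ^ 2 := by gcongr
        _ = _ := by ring
    · filter_upwards [ae_restrict_mem measurableSet_Ioc] with t ht
      have := ht.1
      simp only [Pi.zero_apply]
      positivity
  calc ENNReal.ofReal r * ∫⁻ t in Set.Ioi (0 : ℝ),
        volume {x | t < ‖ψ x‖} * ENNReal.ofReal (t ^ (r - 1))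
      ≤ ENNReal.ofReal r * ∫⁻ p, ∫⁻ t in Set.Ioi (0 : ℝ), F t p := by
        refine mul_le_mul_right (h1.trans_eq ?_) _
        exact lintegral_lintegral_swap hFm.aemeasurable
    _ ≤ ENNReal.ofReal r * ∫⁻ p,
          ENNReal.ofReal (4 / (r - 2) * G ^ (r - 2) * ((1 + ‖p‖ ^ 2) * ‖hat ψ p‖ ^ 2)) := by
        gcongr with p
        exact h2 p
    _ = _ := by
        have hr2 : 0 < r - 2 := by linarith
        have hMH : Integrable (fun p : Space d => (1 + ‖p‖ ^ 2) * ‖hat ψ p‖ ^ 2) := hψ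
        rw [← ofReal_integral_eq_lintegral_ofReal (hMH.const_mul _)
          (Filter.Eventually.of_forall fun x => by positivity),
          ← ENNReal.ofReal_mul (by linarith), integral_const_mul, h1sq]
        congr 1
        ring

end BCS

end

/-! ### Sobolev inequalities in dimensions one, two, three and form boundedness of the potential. -/

noncomputable section

namespace BCS

variable {d : ℕ}

/-- In polar coordinates `y ^ (d - 1) = y ^ (2 * s - 1) * y ^ (d - 2 * s)`, and the last factor is
at most `1 + y ^ 2`. Leaving `s` free lets one estimate serve both `d = 2` and `d = 3`. -/
lemma integral_closedBall_inv_le (hd : 0 < d) {s A : ℝ} (hs : 0 < s)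
    (h0 : 0 ≤ (d : ℝ) - 2 * s) (h2 : (d : ℝ) - 2 * s ≤ 2) (hA : 0 < A) :
    ∫ p in Metric.closedBall (0 : Space d) A, (1 + ‖p‖ ^ 2)⁻¹
      ≤ d * (volume : Measure (Space d)).real (Metric.ball 0 1) / (2 * s) * A ^ (2 * s) := by
  have : Nonempty (Fin d) := ⟨⟨0, hd⟩⟩
  have : Nontrivial (Space d) := inferInstance
  have e1 : ∫ p in Metric.closedBall (0 : Space d) A, (1 + ‖p‖ ^ 2)⁻¹
      = ∫ p : Space d, (Set.Iic A).indicator (fun y : ℝ => (1 + y ^ 2)⁻¹) ‖p‖ := by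
    rw [← integral_indicator Metric.isClosed_closedBall.measurableSet]
    refine integral_congr_ae (Filter.Eventually.of_forall fun p => ?_)
    by_cases h : ‖p‖ ≤ A <;> simp [Set.indicator, h]
  rw [e1, integral_fun_norm_addHaar (volume : Measure (Space d)), finrank_euclideanSpace_fin]
  have hii : IntegrableOn (fun y : ℝ => y ^ (2 * s - 1)) (Set.Ioc 0 A) :=
    (intervalIntegrable_iff_integrableOn_Ioc_of_le hA.le).1
      (intervalIntegral.intervalIntegrable_rpow' (by linarith))
  have e2 : ∫ y in Set.Ioi (0 : ℝ), y ^ (d - 1) • (Set.Iic A).indicator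
      (fun y : ℝ => (1 + y ^ 2)⁻¹) y ≤ A ^ (2 * s) / (2 * s) := by
    have e3 : ∫ y in Set.Ioi (0 : ℝ), y ^ (d - 1) • (Set.Iic A).indicator
        (fun y : ℝ => (1 + y ^ 2)⁻¹) y
        ≤ ∫ y in Set.Ioc 0 A, y ^ (2 * s - 1) := by
      rw [← integral_indicator measurableSet_Ioi, ← integral_indicator measurableSet_Ioc]
      refine integral_mono_of_nonneg (Filter.Eventually.of_forall fun y => ?_)
        (hii.integrable_indicator measurableSet_Ioc) (Filter.Eventually.of_forall fun y => ?_)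
      · simp only [Pi.zero_apply, Set.indicator_apply, Set.mem_Ioi, Set.mem_Iic, smul_eq_mul]
        split_ifs <;> positivity
      · simp only [Set.indicator_apply, Set.mem_Ioi, Set.mem_Iic, Set.mem_Ioc, smul_eq_mul]
        by_cases hy : 0 < y
        · by_cases hyA : y ≤ A
          · simp only [hy, hyA, if_true, and_self]
            have h3 := rpow_le_one_add_sq hy.le h0 h2
            have h4 : y ^ (d - 1) = y ^ (2 * s - 1) * y ^ ((d : ℝ) - 2 * s) := by
              rw [← Real.rpow_natCast, ← Real.rpow_add hy, Nat.cast_sub hd]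
              congr 1
              push_cast
              ring
            rw [h4, mul_assoc]
            refine mul_le_of_le_one_right (by positivity) ?_
            rw [← div_eq_mul_inv, div_le_one (by positivity)]
            exact h3
          · simp [hyA]
        · simp [hy]
    refine e3.trans_eq ?_
    rw [← intervalIntegral.integral_of_le hA.le, integral_rpow (Or.inl (by linarith)),
      sub_add_cancel, Real.zero_rpow (by linarith), sub_zero]
  calc d • (volume : Measure (Space d)).real (Metric.ball 0 1) •
        ∫ y in Set.Ioi (0 : ℝ), y ^ (d - 1) • (Set.Iic A).indicator
          (fun y : ℝ => (1 + y ^ 2)⁻¹) y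
      ≤ d • (volume : Measure (Space d)).real (Metric.ball 0 1) • (A ^ (2 * s) / (2 * s)) := by
        simp only [smul_eq_mul, nsmul_eq_mul] at e2 ⊢
        gcongr
    _ = _ := by
        simp only [smul_eq_mul, nsmul_eq_mul]
        ring

lemma eq_zero_of_h1sq_eq_zero {ψ : L2 d} (hψ : MemH1 ψ) (h : h1sq ψ = 0) : ψ = 0 := by
  have h2 : ‖ψ‖ ^ 2 ≤ h1sq ψ := by
    rw [norm_sq_eq_integral, ← integral_hat_sq]
    refine integral_mono (integrable_hat_sq ψ) hψ fun p => ?_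
    change ‖hat ψ p‖ ^ 2 ≤ (1 + ‖p‖ ^ 2) * ‖hat ψ p‖ ^ 2
    nlinarith [sq_nonneg (‖p‖ * ‖hat ψ p‖)]
  rw [h] at h2
  simpa using le_antisymm h2 (sq_nonneg _)

/-- Taking `G` in `lintegral_rpow_le` proportional to the `H¹` norm makes its right-hand side
homogeneous of degree `r`, so the `r`-th root is linear in that norm. -/
theorem sobolev_of_rpow (hd : 0 < d) {s r : ℝ} (hs : 0 < s) (h0 : 0 ≤ (d : ℝ) - 2 * s)
    (h2 : (d : ℝ) - 2 * s ≤ 2) (hr : 2 < r) (hsr : s * (r - 2) ≤ 2) :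
    ∃ S : ℝ, 0 ≤ S ∧ ∀ ψ : L2 d, MemH1 ψ →
      eLpNorm ψ (ENNReal.ofReal r) volume ≤ ENNReal.ofReal (S * Real.sqrt (h1sq ψ)) := by
  set C : ℝ := Real.sqrt (d * (volume : Measure (Space d)).real (Metric.ball 0 1) / (2 * s))
  have hC : ∀ A : ℝ, 0 < A →
      ∫ p in Metric.closedBall (0 : Space d) A, (1 + ‖p‖ ^ 2)⁻¹ ≤ C ^ 2 * A ^ (2 * s) := by
    intro A hA
    rw [Real.sq_sqrt (by positivity)]
    exact integral_closedBall_inv_le hd hs h0 h2 hA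
  have hC0 : 0 ≤ C := Real.sqrt_nonneg _
  have hN := fourierNorm_pos d
  set c : ℝ := 2 * fourierNorm d * C + 1
  have hc : 0 < c := by positivity
  have hr2 : 0 < r - 2 := by linarith
  set K : ℝ := 4 * r / (r - 2) * c ^ (r - 2)
  have hK : 0 ≤ K := by positivity
  refine ⟨K ^ (1 / r), by positivity, fun ψ hψ => ?_⟩
  -- A vanishing `H¹` norm is treated apart because `G` has to be positive.
  rcases (h1sq_nonneg ψ).eq_or_lt' with h | h
  · rw [eq_zero_of_h1sq_eq_zero hψ h]
    rw [eLpNorm_congr_ae (Lp.coeFn_zero ℂ 2 volume)]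
    simp
  · have hH : 0 < Real.sqrt (h1sq ψ) := Real.sqrt_pos.2 h
    have key := lintegral_rpow_le ψ hψ hs hr hsr hC hC0 (G := c * Real.sqrt (h1sq ψ))
      (by positivity) (by simp only [c]; nlinarith)
    have e1 : 4 * r / (r - 2) * (c * Real.sqrt (h1sq ψ)) ^ (r - 2) * h1sq ψ
        = K * Real.sqrt (h1sq ψ) ^ r := by
      rw [Real.mul_rpow hc.le hH.le]
      have : Real.sqrt (h1sq ψ) ^ r = Real.sqrt (h1sq ψ) ^ (r - 2) * h1sq ψ := by
        conv_rhs => rw [← Real.sq_sqrt h.le, Real.sqrt_sq (Real.sqrt_nonneg _)]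
        rw [← Real.rpow_natCast (Real.sqrt (h1sq ψ)) 2, ← Real.rpow_add hH]
        norm_num
      rw [this]
      ring
    rw [e1] at key
    rw [eLpNorm_eq_lintegral_rpow_enorm_toReal (by simp; linarith) (by simp),
      ENNReal.toReal_ofReal (by linarith)]
    have e2 : ∫⁻ x, ‖ψ x‖ₑ ^ r = ∫⁻ x, ENNReal.ofReal (‖ψ x‖ ^ r) := by
      refine lintegral_congr fun x => ?_
      rw [← ENNReal.ofReal_rpow_of_nonneg (norm_nonneg _) (by linarith), ofReal_norm]
    rw [e2]
    refine (ENNReal.rpow_le_rpow key (by positivity)).trans_eq ?_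
    rw [ENNReal.ofReal_rpow_of_nonneg (by positivity) (by positivity),
      Real.mul_rpow hK (by positivity), ← Real.rpow_mul hH.le, mul_one_div_cancel (by linarith),
      Real.rpow_one]

/-- On the line `(1 + p²)⁻¹` is integrable, so Cauchy–Schwarz puts `ψ̂` in `L¹` and Fourier
inversion bounds `ψ` uniformly. -/
theorem sobolev_one_dim : ∃ S : ℝ, 0 ≤ S ∧ ∀ ψ : L2 1, MemH1 ψ →
      eLpNorm ψ ∞ volume ≤ ENNReal.ofReal (S * Real.sqrt (h1sq ψ)) := by
  have hI : Integrable (fun p : Space 1 => (1 + ‖p‖ ^ 2)⁻¹) := by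
    have := integrable_rpow_neg_one_add_norm_sq (E := Space 1) (μ := volume) (r := 2)
      (by simp)
    refine this.congr (Filter.Eventually.of_forall fun p => ?_)
    norm_num [Real.rpow_neg_one]
  set C := Real.sqrt (∫ p : Space 1, (1 + ‖p‖ ^ 2)⁻¹)
  have hN := fourierNorm_pos 1
  refine ⟨fourierNorm 1 * C, by positivity, fun ψ hψ => ?_⟩
  have hb : ∀ n : ℕ, ∫ p in Metric.closedBall 0 (n : ℝ), ‖hat ψ p‖
      ≤ C * Real.sqrt (h1sq ψ) := by
    intro n
    refine (integral_hat_closedBall_le ψ hψ n).trans ?_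
    refine mul_le_mul_of_nonneg_right (Real.sqrt_le_sqrt ?_) (Real.sqrt_nonneg _)
    exact setIntegral_le_integral hI (Filter.Eventually.of_forall fun p => by positivity)
  have hint : Integrable (hat ψ) := by
    have hcov : AECover volume Filter.atTop fun n : ℕ => Metric.closedBall (0 : Space 1) (n : ℝ) :=
      aecover_closedBall tendsto_natCast_atTop_atTop
    exact hcov.integrable_of_integral_norm_bounded (C * Real.sqrt (h1sq ψ))
      (fun n => integrableOn_hat ψ n) (Filter.Eventually.of_forall hb)
  have htot : ∫ p, ‖hat ψ p‖ ≤ C * Real.sqrt (h1sq ψ) := by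
    have hcov : AECover volume Filter.atTop fun n : ℕ => Metric.closedBall (0 : Space 1) (n : ℝ) :=
      aecover_closedBall tendsto_natCast_atTop_atTop
    exact le_of_tendsto (hcov.integral_tendsto_of_countably_generated hint.norm)
      (Filter.Eventually.of_forall hb)
  rw [eLpNorm_exponent_top]
  refine eLpNormEssSup_le_of_ae_bound ?_
  filter_upwards [norm_le_integral_hat ψ hint] with x hx
  refine hx.trans ?_
  rw [mul_assoc]
  exact mul_le_mul_of_nonneg_left htot hN.le

/-- The potential is split by size: the part where `|V|` is large has small `L^p` norm and is
handled by Hölder and Sobolev, while the bounded rest costs only a multiple of the `L²` norm. -/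
theorem form_bound_of_sobolev {V : Space d → ℝ} {p q r : ℝ≥0∞} [p.HolderConjugate q]
    [r.HolderTriple r q] (hV : MemLp V p) {S : ℝ} (hS : 0 ≤ S)
    (hsob : ∀ ψ : L2 d, MemH1 ψ →
      eLpNorm ψ r volume ≤ ENNReal.ofReal (S * Real.sqrt (h1sq ψ))) {ε : ℝ} (hε : 0 < ε) :
    ∃ C : ℝ, 0 ≤ C ∧ ∀ ψ : L2 d, MemH1 ψ →
      ∫⁻ x, ENNReal.ofReal (|V x| * ‖ψ x‖ ^ 2)
        ≤ ENNReal.ofReal (ε * h1sq ψ + C * ∫ p, ‖hat ψ p‖ ^ 2) := by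
  let W := hV.1.mk V
  have hVW : V =ᵐ[volume] W := hV.1.ae_eq_mk
  have hWm : StronglyMeasurable W := hV.1.stronglyMeasurable_mk
  have hW : MemLp W p := (memLp_congr_ae hVW).1 hV
  -- Sobolev is used twice and costs `S ^ 2`; the summand `1` avoids division by zero.
  have hη : 0 < ε / (S ^ 2 + 1) := by positivity
  obtain ⟨M, hM⟩ := hW.eLpNorm_indicator_norm_ge_le hWm hη
  set U : Space d → ℝ := {x | M ≤ ↑‖W x‖₊}.indicator W
  have hUm : StronglyMeasurable U := by
    refine hWm.indicator (measurableSet_le measurable_const ?_)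
    exact hWm.measurable.nnnorm.coe_nnreal_real
  refine ⟨max M 0, le_max_right _ _, fun ψ hψ => ?_⟩
  have hψm := Lp.stronglyMeasurable ψ
  have h1 : ∀ x, ENNReal.ofReal (|W x| * ‖ψ x‖ ^ 2)
      ≤ ‖(U • ((ψ : Space d → ℂ) • (ψ : Space d → ℂ))) x‖ₑ
        + ENNReal.ofReal (max M 0 * ‖ψ x‖ ^ 2) := by
    intro x
    rw [← ofReal_norm, ← ENNReal.ofReal_add (norm_nonneg _) (by positivity)]
    refine ENNReal.ofReal_le_ofReal ?_
    simp only [Pi.smul_apply', norm_smul, ← sq]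
    by_cases h : M ≤ |W x|
    · have : U x = W x := Set.indicator_of_mem (by simpa using h) _
      rw [this, Real.norm_eq_abs]
      have : 0 ≤ max M 0 * ‖ψ x‖ ^ 2 := by positivity
      linarith
    · have h2 : |W x| ≤ max M 0 := (not_le.1 h).le.trans (le_max_left _ _)
      have : |W x| * ‖ψ x‖ ^ 2 ≤ max M 0 * ‖ψ x‖ ^ 2 := by gcongr
      have h3 : 0 ≤ ‖U x‖ * ‖ψ x‖ ^ 2 := by positivity
      linarith
  have h2 : ∫⁻ x, ‖(U • ((ψ : Space d → ℂ) • (ψ : Space d → ℂ))) x‖ₑ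
      ≤ ENNReal.ofReal (ε * h1sq ψ) := by
    rw [← eLpNorm_one_eq_lintegral_enorm]
    have e1 := eLpNorm_smul_le_mul_eLpNorm (p := r) (q := r) (r := q) (μ := volume)
      hψm.aestronglyMeasurable hψm.aestronglyMeasurable
    have e2 := eLpNorm_smul_le_mul_eLpNorm (p := p) (q := q) (r := 1) (μ := volume)
      (hψm.aestronglyMeasurable.smul hψm.aestronglyMeasurable) hUm.aestronglyMeasurable
    refine e2.trans ((mul_le_mul' hM e1).trans ?_)
    refine (mul_le_mul' le_rfl (mul_le_mul' (hsob ψ hψ) (hsob ψ hψ))).trans ?_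
    rw [← ENNReal.ofReal_mul (by positivity), ← ENNReal.ofReal_mul (by positivity)]
    refine ENNReal.ofReal_le_ofReal ?_
    have hs := Real.mul_self_sqrt (h1sq_nonneg ψ)
    calc ε / (S ^ 2 + 1) * (S * Real.sqrt (h1sq ψ) * (S * Real.sqrt (h1sq ψ)))
        = ε * (S ^ 2 / (S ^ 2 + 1)) * (Real.sqrt (h1sq ψ) * Real.sqrt (h1sq ψ)) := by ring
      _ ≤ ε * 1 * h1sq ψ := by
          rw [hs]
          have := h1sq_nonneg ψ
          gcongr
          rw [div_le_one (by positivity)]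
          linarith
      _ = _ := by ring
  calc ∫⁻ x, ENNReal.ofReal (|V x| * ‖ψ x‖ ^ 2)
      = ∫⁻ x, ENNReal.ofReal (|W x| * ‖ψ x‖ ^ 2) := by
        refine lintegral_congr_ae ?_
        filter_upwards [hVW] with x hx
        rw [hx]
    _ ≤ ∫⁻ x, (‖(U • ((ψ : Space d → ℂ) • (ψ : Space d → ℂ))) x‖ₑ
          + ENNReal.ofReal (max M 0 * ‖ψ x‖ ^ 2)) := lintegral_mono h1
    _ = (∫⁻ x, ‖(U • ((ψ : Space d → ℂ) • (ψ : Space d → ℂ))) x‖ₑ)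
          + ∫⁻ x, ENNReal.ofReal (max M 0 * ‖ψ x‖ ^ 2) :=
        lintegral_add_left (hUm.smul (hψm.smul hψm)).enorm _
    _ ≤ ENNReal.ofReal (ε * h1sq ψ) + ENNReal.ofReal (max M 0 * ∫ p, ‖hat ψ p‖ ^ 2) := by
        refine add_le_add h2 (le_of_eq ?_)
        rw [integral_hat_sq, ← integral_const_mul,
          ofReal_integral_eq_lintegral_ofReal ((integrable_norm_sq ψ).const_mul _)
            (Filter.Eventually.of_forall fun x => by positivity)]
    _ = _ := by
        have := h1sq_nonneg ψ
        have h3 : 0 ≤ ∫ p, ‖hat ψ p‖ ^ 2 := integral_nonneg fun p => by positivity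
        rw [ENNReal.ofReal_add (by positivity) (by positivity)]

/-- The potential is infinitesimally form bounded with respect to the kinetic energy. -/
theorem form_bound (hd : d = 1 ∨ d = 2 ∨ d = 3) {V : Space d → ℝ} (hV : IsAdmissible V)
    {ε : ℝ} (hε : 0 < ε) :
    ∃ C : ℝ, 0 ≤ C ∧ ∀ ψ : L2 d, MemH1 ψ →
      ∫⁻ x, ENNReal.ofReal (|V x| * ‖ψ x‖ ^ 2)
        ≤ ENNReal.ofReal (ε * h1sq ψ + C * ∫ p, ‖hat ψ p‖ ^ 2) := by
  rcases hd with rfl | rfl | rfl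
  · obtain ⟨S, hS, hsob⟩ := sobolev_one_dim
    have : ENNReal.HolderConjugate 1 ∞ := inferInstance
    have : ENNReal.HolderTriple ∞ ∞ ∞ := inferInstance
    exact form_bound_of_sobolev (q := ∞) hV.memLp_one hS hsob hε
  · obtain ⟨p, hp1, hp2, hp⟩ := hV.two_dim rfl
    have : Fact (1 ≤ p) := ⟨hp1.le⟩
    have hpr : 1 < p.toReal := by
      rw [← ENNReal.toReal_one]
      exact (ENNReal.toReal_lt_toReal (by simp) hp2.ne).2 hp1
    set t := p.toReal
    have ht1 : 0 < t - 1 := by linarith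
    have hpt : p = ENNReal.ofReal t := (ENNReal.ofReal_toReal hp2.ne).symm
    set q : ℝ := t / (t - 1)
    have hq : 1 < q := by rw [lt_div_iff₀ ht1]; linarith
    have hc : ENNReal.HolderConjugate p (ENNReal.ofReal q) := by
      constructor
      rw [hpt, ← ENNReal.ofReal_inv_of_pos (by linarith), ← ENNReal.ofReal_inv_of_pos (by linarith),
        ← ENNReal.ofReal_add (by positivity) (by positivity), inv_one]
      convert ENNReal.ofReal_one using 2
      simp only [q]
      field_simp
      ring
    have hc2 : ENNReal.HolderTriple (ENNReal.ofReal (2 * q)) (ENNReal.ofReal (2 * q))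
        (ENNReal.ofReal q) := by
      constructor
      rw [← ENNReal.ofReal_inv_of_pos (by linarith), ← ENNReal.ofReal_inv_of_pos (by linarith),
        ← ENNReal.ofReal_add (by positivity) (by positivity)]
      congr 1
      field_simp
      norm_num
    have hq2 : 0 < 2 * q - 2 := by linarith
    -- Any finite Sobolev exponent is available in the plane. Here `r = 2 * q` with `q` conjugate to
    -- `p`; the first entry of the minimum gives `0 ≤ d - 2 * s`, the second `s * (r - 2) ≤ 2`.
    obtain ⟨S, hS, hsob⟩ := sobolev_of_rpow (d := 2) (by norm_num) (s := min 1 (2 / (2 * q - 2)))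
      (r := 2 * q) (by positivity)
      (by have := min_le_left 1 (2 / (2 * q - 2)); push_cast; linarith)
      (by
        have : 0 < min 1 (2 / (2 * q - 2)) := by positivity
        push_cast; linarith) (by linarith)
      (by
        calc min 1 (2 / (2 * q - 2)) * (2 * q - 2) ≤ 2 / (2 * q - 2) * (2 * q - 2) := by
              gcongr; exact min_le_right _ _
          _ = 2 := div_mul_cancel₀ _ hq2.ne')
    exact form_bound_of_sobolev (q := ENNReal.ofReal q) hp hS hsob hε
  -- The critical case: both `d - 2 * s ≤ 2` and `s * (r - 2) ≤ 2` hold with equality.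
  · obtain ⟨S, hS, hsob⟩ := sobolev_of_rpow (d := 3) (by norm_num) (s := 1 / 2)
      (r := 6) (by norm_num) (by norm_num) (by norm_num) (by norm_num) (by norm_num)
    have hc : ENNReal.HolderConjugate (3 / 2) 3 := by
      constructor
      rw [← ENNReal.toReal_eq_toReal_iff' (by simp) (by simp)]
      rw [ENNReal.toReal_add (by simp) (by simp)]
      norm_num
    have hc2 : ENNReal.HolderTriple (ENNReal.ofReal 6) (ENNReal.ofReal 6) 3 := by
      constructor
      rw [← ENNReal.toReal_eq_toReal_iff' (by simp) (by simp)]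
      rw [ENNReal.toReal_add (by simp) (by simp)]
      norm_num
    exact form_bound_of_sobolev (q := 3) (hV.three_dim rfl) hS hsob hε

end BCS

end

/-! ### Density of cutoffs in `H¹`, weighted estimates for `V`, and the pair kernel. -/

noncomputable section

namespace BCS

variable {d : ℕ}

lemma memH1_of_le {ψ φ : L2 d} (hψ : MemH1 ψ) (h : ∀ᵐ p, ‖hat φ p‖ ≤ ‖hat ψ p‖) :
    MemH1 φ ∧ h1sq φ ≤ h1sq ψ := by
  have hm : Measurable fun p : Space d => (1 + ‖p‖ ^ 2) * ‖hat φ p‖ ^ 2 :=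
    ((measurable_norm.pow_const 2).const_add 1).mul ((hat_measurable φ).norm.pow_const 2)
  have hle : ∀ᵐ p, (1 + ‖p‖ ^ 2) * ‖hat φ p‖ ^ 2 ≤ (1 + ‖p‖ ^ 2) * ‖hat ψ p‖ ^ 2 := by
    filter_upwards [h] with p hp
    gcongr
  have h1 : MemH1 φ := by
    refine Integrable.mono' hψ hm.aestronglyMeasurable ?_
    filter_upwards [hle] with p hp
    rwa [Real.norm_of_nonneg (by positivity)]
  exact ⟨h1, integral_mono_ae h1 hψ hle⟩

lemma norm_hat_cutoff_le (ψ : L2 d) (A : ℝ) : ∀ᵐ p, ‖hat (cutoff ψ A) p‖ ≤ ‖hat ψ p‖ := by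
  filter_upwards [hat_cutoff ψ A] with p hp
  rw [hp]
  exact norm_indicator_le_norm_self _ _

lemma norm_hat_sub_cutoff_le (ψ : L2 d) (A : ℝ) :
    ∀ᵐ p, ‖hat (ψ - cutoff ψ A) p‖ ≤ ‖hat ψ p‖ := by
  filter_upwards [hat_sub_cutoff ψ A] with p hp
  rw [hp]
  split_ifs <;> simp

/-- Cutoffs have integrable transforms, so Fourier identities are first proved for them by Fubini
and then carried to all of `H¹` by this convergence. -/
lemma tendsto_h1sq_sub_cutoff {ψ : L2 d} (hψ : MemH1 ψ) :
    Filter.Tendsto (fun n : ℕ => h1sq (ψ - cutoff ψ n)) Filter.atTop (nhds 0) := by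
  have h0 : ∫ _ : Space d, (0 : ℝ) = 0 := by simp
  rw [← h0]
  refine tendsto_integral_of_dominated_convergence _ (fun n => ?_) hψ (fun n => ?_) ?_
  · exact (((measurable_norm.pow_const 2).const_add 1).mul
      ((hat_measurable _).norm.pow_const 2)).aestronglyMeasurable
  · filter_upwards [norm_hat_sub_cutoff_le ψ n] with p hp
    rw [Real.norm_of_nonneg (by positivity)]
    gcongr
  · have h : ∀ᵐ p, ∀ n : ℕ, hat (ψ - cutoff ψ n) p = if (n : ℝ) < ‖p‖ then hat ψ p else 0 :=
      ae_all_iff.2 fun n => hat_sub_cutoff ψ n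
    filter_upwards [h] with p hp
    refine tendsto_const_nhds.congr' ?_
    filter_upwards [Filter.eventually_ge_atTop ⌈‖p‖⌉₊] with n hn
    have : ¬ ((n : ℝ) < ‖p‖) := not_lt.2 ((Nat.le_ceil _).trans (by exact_mod_cast hn))
    rw [hp n, if_neg this]
    simp

lemma integral_hat_sq_le_h1sq {ψ : L2 d} (hψ : MemH1 ψ) : ∫ p, ‖hat ψ p‖ ^ 2 ≤ h1sq ψ := by
  refine integral_mono (integrable_hat_sq ψ) hψ fun p => ?_
  change ‖hat ψ p‖ ^ 2 ≤ (1 + ‖p‖ ^ 2) * ‖hat ψ p‖ ^ 2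
  nlinarith [sq_nonneg (‖p‖ * ‖hat ψ p‖)]

lemma integrable_and_integral_le {α : Type*} [MeasurableSpace α] {ν : Measure α} {f : α → ℝ}
    {c : ℝ} (hf : AEStronglyMeasurable f ν) (h0 : 0 ≤ f) (hc : 0 ≤ c)
    (h : ∫⁻ x, ENNReal.ofReal (f x) ∂ν ≤ ENNReal.ofReal c) :
    Integrable f ν ∧ ∫ x, f x ∂ν ≤ c := by
  have hi : Integrable f ν := by
    refine ⟨hf, ?_⟩
    rw [hasFiniteIntegral_iff_ofReal (Filter.Eventually.of_forall h0)]
    exact h.trans_lt ENNReal.ofReal_lt_top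
  refine ⟨hi, ?_⟩
  rw [← ENNReal.ofReal_le_ofReal_iff hc,
    ofReal_integral_eq_lintegral_ofReal hi (Filter.Eventually.of_forall h0)]
  exact h

lemma L2_aesm (ψ : L2 d) : AEStronglyMeasurable (fun x => ‖ψ x‖) volume :=
  (Lp.stronglyMeasurable ψ).norm.aestronglyMeasurable

theorem potential_integrable (hd : d = 1 ∨ d = 2 ∨ d = 3) {V : Space d → ℝ}
    (hV : IsAdmissible V) {ψ : L2 d} (hψ : MemH1 ψ) :
    Integrable fun x => |V x| * ‖ψ x‖ ^ 2 := by
  obtain ⟨C, hC, h⟩ := form_bound hd hV one_pos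
  have h1 := h1sq_nonneg ψ
  have h2 : 0 ≤ ∫ p, ‖hat ψ p‖ ^ 2 := integral_nonneg fun p => by positivity
  exact (integrable_and_integral_le (f := fun x => |V x| * ‖ψ x‖ ^ 2)
    (hV.memLp_one.1.norm.mul ((L2_aesm ψ).pow 2))
    (fun x => mul_nonneg (abs_nonneg _) (sq_nonneg _)) (by positivity) (h ψ hψ)).1

theorem potential_le (hd : d = 1 ∨ d = 2 ∨ d = 3) {V : Space d → ℝ} (hV : IsAdmissible V)
    {ε : ℝ} (hε : 0 < ε) : ∃ C : ℝ, 0 ≤ C ∧ ∀ ψ : L2 d, MemH1 ψ →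
      ∫ x, |V x| * ‖ψ x‖ ^ 2 ≤ ε * h1sq ψ + C * ∫ p, ‖hat ψ p‖ ^ 2 := by
  obtain ⟨C, hC, h⟩ := form_bound hd hV hε
  refine ⟨C, hC, fun ψ hψ => ?_⟩
  have h1 := h1sq_nonneg ψ
  have h2 : 0 ≤ ∫ p, ‖hat ψ p‖ ^ 2 := integral_nonneg fun p => by positivity
  exact (integrable_and_integral_le (f := fun x => |V x| * ‖ψ x‖ ^ 2)
    (hV.memLp_one.1.norm.mul ((L2_aesm ψ).pow 2))
    (fun x => mul_nonneg (abs_nonneg _) (sq_nonneg _)) (by positivity) (h ψ hψ)).2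

theorem potential_le_h1sq (hd : d = 1 ∨ d = 2 ∨ d = 3) {V : Space d → ℝ} (hV : IsAdmissible V) :
    ∃ C : ℝ, 0 ≤ C ∧ ∀ ψ : L2 d, MemH1 ψ → ∫ x, |V x| * ‖ψ x‖ ^ 2 ≤ C * h1sq ψ := by
  obtain ⟨C, hC, h⟩ := potential_le hd hV one_pos
  refine ⟨1 + C, by positivity, fun ψ hψ => (h ψ hψ).trans ?_⟩
  nlinarith [integral_hat_sq_le_h1sq hψ]

/-- Cauchy–Schwarz with respect to the weight `|V|`. -/
theorem potential_mul_le (hd : d = 1 ∨ d = 2 ∨ d = 3) {V : Space d → ℝ} (hV : IsAdmissible V)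
    {φ ψ : L2 d} (hφ : MemH1 φ) (hψ : MemH1 ψ) :
    Integrable (fun x => |V x| * (‖φ x‖ * ‖ψ x‖)) ∧ ∫ x, |V x| * (‖φ x‖ * ‖ψ x‖)
      ≤ Real.sqrt (∫ x, |V x| * ‖φ x‖ ^ 2) * Real.sqrt (∫ x, |V x| * ‖ψ x‖ ^ 2) := by
  have hs : ∀ (χ : L2 d) x, (Real.sqrt |V x| * ‖χ x‖) ^ 2 = |V x| * ‖χ x‖ ^ 2 := fun χ x => by
    rw [mul_pow, Real.sq_sqrt (abs_nonneg _)]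
  have hVm : AEStronglyMeasurable (fun x => Real.sqrt |V x|) volume :=
    Real.continuous_sqrt.comp_aestronglyMeasurable hV.memLp_one.1.norm
  have h := integral_mul_le_sqrt (ν := volume) (f := fun x => Real.sqrt |V x| * ‖φ x‖)
    (g := fun x => Real.sqrt |V x| * ‖ψ x‖) (fun x => by positivity) (fun x => by positivity)
    (hVm.mul (L2_aesm φ)) (hVm.mul (L2_aesm ψ))
    (by simp_rw [hs]; exact potential_integrable hd hV hφ)
    (by simp_rw [hs]; exact potential_integrable hd hV hψ)
  have e : ∀ x, Real.sqrt |V x| * ‖φ x‖ * (Real.sqrt |V x| * ‖ψ x‖)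
      = |V x| * (‖φ x‖ * ‖ψ x‖) := fun x => by
    rw [mul_mul_mul_comm, Real.mul_self_sqrt (abs_nonneg _)]
  simp_rw [hs, e] at h
  exact h

/-- Because `V` itself is in `L¹`, so is `Vψ`; its Fourier transform is then an integral at every
momentum, bounded uniformly. -/
theorem potential_mul_one_le (hd : d = 1 ∨ d = 2 ∨ d = 3) {V : Space d → ℝ}
    (hV : IsAdmissible V) {ψ : L2 d} (hψ : MemH1 ψ) :
    Integrable (fun x => |V x| * ‖ψ x‖) ∧ ∫ x, |V x| * ‖ψ x‖
      ≤ Real.sqrt (∫ x, |V x|) * Real.sqrt (∫ x, |V x| * ‖ψ x‖ ^ 2) := by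
  have hs : ∀ x, (Real.sqrt |V x|) ^ 2 = |V x| := fun x => Real.sq_sqrt (abs_nonneg _)
  have hs2 : ∀ x, (Real.sqrt |V x| * ‖ψ x‖) ^ 2 = |V x| * ‖ψ x‖ ^ 2 := fun x => by
    rw [mul_pow, Real.sq_sqrt (abs_nonneg _)]
  have hVm : AEStronglyMeasurable (fun x => Real.sqrt |V x|) volume :=
    Real.continuous_sqrt.comp_aestronglyMeasurable hV.memLp_one.1.norm
  have h := integral_mul_le_sqrt (ν := volume) (f := fun x => Real.sqrt |V x|)
    (g := fun x => Real.sqrt |V x| * ‖ψ x‖) (fun x => by positivity) (fun x => by positivity)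
    hVm (hVm.mul (L2_aesm ψ)) (by simp_rw [hs]; exact (memLp_one_iff_integrable.1 hV.memLp_one).abs)
    (by simp_rw [hs2]; exact potential_integrable hd hV hψ)
  have e : ∀ x, Real.sqrt |V x| * (Real.sqrt |V x| * ‖ψ x‖) = |V x| * ‖ψ x‖ := fun x => by
    rw [← mul_assoc, Real.mul_self_sqrt (abs_nonneg _)]
  simp_rw [hs, hs2, e] at h
  exact h

/-- The pair interaction in momentum space: `(2π)^{-d/2} V̂(p) = -pairKernel V p`. -/
def pairKernel (V : Space d → ℝ) (p : Space d) : ℝ := -(fourierNorm d * (potentialHat V p).re)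

/-- The order on `ℂ` forces the imaginary part of `V̂` to vanish, so nothing is lost by taking the
real part in `pairKernel`. -/
lemma ofReal_pairKernel {V : Space d → ℝ} (hneg : IsNegativeType V) (p : Space d) :
    (pairKernel V p : ℂ) = -((fourierNorm d : ℂ) * potentialHat V p) := by
  have h := hneg.hat_nonpos p
  rw [Complex.le_def] at h
  apply Complex.ext <;> simp [pairKernel, h.2]

lemma pairKernel_nonneg {V : Space d → ℝ} (hneg : IsNegativeType V) (p : Space d) :
    0 ≤ pairKernel V p := by
  have h := hneg.hat_nonpos p
  rw [Complex.le_def] at h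
  have h1 := h.1
  simp only [Complex.zero_re] at h1
  have := fourierNorm_pos d
  unfold pairKernel
  nlinarith

lemma pairKernel_zero_pos {V : Space d → ℝ} (hneg : IsNegativeType V) : 0 < pairKernel V 0 := by
  have h := hneg.hat_zero_neg
  rw [Complex.lt_def] at h
  have h1 := h.1
  simp only [Complex.zero_re] at h1
  have := fourierNorm_pos d
  unfold pairKernel
  nlinarith

lemma norm_exp_neg_I_mul (r : ℝ) : ‖Complex.exp (-Complex.I * r)‖ = 1 := by
  have : -Complex.I * r = ((-r : ℝ) : ℂ) * Complex.I := by push_cast; ring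
  rw [this, Complex.norm_exp_ofReal_mul_I]

lemma pairKernel_continuous {V : Space d → ℝ} (hV : IsAdmissible V) :
    Continuous (pairKernel V) := by
  have hVi : Integrable V := memLp_one_iff_integrable.1 hV.memLp_one
  have : Continuous (potentialHat V) := by
    unfold potentialHat
    refine continuous_const.mul (continuous_of_dominated (bound := fun x => |V x|)
      (fun p => ?_) (fun p => ?_) hVi.abs ?_)
    · exact (Complex.continuous_ofReal.comp_aestronglyMeasurable hVi.1).mul (by fun_prop : Continuous _).aestronglyMeasurable
    · refine Filter.Eventually.of_forall fun x => ?_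
      rw [norm_mul, norm_exp_neg_I_mul, Complex.norm_real, mul_one, Real.norm_eq_abs]
    · exact Filter.Eventually.of_forall fun x => by fun_prop
  unfold pairKernel
  exact (continuous_const.mul (Complex.continuous_re.comp this)).neg

lemma pairKernel_bounded {V : Space d → ℝ} :
    ∃ M, ∀ p, pairKernel V p ≤ M := by
  have hN := fourierNorm_pos d
  refine ⟨fourierNorm d * (fourierNorm d * ∫ x, |V x|), fun p => ?_⟩
  have h1 : ‖potentialHat V p‖ ≤ fourierNorm d * ∫ x, |V x| := by
    unfold potentialHat
    rw [norm_mul, Complex.norm_real, Real.norm_of_nonneg hN.le]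
    refine mul_le_mul_of_nonneg_left ((norm_integral_le_integral_norm _).trans_eq ?_) hN.le
    refine integral_congr_ae (Filter.Eventually.of_forall fun x => ?_)
    simp only [norm_mul, norm_exp_neg_I_mul, Complex.norm_real, mul_one, Real.norm_eq_abs]
  have h2 := (abs_le.1 (Complex.abs_re_le_norm (potentialHat V p))).1
  unfold pairKernel
  nlinarith

/-- Radiality of `V` enters only here. It yields the evenness of the kernel as well as the radiality
of the minimizers. -/
lemma potentialHat_isometry {V : Space d → ℝ} (hr : IsRadial V) (O : Space d ≃ₗᵢ[ℝ] Space d)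
    (p : Space d) : potentialHat V (O p) = potentialHat V p := by
  obtain ⟨f, hf⟩ := hr
  have hmp : MeasurePreserving O volume volume := O.measurePreserving
  have hO : (fun x => V (O x)) =ᵐ[volume] V := by
    filter_upwards [hf, hmp.quasiMeasurePreserving.ae_eq_comp hf] with x h1 h2
    simp only [Function.comp_apply] at h2
    rw [h1, h2, O.norm_map]
  unfold potentialHat
  congr 1
  rw [← hmp.integral_comp O.toHomeomorph.measurableEmbedding]
  refine integral_congr_ae ?_
  filter_upwards [hO] with x hx
  rw [hx, O.inner_map_map]

end BCS

end

/-! ### Multiplication by `V` as a convolution in momentum space. -/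

noncomputable section

namespace BCS

variable {d : ℕ}

/-- `(2π)^{-d/2} ∫ V(x) ψ(x) e^{-ip·x} dx`, the Fourier transform of `Vψ ∈ L¹`. -/
def potentialMulHat (V : Space d → ℝ) (ψ : L2 d) (p : Space d) : ℂ :=
  (fourierNorm d : ℂ) * ∫ x, (V x : ℂ) * ψ x * Complex.exp (-Complex.I * (inner ℝ p x : ℝ))

lemma exp_inner_sub (p q x : Space d) :
    Complex.exp (Complex.I * (inner ℝ q x : ℝ)) * Complex.exp (-Complex.I * (inner ℝ p x : ℝ))
      = Complex.exp (-Complex.I * (inner ℝ (p - q) x : ℝ)) := by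
  rw [← Complex.exp_add, inner_sub_left]
  congr 1
  push_cast
  ring

lemma aesm_ofReal {V : Space d → ℝ} (hV : IsAdmissible V) :
    AEStronglyMeasurable (fun x => (V x : ℂ)) volume :=
  Complex.continuous_ofReal.comp_aestronglyMeasurable hV.memLp_one.1

lemma integrable_ofReal {V : Space d → ℝ} (hV : IsAdmissible V) :
    Integrable (fun x => (V x : ℂ)) := (memLp_one_iff_integrable.1 hV.memLp_one).ofReal

/-- Convolution form of `(Vψ)^` for integrable `ψ̂`. -/
theorem potentialMulHat_eq_of_integrable {V : Space d → ℝ} (hV : IsAdmissible V)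
    (hneg : IsNegativeType V) (ψ : L2 d) (hψ : Integrable (hat ψ)) (p : Space d) :
    potentialMulHat V ψ p = -∫ q, (pairKernel V (p - q) : ℂ) * hat ψ q := by
  -- This is where integrability of `ψ̂` is needed: it allows Fubini in position and momentum
  -- jointly.
  have hF : Integrable (fun z : Space d × Space d => (V z.1 : ℂ) * hat ψ z.2 *
      Complex.exp (-Complex.I * (inner ℝ (p - z.2) z.1 : ℝ))) (volume.prod volume) := by
    refine ((integrable_ofReal hV).mul_prod hψ).mul_bdd (c := 1)
      (by fun_prop : Continuous _).aestronglyMeasurable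
      (Filter.Eventually.of_forall fun z => (norm_exp_neg_I_mul _).le)
  have h1 : ∫ x, (V x : ℂ) * ψ x * Complex.exp (-Complex.I * (inner ℝ p x : ℝ))
      = (fourierNorm d : ℂ) * ∫ x, ∫ q, (V x : ℂ) * hat ψ q *
        Complex.exp (-Complex.I * (inner ℝ (p - q) x : ℝ)) := by
    rw [← integral_const_mul]
    refine integral_congr_ae ?_
    filter_upwards [ae_eq_integral_hat ψ hψ] with x hx
    rw [hx]
    have : ∫ q, (V x : ℂ) * hat ψ q * Complex.exp (-Complex.I * (inner ℝ (p - q) x : ℝ))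
        = (V x : ℂ) * (∫ q, hat ψ q * Complex.exp (Complex.I * (inner ℝ q x : ℝ)))
          * Complex.exp (-Complex.I * (inner ℝ p x : ℝ)) := by
      rw [← integral_const_mul, ← integral_mul_const]
      refine integral_congr_ae (Filter.Eventually.of_forall fun q => ?_)
      simp only [← exp_inner_sub]
      ring
    rw [this]
    ring
  rw [potentialMulHat, h1, integral_integral_swap hF, ← integral_const_mul, ← integral_const_mul,
    ← integral_neg]
  refine integral_congr_ae (Filter.Eventually.of_forall fun q => ?_)
  simp only [ofReal_pairKernel hneg, potentialHat]
  have : ∫ x, (V x : ℂ) * hat ψ q * Complex.exp (-Complex.I * (inner ℝ (p - q) x : ℝ))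
      = hat ψ q * ∫ x, (V x : ℂ) * Complex.exp (-Complex.I * (inner ℝ (p - q) x : ℝ)) := by
    rw [← integral_const_mul]
    refine integral_congr_ae (Filter.Eventually.of_forall fun x => ?_)
    ring
  rw [this]
  ring

/-- Cauchy–Schwarz for the weight `|V|` and the form bound. Being uniform in `p` and linear in the
`H¹` norm, the estimate survives the removal of cutoffs. -/
lemma norm_potentialMulHat_le (hd : d = 1 ∨ d = 2 ∨ d = 3) {V : Space d → ℝ}
    (hV : IsAdmissible V) :
    ∃ C : ℝ, 0 ≤ C ∧ ∀ ψ : L2 d, MemH1 ψ → ∀ p,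
      ‖potentialMulHat V ψ p‖ ≤ C * Real.sqrt (h1sq ψ) := by
  obtain ⟨C, hC, h⟩ := potential_le_h1sq hd hV
  have hN := fourierNorm_pos d
  refine ⟨fourierNorm d * (Real.sqrt (∫ x, |V x|) * Real.sqrt C), by positivity,
    fun ψ hψ p => ?_⟩
  rw [potentialMulHat, norm_mul, Complex.norm_real, Real.norm_of_nonneg hN.le, mul_assoc]
  refine mul_le_mul_of_nonneg_left ?_ hN.le
  refine (norm_integral_le_integral_norm _).trans ?_
  have e : ∫ x, ‖(V x : ℂ) * ψ x * Complex.exp (-Complex.I * (inner ℝ p x : ℝ))‖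
      = ∫ x, |V x| * ‖ψ x‖ := by
    refine integral_congr_ae (Filter.Eventually.of_forall fun x => ?_)
    simp only [norm_mul, norm_exp_neg_I_mul, Complex.norm_real, mul_one, Real.norm_eq_abs]
  rw [e, mul_assoc]
  refine (potential_mul_one_le hd hV hψ).2.trans ?_
  refine mul_le_mul_of_nonneg_left ?_ (Real.sqrt_nonneg _)
  rw [← Real.sqrt_mul hC]
  exact Real.sqrt_le_sqrt (h ψ hψ)

lemma integrable_potential_mul (hd : d = 1 ∨ d = 2 ∨ d = 3) {V : Space d → ℝ}
    (hV : IsAdmissible V) {ψ : L2 d} (hψ : MemH1 ψ) :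
    Integrable (fun x => (V x : ℂ) * ψ x) := by
  refine (potential_mul_one_le hd hV hψ).1.mono'
    ((aesm_ofReal hV).mul (Lp.aestronglyMeasurable ψ)) (Filter.Eventually.of_forall fun x => ?_)
  rw [norm_mul, Complex.norm_real, Real.norm_eq_abs]

lemma integrable_potential_mul_exp (hd : d = 1 ∨ d = 2 ∨ d = 3) {V : Space d → ℝ}
    (hV : IsAdmissible V) {ψ : L2 d} (hψ : MemH1 ψ) (p : Space d) :
    Integrable (fun x => (V x : ℂ) * ψ x * Complex.exp (-Complex.I * (inner ℝ p x : ℝ))) :=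
  (integrable_potential_mul hd hV hψ).mul_bdd (c := 1)
    (by fun_prop : Continuous _).aestronglyMeasurable
    (Filter.Eventually.of_forall fun z => (norm_exp_neg_I_mul _).le)

lemma potentialMulHat_sub (hd : d = 1 ∨ d = 2 ∨ d = 3) {V : Space d → ℝ}
    (hV : IsAdmissible V) {ψ φ : L2 d} (hψ : MemH1 ψ) (hφ : MemH1 φ) (p : Space d) :
    potentialMulHat V (ψ - φ) p = potentialMulHat V ψ p - potentialMulHat V φ p := by
  unfold potentialMulHat
  rw [← mul_sub, ← integral_sub (integrable_potential_mul_exp hd hV hψ p)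
    (integrable_potential_mul_exp hd hV hφ p)]
  congr 1
  refine integral_congr_ae ?_
  filter_upwards [Lp.coeFn_sub ψ φ] with x hx
  rw [hx, Pi.sub_apply]
  ring

lemma memH1_cutoff {ψ : L2 d} (hψ : MemH1 ψ) (A : ℝ) : MemH1 (cutoff ψ A) :=
  (memH1_of_le hψ (norm_hat_cutoff_le ψ A)).1

lemma memH1_sub_cutoff {ψ : L2 d} (hψ : MemH1 ψ) (A : ℝ) : MemH1 (ψ - cutoff ψ A) :=
  (memH1_of_le hψ (norm_hat_sub_cutoff_le ψ A)).1

lemma tendsto_potentialMulHat_cutoff (hd : d = 1 ∨ d = 2 ∨ d = 3) {V : Space d → ℝ}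
    (hV : IsAdmissible V) {ψ : L2 d} (hψ : MemH1 ψ) (p : Space d) :
    Filter.Tendsto (fun n : ℕ => potentialMulHat V (cutoff ψ n) p) Filter.atTop
      (nhds (potentialMulHat V ψ p)) := by
  obtain ⟨C, hC, h⟩ := norm_potentialMulHat_le hd hV
  rw [tendsto_iff_norm_sub_tendsto_zero]
  have h0 : Filter.Tendsto (fun n : ℕ => C * Real.sqrt (h1sq (ψ - cutoff ψ n))) Filter.atTop
      (nhds 0) := by
    have := ((Real.continuous_sqrt.tendsto 0).comp (tendsto_h1sq_sub_cutoff hψ)).const_mul C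
    simpa using this
  refine squeeze_zero (fun n => norm_nonneg _) (fun n => ?_) h0
  rw [norm_sub_rev, ← potentialMulHat_sub hd hV hψ (memH1_cutoff hψ n)]
  exact h _ (memH1_sub_cutoff hψ n) p

/-- Non-negative functions `u` in momentum space with `∫ (1 + p²) u(p)² dp < ∞`. -/
structure MemW (u : Space d → ℝ) : Prop where
  measurable : Measurable u
  nonneg : 0 ≤ u
  integrable : Integrable fun p => (1 + ‖p‖ ^ 2) * u p ^ 2

/-- The squared norm `∫ (1 + p²) u(p)² dp`. -/
def wsq (u : Space d → ℝ) : ℝ := ∫ p, (1 + ‖p‖ ^ 2) * u p ^ 2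

lemma MemW.integrable_sq {u : Space d → ℝ} (hu : MemW u) : Integrable fun p => u p ^ 2 := by
  refine hu.integrable.mono' (hu.measurable.pow_const 2).aestronglyMeasurable
    (Filter.Eventually.of_forall fun p => ?_)
  rw [Real.norm_of_nonneg (by positivity)]
  nlinarith [sq_nonneg (‖p‖ * u p)]

lemma MemW.exists_hat {u : Space d → ℝ} (hu : MemW u) :
    ∃ ψ : L2 d, hat ψ =ᵐ[volume] (fun p => (u p : ℂ)) ∧ MemH1 ψ ∧ h1sq ψ = wsq u ∧
      ∫ p, ‖hat ψ p‖ ^ 2 = ∫ p, u p ^ 2 := by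
  have hL : MemLp (fun p => (u p : ℂ)) 2 :=
    ((memLp_two_iff_integrable_sq hu.measurable.aestronglyMeasurable).2 hu.integrable_sq).ofReal
  obtain ⟨ψ, hψ⟩ := exists_hat_eq hL
  have h2 : (fun p => ‖hat ψ p‖ ^ 2) =ᵐ[volume] fun p => u p ^ 2 := by
    filter_upwards [hψ] with p hp
    rw [hp, Complex.norm_real, Real.norm_eq_abs, sq_abs]
  have h1 : (fun p => (1 + ‖p‖ ^ 2) * ‖hat ψ p‖ ^ 2) =ᵐ[volume]
      fun p => (1 + ‖p‖ ^ 2) * u p ^ 2 := by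
    filter_upwards [h2] with p hp
    rw [hp]
  exact ⟨ψ, hψ, hu.integrable.congr h1.symm, integral_congr_ae h1, integral_congr_ae h2⟩

lemma aecover_closedBall_nat {E : Type*} [PseudoMetricSpace E] [MeasurableSpace E]
    [OpensMeasurableSpace E] (ν : Measure E) (x : E) :
    AECover ν Filter.atTop fun n : ℕ => Metric.closedBall x (n : ℝ) :=
  aecover_closedBall tendsto_natCast_atTop_atTop

/-- A non-negative function is integrable, with the same bound, if its integrals over all balls
are bounded. -/
lemma integrable_of_closedBall {E : Type*} [PseudoMetricSpace E] [MeasurableSpace E]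
    [OpensMeasurableSpace E] {ν : Measure E} {x : E} {f : E → ℝ} {c : ℝ} (h0 : 0 ≤ f)
    (hi : ∀ n : ℕ, IntegrableOn f (Metric.closedBall x n) ν)
    (hb : ∀ n : ℕ, ∫ y in Metric.closedBall x n, f y ∂ν ≤ c) :
    Integrable f ν ∧ ∫ y, f y ∂ν ≤ c := by
  have hc := aecover_closedBall_nat ν x
  have hint : Integrable f ν := hc.integrable_of_integral_bounded_of_nonneg_ae c hi
    (Filter.Eventually.of_forall h0) (Filter.Eventually.of_forall hb)
  exact ⟨hint, le_of_tendsto (hc.integral_tendsto_of_countably_generated hint)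
    (Filter.Eventually.of_forall hb)⟩

lemma integral_hat_cutoff_mul (ψ : L2 d) (A : ℝ) (g : Space d → ℂ) :
    ∫ q, g q * hat (cutoff ψ A) q = ∫ q in Metric.closedBall 0 A, g q * hat ψ q := by
  rw [← integral_indicator Metric.isClosed_closedBall.measurableSet]
  refine integral_congr_ae ?_
  filter_upwards [hat_cutoff ψ A] with q hq
  rw [hq]
  by_cases h : q ∈ Metric.closedBall (0 : Space d) A <;> simp [h]

/-- The integral over a ball is, up to sign, the transform of `V` times a cutoff function, hence
bounded independently of the ball. As the integrand is non-negative, this already gives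
integrability over the whole space, although `k` is only known to be bounded and `u` need not be in
`L¹`. -/
theorem pairKernel_conv_bound (hd : d = 1 ∨ d = 2 ∨ d = 3) {V : Space d → ℝ}
    (hV : IsAdmissible V) (hneg : IsNegativeType V) :
    ∃ C : ℝ, 0 ≤ C ∧ ∀ u : Space d → ℝ, MemW u → ∀ p,
      Integrable (fun q => pairKernel V (p - q) * u q) ∧
      ∫ q, pairKernel V (p - q) * u q ≤ C * Real.sqrt (wsq u) := by
  obtain ⟨C, hC, h⟩ := norm_potentialMulHat_le hd hV
  refine ⟨C, hC, fun u hu p => ?_⟩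
  obtain ⟨ψ, hψu, hψ, hh, -⟩ := hu.exists_hat
  have hk : Continuous fun q => pairKernel V (p - q) :=
    (pairKernel_continuous hV).comp (by fun_prop)
  obtain ⟨M, hM⟩ := pairKernel_bounded (V := V)
  refine integrable_of_closedBall (x := 0)
    (fun q => mul_nonneg (pairKernel_nonneg hneg _) (hu.nonneg q)) (fun n => ?_) (fun n => ?_)
  · have hui : IntegrableOn u (Metric.closedBall 0 (n : ℝ)) := by
      refine (integrableOn_hat ψ n).norm.congr ?_
      filter_upwards [ae_restrict_of_ae hψu] with q hq
      rw [hq, Complex.norm_real, Real.norm_of_nonneg (hu.nonneg q)]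
    refine Integrable.bdd_mul (c := M) hui hk.aestronglyMeasurable
      (Filter.Eventually.of_forall fun q => ?_)
    rw [Real.norm_of_nonneg (pairKernel_nonneg hneg _)]
    exact hM _
  · have e1 := potentialMulHat_eq_of_integrable hV hneg (cutoff ψ n) (integrable_hat_cutoff ψ n) p
    have e2 : ∫ q, (pairKernel V (p - q) : ℂ) * hat (cutoff ψ n) q
        = ((∫ q in Metric.closedBall 0 (n : ℝ), pairKernel V (p - q) * u q : ℝ) : ℂ) := by
      rw [integral_hat_cutoff_mul, ← integral_complex_ofReal]
      refine integral_congr_ae ?_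
      filter_upwards [ae_restrict_of_ae hψu] with q hq
      rw [hq]
      push_cast
      rfl
    rw [e2] at e1
    have h3 := h (cutoff ψ n) (memH1_cutoff hψ n) p
    rw [e1, norm_neg, Complex.norm_real] at h3
    refine (le_abs_self _).trans (h3.trans ?_)
    rw [← hh]
    exact mul_le_mul_of_nonneg_left
      (Real.sqrt_le_sqrt (memH1_of_le hψ (norm_hat_cutoff_le ψ n)).2) hC

lemma memW_norm_hat {ψ : L2 d} (hψ : MemH1 ψ) : MemW fun p => ‖hat ψ p‖ :=
  ⟨(hat_measurable ψ).norm, fun _ => norm_nonneg _, hψ⟩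

lemma integrable_pairKernel_mul_hat (hd : d = 1 ∨ d = 2 ∨ d = 3) {V : Space d → ℝ}
    (hV : IsAdmissible V) (hneg : IsNegativeType V) {ψ : L2 d} (hψ : MemH1 ψ) (p : Space d) :
    Integrable fun q => (pairKernel V (p - q) : ℂ) * hat ψ q := by
  obtain ⟨C, hC, h⟩ := pairKernel_conv_bound hd hV hneg
  have hk : Continuous fun q => pairKernel V (p - q) :=
    (pairKernel_continuous hV).comp (by fun_prop)
  refine (h _ (memW_norm_hat hψ) p).1.mono' ((Complex.continuous_ofReal.comp
    hk).aestronglyMeasurable.mul (hat_stronglyMeasurable ψ).aestronglyMeasurable)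
    (Filter.Eventually.of_forall fun q => ?_)
  rw [norm_mul, Complex.norm_real, Real.norm_of_nonneg (pairKernel_nonneg hneg _)]

/-- Convolution form of `(Vψ)^` for `ψ ∈ H¹`. -/
theorem potentialMulHat_eq (hd : d = 1 ∨ d = 2 ∨ d = 3) {V : Space d → ℝ}
    (hV : IsAdmissible V) (hneg : IsNegativeType V) {ψ : L2 d} (hψ : MemH1 ψ) (p : Space d) :
    potentialMulHat V ψ p = -∫ q, (pairKernel V (p - q) : ℂ) * hat ψ q := by
  -- Both sides are limits of their values at cutoffs: the left by the `H¹` bound, the right by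
  -- exhausting momentum space with balls.
  refine tendsto_nhds_unique (tendsto_potentialMulHat_cutoff hd hV hψ p) ?_
  have h1 := (aecover_closedBall_nat volume (0 : Space d)).integral_tendsto_of_countably_generated
    (integrable_pairKernel_mul_hat hd hV hneg hψ p)
  refine h1.neg.congr fun n => ?_
  rw [potentialMulHat_eq_of_integrable hV hneg _ (integrable_hat_cutoff ψ n) p,
    integral_hat_cutoff_mul]

lemma integrable_potential_form (hd : d = 1 ∨ d = 2 ∨ d = 3) {V : Space d → ℝ}
    (hV : IsAdmissible V) {φ ψ : L2 d} (hφ : MemH1 φ) (hψ : MemH1 ψ) :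
    Integrable (fun x => (V x : ℂ) * (star (φ x) * ψ x)) := by
  refine (potential_mul_le hd hV hφ hψ).1.mono' ((aesm_ofReal hV).mul
    ((continuous_star.comp_aestronglyMeasurable (Lp.aestronglyMeasurable φ)).mul
      (Lp.aestronglyMeasurable ψ))) (Filter.Eventually.of_forall fun x => ?_)
  rw [norm_mul, norm_mul, norm_star, Complex.norm_real, Real.norm_eq_abs]

/-- Parseval's identity for `∫ V φ̄ ψ` when `φ̂` is integrable. -/
theorem potential_form_eq_of_integrable (hd : d = 1 ∨ d = 2 ∨ d = 3) {V : Space d → ℝ}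
    (hV : IsAdmissible V) {φ ψ : L2 d} (hφ : Integrable (hat φ)) (hψ : MemH1 ψ) :
    ∫ x, (V x : ℂ) * (star (φ x) * ψ x) = ∫ p, star (hat φ p) * potentialMulHat V ψ p := by
  have hF : Integrable (fun z : Space d × Space d => ((V z.1 : ℂ) * ψ z.1) * star (hat φ z.2) *
      Complex.exp (-Complex.I * (inner ℝ z.2 z.1 : ℝ))) (volume.prod volume) := by
    have hs : Integrable fun p => star (hat φ p) :=
      hφ.norm.mono' (continuous_star.comp_aestronglyMeasurable hφ.1)
        (Filter.Eventually.of_forall fun p => by simp)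
    refine ((integrable_potential_mul hd hV hψ).mul_prod hs).mul_bdd (c := 1)
      (by fun_prop : Continuous _).aestronglyMeasurable
      (Filter.Eventually.of_forall fun z => (norm_exp_neg_I_mul _).le)
  have h1 : ∫ x, (V x : ℂ) * (star (φ x) * ψ x)
      = (fourierNorm d : ℂ) * ∫ x, ∫ p, ((V x : ℂ) * ψ x) * star (hat φ p) *
        Complex.exp (-Complex.I * (inner ℝ p x : ℝ)) := by
    rw [← integral_const_mul]
    refine integral_congr_ae ?_
    filter_upwards [ae_eq_integral_hat φ hφ] with x hx
    rw [hx]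
    have : ∫ p, ((V x : ℂ) * ψ x) * star (hat φ p) * Complex.exp (-Complex.I * (inner ℝ p x : ℝ))
        = ((V x : ℂ) * ψ x) *
          star (∫ p, hat φ p * Complex.exp (Complex.I * (inner ℝ p x : ℝ))) := by
      rw [Complex.star_def, ← integral_conj, ← integral_const_mul]
      refine integral_congr_ae (Filter.Eventually.of_forall fun p => ?_)
      simp only [map_mul, ← Complex.exp_conj, Complex.conj_I, Complex.conj_ofReal]
      ring
    rw [this, star_mul', Complex.star_def, Complex.conj_ofReal]
    ring
  rw [h1, integral_integral_swap hF, ← integral_const_mul]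
  refine integral_congr_ae (Filter.Eventually.of_forall fun p => ?_)
  simp only [potentialMulHat]
  have : ∫ x, ((V x : ℂ) * ψ x) * star (hat φ p) * Complex.exp (-Complex.I * (inner ℝ p x : ℝ))
      = star (hat φ p) * ∫ x, (V x : ℂ) * ψ x * Complex.exp (-Complex.I * (inner ℝ p x : ℝ)) := by
    rw [← integral_const_mul]
    refine integral_congr_ae (Filter.Eventually.of_forall fun x => ?_)
    ring
  rw [this]
  ring

end BCS

end

/-! ### The abstract properties of the kernel, and Parseval's identity for the potential energy. -/

noncomputable section

namespace BCS

variable {d : ℕ}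

/-- The properties of the momentum space interaction used in the analysis of the gap equation. -/
structure IsPairKernel (k : Space d → ℝ) : Prop where
  continuous : Continuous k
  nonneg : ∀ p, 0 ≤ k p
  zero_pos : 0 < k 0
  bounded : ∃ M, ∀ p, k p ≤ M
  isometry : ∀ (O : Space d ≃ₗᵢ[ℝ] Space d) p, k (O p) = k p
  conv_bound : ∃ C : ℝ, 0 ≤ C ∧ ∀ u : Space d → ℝ, MemW u → ∀ p,
    Integrable (fun q => k (p - q) * u q) ∧ ∫ q, k (p - q) * u q ≤ C * Real.sqrt (wsq u)
  form_bound : ∀ ε : ℝ, 0 < ε → ∃ C : ℝ, 0 ≤ C ∧ ∀ u : Space d → ℝ, MemW u →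
    Integrable (fun z : Space d × Space d => k (z.1 - z.2) * (u z.1 * u z.2))
      (volume.prod volume) ∧
    ∫ z : Space d × Space d, k (z.1 - z.2) * (u z.1 * u z.2) ∂(volume.prod volume)
      ≤ ε * wsq u + C * ∫ p, u p ^ 2

/-- On a product of balls the double integral is `-∫ V |ψₙ|²` for a cutoff `ψₙ`, which the form
bound controls uniformly; positivity of the integrand then gives integrability on the whole product.
-/
theorem pairKernel_form_bound (hd : d = 1 ∨ d = 2 ∨ d = 3) {V : Space d → ℝ}
    (hV : IsAdmissible V) (hneg : IsNegativeType V) {ε : ℝ} (hε : 0 < ε) :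
    ∃ C : ℝ, 0 ≤ C ∧ ∀ u : Space d → ℝ, MemW u →
    Integrable (fun z : Space d × Space d => pairKernel V (z.1 - z.2) * (u z.1 * u z.2))
      (volume.prod volume) ∧
    ∫ z : Space d × Space d, pairKernel V (z.1 - z.2) * (u z.1 * u z.2) ∂(volume.prod volume)
      ≤ ε * wsq u + C * ∫ p, u p ^ 2 := by
  obtain ⟨C, hC, h⟩ := potential_le hd hV hε
  refine ⟨C, hC, fun u hu => ?_⟩
  obtain ⟨ψ, hψu, hψ, hh, hh2⟩ := hu.exists_hat
  have hk : Continuous fun z : Space d × Space d => pairKernel V (z.1 - z.2) :=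
    (pairKernel_continuous hV).comp (by fun_prop)
  obtain ⟨M, hM⟩ := pairKernel_bounded (V := V)
  have hui : ∀ n : ℕ, IntegrableOn u (Metric.closedBall 0 (n : ℝ)) := fun n => by
    refine (integrableOn_hat ψ n).norm.congr ?_
    filter_upwards [ae_restrict_of_ae hψu] with q hq
    rw [hq, Complex.norm_real, Real.norm_of_nonneg (hu.nonneg q)]
  -- The product carries the maximum metric, so its balls are products of balls and truncation acts
  -- on each variable separately.
  have hres : ∀ n : ℕ, (volume.prod volume).restrict
      (Metric.closedBall ((0, 0) : Space d × Space d) (n : ℝ))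
      = (volume.restrict (Metric.closedBall (0 : Space d) n)).prod
        (volume.restrict (Metric.closedBall (0 : Space d) n)) := fun n => by
    rw [Measure.prod_restrict, closedBall_prod_same]
  have hint : ∀ n : ℕ, Integrable
      (fun z : Space d × Space d => pairKernel V (z.1 - z.2) * (u z.1 * u z.2))
      ((volume.restrict (Metric.closedBall (0 : Space d) n)).prod
        (volume.restrict (Metric.closedBall (0 : Space d) n))) := fun n => by
    refine Integrable.bdd_mul (c := M) ((hui n).mul_prod (hui n)) hk.aestronglyMeasurable
      (Filter.Eventually.of_forall fun q => ?_)
    rw [Real.norm_of_nonneg (pairKernel_nonneg hneg _)]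
    exact hM _
  refine integrable_of_closedBall (x := ((0, 0) : Space d × Space d))
    (fun z => mul_nonneg (pairKernel_nonneg hneg _)
      (mul_nonneg (hu.nonneg _) (hu.nonneg _))) (fun n => ?_) (fun n => ?_)
  · rw [IntegrableOn, hres]
    exact hint n
  · rw [hres, integral_prod _ (hint n)]
    have hn := memH1_cutoff hψ (n : ℝ)
    have e1 := potential_form_eq_of_integrable hd hV (integrable_hat_cutoff ψ n) hn
    have e2 : ∀ p, potentialMulHat V (cutoff ψ n) p
        = -((∫ q in Metric.closedBall 0 (n : ℝ), pairKernel V (p - q) * u q : ℝ) : ℂ) := by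
      intro p
      rw [potentialMulHat_eq_of_integrable hV hneg (cutoff ψ n) (integrable_hat_cutoff ψ n) p,
        integral_hat_cutoff_mul, ← integral_complex_ofReal]
      congr 1
      refine integral_congr_ae ?_
      filter_upwards [ae_restrict_of_ae hψu] with q hq
      rw [hq]
      push_cast
      rfl
    have e3 : ∫ p, star (hat (cutoff ψ n) p) * potentialMulHat V (cutoff ψ n) p
        = -((∫ p in Metric.closedBall 0 (n : ℝ), ∫ q in Metric.closedBall 0 (n : ℝ),
          pairKernel V (p - q) * (u p * u q) : ℝ) : ℂ) := by
      rw [← integral_complex_ofReal, ← integral_neg,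
        ← integral_indicator Metric.isClosed_closedBall.measurableSet]
      refine integral_congr_ae ?_
      filter_upwards [hψu, hat_cutoff ψ n] with p hp hp2
      rw [hp2, e2]
      by_cases hpn : p ∈ Metric.closedBall (0 : Space d) n
      · rw [Set.indicator_of_mem hpn, Set.indicator_of_mem hpn, hp, Complex.star_def,
          Complex.conj_ofReal, mul_neg, ← Complex.ofReal_mul, ← integral_const_mul]
        congr 2
        refine integral_congr_ae (Filter.Eventually.of_forall fun q => ?_)
        ring
      · simp [hpn]
    have e4 : ∫ x, (V x : ℂ) * (star (cutoff ψ n x) * cutoff ψ n x)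
        = ((∫ x, V x * ‖cutoff ψ n x‖ ^ 2 : ℝ) : ℂ) := by
      rw [← integral_complex_ofReal]
      refine integral_congr_ae (Filter.Eventually.of_forall fun x => ?_)
      simp only [Complex.star_def]
      rw [← Complex.normSq_eq_conj_mul_self, Complex.normSq_eq_norm_sq]
      push_cast
      rfl
    rw [e4, e3] at e1
    have e5 : ∫ p in Metric.closedBall 0 (n : ℝ), ∫ q in Metric.closedBall 0 (n : ℝ),
          pairKernel V (p - q) * (u p * u q) = -∫ x, V x * ‖cutoff ψ n x‖ ^ 2 := by
      rw [← Complex.ofReal_neg] at e1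
      linarith [Complex.ofReal_injective e1]
    rw [e5]
    have e6 : -∫ x, V x * ‖cutoff ψ n x‖ ^ 2 ≤ ∫ x, |V x| * ‖cutoff ψ n x‖ ^ 2 := by
      rw [← integral_neg]
      have hI := potential_integrable hd hV hn
      refine integral_mono (hI.mono' ?_ ?_) hI fun x => ?_
      · exact (hV.memLp_one.1.mul ((L2_aesm _).pow 2)).neg
      · refine Filter.Eventually.of_forall fun x => ?_
        rw [norm_neg, norm_mul, Real.norm_eq_abs, Real.norm_of_nonneg (by positivity)]
      · have := neg_abs_le (V x)
        have : 0 ≤ (|V x| + V x) * ‖cutoff ψ n x‖ ^ 2 := mul_nonneg (by linarith) (sq_nonneg _)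
        simp only
        linarith
    refine e6.trans ((h _ hn).trans ?_)
    rw [← hh, ← hh2]
    have h7 := memH1_of_le hψ (norm_hat_cutoff_le ψ n)
    have h8 : ∫ p, ‖hat (cutoff ψ n) p‖ ^ 2 ≤ ∫ p, ‖hat ψ p‖ ^ 2 := by
      refine integral_mono_ae (integrable_hat_sq _) (integrable_hat_sq _) ?_
      filter_upwards [norm_hat_cutoff_le ψ n] with p hp
      gcongr
    have := h7.2
    gcongr

theorem isPairKernel (hd : d = 1 ∨ d = 2 ∨ d = 3) {V : Space d → ℝ}
    (hV : IsAdmissible V) (hneg : IsNegativeType V) : IsPairKernel (pairKernel V) where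
  continuous := pairKernel_continuous hV
  nonneg := pairKernel_nonneg hneg
  zero_pos := pairKernel_zero_pos hneg
  bounded := pairKernel_bounded
  isometry O p := by rw [pairKernel, pairKernel, potentialHat_isometry hneg.radial]
  conv_bound := pairKernel_conv_bound hd hV hneg
  form_bound _ hε := pairKernel_form_bound hd hV hneg hε

lemma MemW.add {u v : Space d → ℝ} (hu : MemW u) (hv : MemW v) :
    MemW (fun p => u p + v p) := by
  refine ⟨hu.measurable.add hv.measurable, fun p => add_nonneg (hu.nonneg p) (hv.nonneg p), ?_⟩
  refine ((hu.integrable.const_mul 2).add (hv.integrable.const_mul 2)).mono'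
    (((measurable_norm.pow_const 2).const_add 1).mul
      ((hu.measurable.add hv.measurable).pow_const 2)).aestronglyMeasurable
    (Filter.Eventually.of_forall fun p => ?_)
  rw [Real.norm_of_nonneg (by positivity)]
  simp only [Pi.add_apply]
  have : 0 ≤ (1 + ‖p‖ ^ 2) * (u p - v p) ^ 2 := by positivity
  nlinarith

lemma IsPairKernel.continuous_sub {k : Space d → ℝ} (hk : IsPairKernel k) :
    Continuous fun z : Space d × Space d => k (z.1 - z.2) :=
  hk.continuous.comp (by fun_prop)

/-- Polarization by domination: `u(p) v(q) ≤ (u + v)(p) (u + v)(q)`. -/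
lemma IsPairKernel.integrable_mul {k : Space d → ℝ} (hk : IsPairKernel k) {u v : Space d → ℝ}
    (hu : MemW u) (hv : MemW v) :
    Integrable (fun z : Space d × Space d => k (z.1 - z.2) * (u z.1 * v z.2))
      (volume.prod volume) := by
  obtain ⟨C, hC, h⟩ := hk.form_bound 1 one_pos
  refine (h _ (hu.add hv)).1.mono' (hk.continuous_sub.measurable.mul
    ((hu.measurable.comp measurable_fst).mul
      (hv.measurable.comp measurable_snd))).aestronglyMeasurable
    (Filter.Eventually.of_forall fun z => ?_)
  have h1 := hu.nonneg z.1
  have h2 := hu.nonneg z.2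
  have h3 := hv.nonneg z.1
  have h4 := hv.nonneg z.2
  simp only [Pi.zero_apply] at h1 h2 h3 h4
  rw [Real.norm_of_nonneg (mul_nonneg (hk.nonneg _) (by positivity))]
  refine mul_le_mul_of_nonneg_left ?_ (hk.nonneg _)
  gcongr <;> linarith

/-- Parseval's identity for `∫ V φ̄ ψ` on `H¹`. -/
theorem potential_form_eq (hd : d = 1 ∨ d = 2 ∨ d = 3) {V : Space d → ℝ}
    (hV : IsAdmissible V) (hneg : IsNegativeType V) {φ ψ : L2 d} (hφ : MemH1 φ) (hψ : MemH1 ψ) :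
    Integrable (fun z : Space d × Space d => (pairKernel V (z.1 - z.2) : ℂ) *
      (star (hat φ z.1) * hat ψ z.2)) (volume.prod volume) ∧
    ∫ x, (V x : ℂ) * (star (φ x) * ψ x) = -∫ z : Space d × Space d,
      (pairKernel V (z.1 - z.2) : ℂ) * (star (hat φ z.1) * hat ψ z.2) ∂(volume.prod volume) := by
  have hk := isPairKernel hd hV hneg
  have hI : Integrable (fun z : Space d × Space d => (pairKernel V (z.1 - z.2) : ℂ) *
      (star (hat φ z.1) * hat ψ z.2)) (volume.prod volume) := by
    refine (hk.integrable_mul (memW_norm_hat hφ) (memW_norm_hat hψ)).mono'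
      ((Complex.continuous_ofReal.comp hk.continuous_sub).measurable.mul
        ((continuous_star.measurable.comp ((hat_measurable φ).comp measurable_fst)).mul
          ((hat_measurable ψ).comp measurable_snd))).aestronglyMeasurable
      (Filter.Eventually.of_forall fun z => ?_)
    rw [norm_mul, norm_mul, norm_star, Complex.norm_real, Real.norm_of_nonneg (hk.nonneg _)]
  refine ⟨hI, ?_⟩
  have e1 : ∀ p, ∫ q, (pairKernel V (p - q) : ℂ) * (star (hat φ p) * hat ψ q)
      = -(star (hat φ p) * potentialMulHat V ψ p) := by
    intro p
    rw [potentialMulHat_eq hd hV hneg hψ, mul_neg, neg_neg, ← integral_const_mul]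
    refine integral_congr_ae (Filter.Eventually.of_forall fun q => ?_)
    ring
  have hI2 : Integrable fun p => star (hat φ p) * potentialMulHat V ψ p := by
    have := hI.integral_prod_left
    simp_rw [e1] at this
    simpa using this.neg
  rw [integral_prod _ hI]
  simp_rw [e1]
  rw [integral_neg, neg_neg]
  -- Only `φ` is truncated. The left side converges by Cauchy–Schwarz for the weight `|V|`, the
  -- right side because the cutoff restricts the outer integral to a ball.
  have hl1 : Filter.Tendsto (fun n : ℕ => ∫ x, (V x : ℂ) * (star (cutoff φ n x) * ψ x))
      Filter.atTop (nhds (∫ x, (V x : ℂ) * (star (φ x) * ψ x))) := by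
    rw [tendsto_iff_norm_sub_tendsto_zero]
    obtain ⟨C, hC, h⟩ := potential_le_h1sq hd hV
    have h0 : Filter.Tendsto (fun n : ℕ => Real.sqrt (C * h1sq (φ - cutoff φ n))
        * Real.sqrt (∫ x, |V x| * ‖ψ x‖ ^ 2)) Filter.atTop (nhds 0) := by
      have := ((Real.continuous_sqrt.tendsto _).comp
        ((tendsto_h1sq_sub_cutoff hφ).const_mul C)).mul_const
          (Real.sqrt (∫ x, |V x| * ‖ψ x‖ ^ 2))
      simpa using this
    refine squeeze_zero (fun n => norm_nonneg _) (fun n => ?_) h0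
    have hn := memH1_sub_cutoff hφ (n : ℝ)
    rw [← integral_sub (integrable_potential_form hd hV (memH1_cutoff hφ n) hψ)
      (integrable_potential_form hd hV hφ hψ)]
    refine (norm_integral_le_integral_norm _).trans ?_
    have h3 : ∫ x, ‖(V x : ℂ) * (star (cutoff φ n x) * ψ x) - (V x : ℂ) * (star (φ x) * ψ x)‖
        = ∫ x, |V x| * (‖(φ - cutoff φ n) x‖ * ‖ψ x‖) := by
      refine integral_congr_ae ?_
      filter_upwards [Lp.coeFn_sub φ (cutoff φ n)] with x hx
      rw [hx, ← mul_sub, ← sub_mul, ← star_sub, norm_mul, norm_mul, norm_star, Complex.norm_real,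
        Real.norm_eq_abs, Pi.sub_apply, norm_sub_rev]
    rw [h3]
    refine (potential_mul_le hd hV hn hψ).2.trans ?_
    exact mul_le_mul_of_nonneg_right (Real.sqrt_le_sqrt (h _ hn)) (Real.sqrt_nonneg _)
  refine tendsto_nhds_unique hl1 ?_
  refine ((aecover_closedBall_nat volume
    (0 : Space d)).integral_tendsto_of_countably_generated hI2).congr fun n => ?_
  rw [potential_form_eq_of_integrable hd hV (integrable_hat_cutoff φ n) hψ,
    ← integral_indicator Metric.isClosed_closedBall.measurableSet]
  refine integral_congr_ae ?_
  filter_upwards [hat_cutoff φ n] with p hp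
  rw [hp]
  by_cases h : p ∈ Metric.closedBall (0 : Space d) n <;> simp [h]

end BCS

end

/-! ### Scalar analysis: the function `E / tanh(E / 2T)` and convexity of the entropy. -/

noncomputable section

namespace BCS

variable {d : ℕ}

/-- The function `E ↦ E / tanh (E / 2T)`, extended by continuity. -/
def kappa (T E : ℝ) : ℝ :=
  if T = 0 then E else if E = 0 then 2 * T else E / Real.tanh (E / (2 * T))

lemma symbolK_eq (μ T : ℝ) (Δ : Space d → ℂ) (p : Space d) :
    symbolK μ T Δ p = kappa T (dispersion μ Δ p) := rfl

lemma tanh_eq_exp (x : ℝ) :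
    Real.tanh x = (Real.exp (2 * x) - 1) / (Real.exp (2 * x) + 1) := by
  rw [Real.tanh_eq, div_eq_div_iff (by positivity) (by positivity)]
  have : Real.exp (2 * x) = Real.exp x * Real.exp x := by rw [← Real.exp_add]; ring_nf
  have h2 : Real.exp x * Real.exp (-x) = 1 := by rw [← Real.exp_add]; simp
  rw [this]
  linear_combination (-2 * Real.exp x) * h2 + 0 * h2

lemma tanh_le_tanh {x y : ℝ} (h : x ≤ y) : Real.tanh x ≤ Real.tanh y := by
  rw [tanh_eq_exp, tanh_eq_exp, div_le_div_iff₀ (by positivity) (by positivity)]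
  have : Real.exp (2 * x) ≤ Real.exp (2 * y) := Real.exp_le_exp.2 (by linarith)
  nlinarith

lemma tanh_pos {x : ℝ} (h : 0 < x) : 0 < Real.tanh x := by
  rw [tanh_eq_exp]
  have : 1 < Real.exp (2 * x) := Real.one_lt_exp_iff.2 (by linarith)
  exact div_pos (by linarith) (by positivity)

/-- A consequence of `exp (2x) ≥ 1 + 2x`; it bounds `kappa` from above by `E + 2T`. -/
lemma div_le_tanh {x : ℝ} (h : 0 ≤ x) : x / (1 + x) ≤ Real.tanh x := by
  rw [tanh_eq_exp, div_le_div_iff₀ (by positivity) (by positivity)]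
  nlinarith [Real.add_one_le_exp (2 * x)]

lemma kappa_of_pos {T E : ℝ} (hT : 0 < T) (hE : 0 < E) :
    kappa T E = E / Real.tanh (E / (2 * T)) := by
  simp [kappa, hT.ne', hE.ne']

lemma le_kappa {T E : ℝ} (hT : 0 ≤ T) (hE : 0 ≤ E) : E ≤ kappa T E := by
  rcases hT.eq_or_lt' with rfl | hT
  · simp [kappa]
  rcases hE.eq_or_lt' with rfl | hE
  · simp [kappa, hT.ne', hT.le]
  rw [kappa_of_pos hT hE, le_div_iff₀ (tanh_pos (by positivity))]
  nlinarith [Real.tanh_lt_one (E / (2 * T))]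

lemma kappa_nonneg {T E : ℝ} (hT : 0 ≤ T) (hE : 0 ≤ E) : 0 ≤ kappa T E :=
  hE.trans (le_kappa hT hE)

lemma kappa_pos {T E : ℝ} (hT : 0 ≤ T) (hE : 0 < E) : 0 < kappa T E :=
  hE.trans_le (le_kappa hT hE.le)

lemma kappa_le {T E : ℝ} (hT : 0 ≤ T) (hE : 0 ≤ E) : kappa T E ≤ E + 2 * T := by
  rcases hT.eq_or_lt' with rfl | hT
  · simp [kappa]
  rcases hE.eq_or_lt' with rfl | hE
  · simp [kappa, hT.ne']
  rw [kappa_of_pos hT hE, div_le_iff₀ (tanh_pos (by positivity))]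
  have h := div_le_tanh (x := E / (2 * T)) (by positivity)
  have h2 : E / (2 * T) / (1 + E / (2 * T)) = E / (E + 2 * T) := by field_simp; ring
  rw [h2, div_le_iff₀ (by positivity)] at h
  linarith

/-- Positive `E` suffices, because the dispersion vanishes only where the gap does and `p² = μ`,
hence at most on a null set. -/
lemma continuousAt_kappa {T E : ℝ} (hT : 0 ≤ T) (hE : 0 < E) : ContinuousAt (kappa T) E := by
  rcases hT.eq_or_lt' with rfl | hT
  · have : kappa 0 = fun E => E := by ext E; simp [kappa]
    rw [this]
    exact continuousAt_id
  · have h : ContinuousAt (fun E => E / Real.tanh (E / (2 * T))) E := by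
      refine continuousAt_id.div ?_ (tanh_pos (by positivity)).ne'
      have : Continuous fun E : ℝ => Real.tanh (E / (2 * T)) := by
        simp_rw [tanh_eq_exp]
        exact Continuous.div (by fun_prop) (by fun_prop) fun x => by positivity
      exact this.continuousAt
    refine h.congr ?_
    filter_upwards [lt_mem_nhds hE] with x hx
    rw [kappa_of_pos hT hx]

lemma measurable_kappa (T : ℝ) : Measurable (kappa T) := by
  unfold kappa
  split_ifs
  · exact measurable_id
  · refine Measurable.ite (measurableSet_singleton 0) measurable_const ?_
    refine measurable_id.div ?_
    have : Continuous fun E : ℝ => Real.tanh (E / (2 * T)) := by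
      simp_rw [tanh_eq_exp]
      exact Continuous.div (by fun_prop) (by fun_prop) fun x => by positivity
    exact this.measurable

/-- `E / (2 κ_T(E)) = tanh(E / 2T) / 2`. -/
lemma div_kappa_of_pos {T E : ℝ} (hT : 0 < T) (hE : 0 ≤ E) :
    E / (2 * kappa T E) = Real.tanh (E / (2 * T)) / 2 := by
  rcases hE.eq_or_lt' with rfl | hE
  · simp
  · have := tanh_pos (x := E / (2 * T)) (by positivity)
    rw [kappa_of_pos hT hE]
    field_simp

lemma div_kappa_zero {E : ℝ} (hE : 0 < E) : E / (2 * kappa 0 E) = 1 / 2 := by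
  simp only [kappa, if_true]
  field_simp

lemma div_kappa_nonneg {T E : ℝ} (hT : 0 ≤ T) (hE : 0 ≤ E) : 0 ≤ E / (2 * kappa T E) :=
  div_nonneg hE (by linarith [kappa_nonneg hT hE])

lemma div_kappa_le {T E : ℝ} (hT : 0 ≤ T) (hE : 0 ≤ E) : E / (2 * kappa T E) ≤ 1 / 2 := by
  rcases hE.eq_or_lt' with rfl | hE
  · simp
  rw [div_le_div_iff₀ (by linarith [kappa_pos hT hE]) (by norm_num)]
  linarith [le_kappa hT hE.le]

lemma div_kappa_mono {T E E' : ℝ} (hT : 0 ≤ T) (hE : 0 < E) (h : E ≤ E') :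
    E / (2 * kappa T E) ≤ E' / (2 * kappa T E') := by
  rcases hT.eq_or_lt' with rfl | hT
  · rw [div_kappa_zero hE, div_kappa_zero (hE.trans_le h)]
  · rw [div_kappa_of_pos hT hE.le, div_kappa_of_pos hT (hE.le.trans h)]
    have := tanh_le_tanh (x := E / (2 * T)) (y := E' / (2 * T)) (by gcongr)
    linarith

/-- Monotonicity of the gap map: `D ↦ D / κ_T(√(ξ² + D²))` is increasing. -/
lemma gapMap_mono {T ξ D D' : ℝ} (hT : 0 ≤ T) (hD : 0 ≤ D) (h : D ≤ D') :
    D / (2 * kappa T (Real.sqrt (ξ ^ 2 + D ^ 2)))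
      ≤ D' / (2 * kappa T (Real.sqrt (ξ ^ 2 + D' ^ 2))) := by
  rcases hD.eq_or_lt' with rfl | hD
  · rw [zero_div]
    exact div_nonneg h (by linarith [kappa_nonneg hT (Real.sqrt_nonneg (ξ ^ 2 + D' ^ 2))])
  have hD' : 0 < D' := hD.trans_le h
  set E := Real.sqrt (ξ ^ 2 + D ^ 2)
  set E' := Real.sqrt (ξ ^ 2 + D' ^ 2)
  have hE : 0 < E := Real.sqrt_pos.2 (by positivity)
  have hE' : 0 < E' := Real.sqrt_pos.2 (by positivity)
  have hEE : E ≤ E' := Real.sqrt_le_sqrt (by gcongr)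
  -- The quantity factors as `(D / E) * (E / (2κ))`, and each factor increases with `D`.
  have hratio : D / E ≤ D' / E' := by
    rw [div_le_div_iff₀ hE hE']
    refine abs_le_of_sq_le_sq' ?_ (by positivity) |>.2
    rw [mul_pow, mul_pow, Real.sq_sqrt (by positivity), Real.sq_sqrt (by positivity)]
    have : D ^ 2 ≤ D' ^ 2 := by gcongr
    nlinarith [sq_nonneg ξ]
  have h1 := div_kappa_mono hT hE hEE
  have e : D / (2 * kappa T E) = (D / E) * (E / (2 * kappa T E)) := by field_simp
  have e' : D' / (2 * kappa T E') = (D' / E') * (E' / (2 * kappa T E')) := by field_simp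
  rw [e, e']
  exact mul_le_mul hratio h1 (div_kappa_nonneg hT hE.le) (by positivity)

/-- The entropy density as a function of the distance of `Γ̂` from `1/2`. -/
def hfun (r : ℝ) : ℝ := -Real.binEntropy (1 / 2 + r)

/-- The derivative of `hfun`. -/
def hslope (r : ℝ) : ℝ := Real.log (1 / 2 + r) - Real.log (1 / 2 - r)

lemma hasDerivAt_hslope {r : ℝ} (h1 : -(1 / 2) < r) (h2 : r < 1 / 2) :
    HasDerivAt hslope ((1 / 2 + r)⁻¹ + (1 / 2 - r)⁻¹) r := by
  have e1 : HasDerivAt (fun r : ℝ => Real.log (1 / 2 + r)) ((1 / 2 + r)⁻¹) r := by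
    have := ((hasDerivAt_id r).const_add (1 / 2 : ℝ)).log (by simp; linarith)
    simpa using this
  have e2 : HasDerivAt (fun r : ℝ => Real.log (1 / 2 - r)) (-(1 / 2 - r)⁻¹) r := by
    have := ((hasDerivAt_id r).const_sub (1 / 2 : ℝ)).log (by simp; linarith)
    simpa [neg_div] using this
  have := e1.sub e2
  rw [sub_neg_eq_add] at this
  exact this

lemma inv_add_inv_half {r : ℝ} (h1 : -(1 / 2) < r) (h2 : r < 1 / 2) :
    (1 / 2 + r)⁻¹ + (1 / 2 - r)⁻¹ = (1 / 4 - r ^ 2)⁻¹ := by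
  rw [inv_add_inv (by linarith) (by linarith), show 1 / 2 + r + (1 / 2 - r) = 1 by ring, one_div]
  congr 1
  ring

/-- The derivative is `1 / (1/4 - r²)`, which increases for `r ≥ 0`. -/
lemma strictConvexOn_hslope : StrictConvexOn ℝ (Set.Ico 0 (1 / 2)) hslope := by
  refine StrictMonoOn.strictConvexOn_of_deriv (convex_Ico _ _) ?_ ?_
  · intro r hr
    exact (hasDerivAt_hslope (by linarith [hr.1]) hr.2).continuousAt.continuousWithinAt
  · rw [interior_Ico]
    intro a ha b hb hab
    rw [(hasDerivAt_hslope (by linarith [ha.1]) ha.2).deriv,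
      (hasDerivAt_hslope (by linarith [hb.1]) hb.2).deriv]
    rw [inv_add_inv_half (by linarith [ha.1]) ha.2, inv_add_inv_half (by linarith [hb.1]) hb.2]
    apply inv_strictAnti₀
    · nlinarith [hb.1, hb.2]
    · nlinarith [ha.1, hb.1]

lemma hslope_zero : hslope 0 = 0 := by simp [hslope]

/-- A strictly convex function vanishing at `0` has increasing chord slopes `hslope r / r`. This
ratio is twice the derivative of `hfun` with respect to `r²`, so the lemma expresses convexity in
that variable. -/
lemma hslope_mul_lt {a b : ℝ} (ha : 0 < a) (hab : a < b) (hb : b < 1 / 2) :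
    hslope a * b < hslope b * a := by
  have hb0 : 0 < b := ha.trans hab
  have h := strictConvexOn_hslope.2 (⟨le_rfl, by norm_num⟩ : (0 : ℝ) ∈ Set.Ico 0 (1 / 2))
    (⟨hb0.le, hb⟩ : b ∈ Set.Ico 0 (1 / 2)) hb0.ne
    (show 0 < 1 - a / b by rw [sub_pos, div_lt_one hb0]; exact hab)
    (show 0 < a / b by positivity) (by ring)
  simp only [smul_eq_mul, mul_zero, zero_add, hslope_zero] at h
  rw [div_mul_cancel₀ _ hb0.ne'] at h
  calc hslope a * b < a / b * hslope b * b := by gcongr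
    _ = _ := by field_simp

/-- The limiting case of slope comparison at `r = 0`, used when `E = 0` and `κ = 2T`. -/
lemma four_mul_lt_hslope {r : ℝ} (h0 : 0 < r) (h1 : r < 1 / 2) : 4 * r < hslope r := by
  have hd : ∀ x ∈ Set.Ico (0 : ℝ) (1 / 2), HasDerivAt (fun r => hslope r - 4 * r)
      ((1 / 2 + x)⁻¹ + (1 / 2 - x)⁻¹ - 4) x := fun x hx => by
    have := (hasDerivAt_hslope (by linarith [hx.1]) hx.2).sub ((hasDerivAt_id x).const_mul 4)
    rw [mul_one] at this
    exact this
  have hm : StrictMonoOn (fun r => hslope r - 4 * r) (Set.Ico (0 : ℝ) (1 / 2)) := by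
    refine strictMonoOn_of_deriv_pos (convex_Ico _ _)
      (fun x hx => (hd x hx).continuousAt.continuousWithinAt) fun x hx => ?_
    rw [interior_Ico] at hx
    rw [(hd x ⟨hx.1.le, hx.2⟩).deriv]
    have h1 : 0 < 1 / 2 + x := by linarith [hx.1]
    have h2 : 0 < 1 / 2 - x := by linarith [hx.2]
    have h3 : 0 < 1 / 4 - x ^ 2 := by nlinarith
    rw [inv_add_inv_half (by linarith) hx.2, sub_pos, lt_inv_comm₀ (by norm_num) h3]
    nlinarith [hx.1]
  have := hm ⟨le_rfl, by norm_num⟩ ⟨h0.le, h1⟩ h0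
  simp only [hslope_zero] at this
  linarith

/-- With `x = E / 2T` this is stationarity: at `r₀ = tanh(E / 2T) / 2` one has `T h'(r₀) = E = 2 κ
r₀`. -/
lemma hslope_tanh (x : ℝ) : hslope (Real.tanh x / 2) = 2 * x := by
  have hp : Real.exp (2 * x) + 1 ≠ 0 := by positivity
  have e1 : 1 / 2 + Real.tanh x / 2 = Real.exp (2 * x) / (Real.exp (2 * x) + 1) := by
    rw [tanh_eq_exp]; field_simp; ring
  have e2 : 1 / 2 - Real.tanh x / 2 = 1 / (Real.exp (2 * x) + 1) := by
    rw [tanh_eq_exp]; field_simp; ring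
  rw [hslope, e1, e2, Real.log_div (by positivity) hp, Real.log_div one_ne_zero hp, Real.log_exp,
    Real.log_one]
  ring

lemma hasDerivAt_hfun {r : ℝ} (h1 : -(1 / 2) < r) (h2 : r < 1 / 2) :
    HasDerivAt hfun (hslope r) r := by
  have h := (Real.hasDerivAt_binEntropy (p := 1 / 2 + r) (by linarith) (by linarith)).comp r
    ((hasDerivAt_id r).const_add (1 / 2))
  have h3 := h.neg
  have e : -((Real.log (1 - (1 / 2 + r)) - Real.log (1 / 2 + r)) * 1) = hslope r := by
    rw [hslope, show 1 - (1 / 2 + r) = 1 / 2 - r by ring]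
    ring
  rw [e] at h3
  exact h3

lemma continuous_hfun : Continuous hfun := by
  unfold hfun
  fun_prop

/-- Sign of the derivative of `r ↦ T h(r) - κ r²` around `r₀ = E / 2κ`. -/
lemma sign_deriv {T E : ℝ} (hT : 0 < T) (hE : 0 ≤ E) {r : ℝ} (h0 : 0 < r) (h1 : r < 1 / 2) :
    (E / (2 * kappa T E) < r → 0 < T * hslope r - kappa T E * (2 * r)) ∧
    (r < E / (2 * kappa T E) → T * hslope r - kappa T E * (2 * r) < 0) := by
  rcases hE.eq_or_lt' with rfl | hE
  · have hk : kappa T 0 = 2 * T := by simp [kappa, hT.ne']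
    refine ⟨fun _ => ?_, fun h => ?_⟩
    · rw [hk]
      nlinarith [four_mul_lt_hslope h0 h1]
    · simp at h
      linarith
  · have hκ := kappa_pos hT.le hE
    set r₀ := E / (2 * kappa T E)
    have hr₀ : r₀ = Real.tanh (E / (2 * T)) / 2 := div_kappa_of_pos hT hE.le
    have hr₀p : 0 < r₀ := by positivity
    have hr₀l : r₀ < 1 / 2 := by
      rw [hr₀]
      linarith [Real.tanh_lt_one (E / (2 * T))]
    have hs : T * hslope r₀ = kappa T E * (2 * r₀) := by
      rw [hr₀, hslope_tanh, ← hr₀]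
      simp only [r₀]
      field_simp
    refine ⟨fun h => ?_, fun h => ?_⟩
    · have := hslope_mul_lt hr₀p h h1
      have h3 : T * (hslope r₀ * r) < T * (hslope r * r₀) := mul_lt_mul_of_pos_left this hT
      have h4 : 0 < (T * hslope r - kappa T E * (2 * r)) * r₀ := by
        have : kappa T E * (2 * r) * r₀ = T * hslope r₀ * r := by rw [hs]; ring
        nlinarith
      exact (pos_iff_pos_of_mul_pos h4).2 hr₀p
    · have := hslope_mul_lt h0 h hr₀l
      have h3 : T * (hslope r * r₀) < T * (hslope r₀ * r) := mul_lt_mul_of_pos_left this hT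
      have h4 : 0 < (kappa T E * (2 * r) - T * hslope r) * r₀ := by
        have : kappa T E * (2 * r) * r₀ = T * hslope r₀ * r := by rw [hs]; ring
        nlinarith
      linarith [(pos_iff_pos_of_mul_pos h4).2 hr₀p]

/-- Convexity of the entropy as a function of `r²`, with its equality case. -/
theorem entropy_convexity {T E r : ℝ} (hT : 0 ≤ T) (hE : 0 ≤ E) (hκ : 0 < kappa T E)
    (h0 : 0 ≤ r) (h1 : r ≤ 1 / 2) :
    kappa T E * (r ^ 2 - (E / (2 * kappa T E)) ^ 2)
        ≤ T * (hfun r - hfun (E / (2 * kappa T E))) ∧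
    (T * (hfun r - hfun (E / (2 * kappa T E)))
        = kappa T E * (r ^ 2 - (E / (2 * kappa T E)) ^ 2) → r = E / (2 * kappa T E)) := by
  set r₀ := E / (2 * kappa T E) with hr₀
  rcases hT.eq_or_lt' with rfl | hT
  · have hE' : 0 < E := by simpa [kappa] using hκ
    -- At zero temperature `r₀` is the largest admissible value, and the claim reduces to `r ^ 2 ≤ 1
    -- / 4`.
    have : r₀ = 1 / 2 := div_kappa_zero hE'
    rw [this]
    refine ⟨?_, fun h => ?_⟩
    · rw [zero_mul]
      exact mul_nonpos_of_nonneg_of_nonpos hκ.le (by nlinarith)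
    · rw [zero_mul, eq_comm, mul_eq_zero] at h
      rcases h with h | h
      · exact absurd h hκ.ne'
      · nlinarith
  · have hr0 : 0 ≤ r₀ := div_kappa_nonneg hT.le hE
    have hr1 : r₀ ≤ 1 / 2 := div_kappa_le hT.le hE
    let g : ℝ → ℝ := fun r => T * hfun r - kappa T E * r ^ 2
    have hgc : Continuous g := by
      have := continuous_hfun
      fun_prop
    have hgd : ∀ x, 0 < x → x < 1 / 2 →
        deriv g x = T * hslope x - kappa T E * (2 * x) := fun x hx hx2 => by
      have := ((hasDerivAt_hfun (by linarith) hx2).const_mul T).sub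
        ((hasDerivAt_pow 2 x).const_mul (kappa T E))
      rw [show ((2 : ℕ) : ℝ) * x ^ (2 - 1) = 2 * x by norm_num] at this
      exact this.deriv
    -- By `sign_deriv` the function `g` strictly decreases on `[0, r₀]` and strictly increases on
    -- `[r₀, 1/2]`, so `r₀` is its unique minimum; this contains both the inequality and the
    -- equality case.
    have key : r ≠ r₀ → g r₀ < g r := by
      intro hne
      rcases lt_or_gt_of_ne hne with h | h
      · refine (strictAntiOn_of_deriv_neg (convex_Icc 0 r₀) hgc.continuousOn fun x hx => ?_)
          ⟨h0, h.le⟩ ⟨hr0, le_rfl⟩ h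
        rw [interior_Icc] at hx
        have hx2 : x < 1 / 2 := hx.2.trans_le hr1
        rw [hgd x hx.1 hx2]
        exact (sign_deriv hT hE hx.1 hx2).2 hx.2
      · refine (strictMonoOn_of_deriv_pos (convex_Icc r₀ (1 / 2)) hgc.continuousOn fun x hx => ?_)
          ⟨le_rfl, hr1⟩ ⟨h.le, h1⟩ h
        rw [interior_Icc] at hx
        have hx1 : 0 < x := hr0.trans_lt hx.1
        rw [hgd x hx1 hx.2]
        exact (sign_deriv hT hE hx1 hx.2).1 hx.1
    refine ⟨?_, fun h => ?_⟩
    · by_cases hne : r = r₀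
      · rw [hne]; simp
      · have := key hne
        simp only [g] at this
        linarith
    · by_contra hne
      have := key hne
      simp only [g] at this
      linarith

lemma hfun_nonpos {r : ℝ} (h0 : 0 ≤ r) (h1 : r ≤ 1 / 2) : hfun r ≤ 0 := by
  have := Real.binEntropy_nonneg (p := 1 / 2 + r) (by linarith) (by linarith)
  unfold hfun
  linarith

/-- Decay of `1/4 - r₀²` for large energies. -/
lemma quarter_sub_sq_le {T E : ℝ} (hT : 0 < T) (hE : 0 ≤ E) :
    1 / 4 - (E / (2 * kappa T E)) ^ 2 ≤ Real.exp (-(E / T)) := by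
  rw [div_kappa_of_pos hT hE, tanh_eq_exp]
  have e : 2 * (E / (2 * T)) = E / T := by field_simp
  rw [e, Real.exp_neg]
  have : 0 < Real.exp (E / T) := Real.exp_pos _
  have e2 : 1 / 4 - ((Real.exp (E / T) - 1) / (Real.exp (E / T) + 1) / 2) ^ 2
      = Real.exp (E / T) / (Real.exp (E / T) + 1) ^ 2 := by
    field_simp; ring
  rw [e2, div_le_iff₀ (by positivity), ← div_eq_inv_mul, le_div_iff₀ this]
  nlinarith

end BCS

end

/-! ### Convolution operators with a positive kernel and the Schur test. -/

noncomputable section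

namespace BCS

variable {d : ℕ}

/-- Convolution with the pair kernel. -/
def conv (k u : Space d → ℝ) (p : Space d) : ℝ := ∫ q, k (p - q) * u q

/-- The quadratic form of the pair kernel. -/
def pairForm (k u : Space d → ℝ) : ℝ :=
  ∫ z : Space d × Space d, k (z.1 - z.2) * (u z.1 * u z.2) ∂(volume.prod volume)

lemma MemW.of_le {u v : Space d → ℝ} (hv : MemW v) (hm : Measurable u) (h0 : 0 ≤ u) (h : u ≤ v) :
    MemW u := by
  refine ⟨hm, h0, hv.integrable.mono' (((measurable_norm.pow_const 2).const_add 1).mul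
    (hm.pow_const 2)).aestronglyMeasurable (Filter.Eventually.of_forall fun p => ?_)⟩
  rw [Real.norm_of_nonneg (by positivity)]
  have := h p
  have := h0 p
  simp only [Pi.zero_apply] at this
  gcongr

lemma memW_const_indicator (c : ℝ) (hc : 0 ≤ c) (R : ℝ) :
    MemW fun p : Space d => if ‖p‖ ≤ R then c else 0 := by
  have hs : MeasurableSet {p : Space d | ‖p‖ ≤ R} := measurableSet_le measurable_norm
    measurable_const
  refine ⟨Measurable.ite hs measurable_const measurable_const, fun p => ?_, ?_⟩
  · simp only [Pi.zero_apply]; split_ifs <;> simp [hc]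
  · have : (fun p : Space d => (1 + ‖p‖ ^ 2) * (if ‖p‖ ≤ R then c else 0) ^ 2)
        = (Metric.closedBall 0 R).indicator fun p => (1 + ‖p‖ ^ 2) * c ^ 2 := by
      ext p
      by_cases h : ‖p‖ ≤ R <;> simp [Set.indicator, h]
    rw [this, integrable_indicator_iff Metric.isClosed_closedBall.measurableSet]
    exact (by fun_prop : Continuous fun p : Space d => (1 + ‖p‖ ^ 2) * c ^ 2).continuousOn
      |>.integrableOn_compact (isCompact_closedBall 0 R)

namespace IsPairKernel

variable {k : Space d → ℝ}

lemma neg_eq (hk : IsPairKernel k) (p : Space d) : k (-p) = k p :=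
  hk.isometry (LinearIsometryEquiv.neg ℝ) p

lemma sub_comm (hk : IsPairKernel k) (p q : Space d) : k (p - q) = k (q - p) := by
  rw [← neg_sub, hk.neg_eq]

lemma integrable_conv (hk : IsPairKernel k) {u : Space d → ℝ} (hu : MemW u) (p : Space d) :
    Integrable fun q => k (p - q) * u q := by
  obtain ⟨C, hC, h⟩ := hk.conv_bound
  exact (h u hu p).1

lemma conv_nonneg (hk : IsPairKernel k) {u : Space d → ℝ} (hu : 0 ≤ u) (p : Space d) :
    0 ≤ conv k u p := integral_nonneg fun q => mul_nonneg (hk.nonneg _) (hu q)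

lemma conv_mono (hk : IsPairKernel k) {u v : Space d → ℝ} (hu : MemW u) (hv : MemW v)
    (h : u ≤ v) (p : Space d) : conv k u p ≤ conv k v p :=
  integral_mono (hk.integrable_conv hu p) (hk.integrable_conv hv p) fun q =>
    mul_le_mul_of_nonneg_left (h q) (hk.nonneg _)

lemma conv_congr {u v : Space d → ℝ} (h : u =ᵐ[volume] v) (p : Space d) :
    conv k u p = conv k v p := by
  refine integral_congr_ae ?_
  filter_upwards [h] with q hq
  rw [hq]

lemma conv_isometry (hk : IsPairKernel k) {u : Space d → ℝ} (O : Space d ≃ₗᵢ[ℝ] Space d)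
    (hu : ∀ p, u (O p) = u p) (p : Space d) : conv k u (O p) = conv k u p := by
  unfold conv
  rw [← O.measurePreserving.integral_comp O.toHomeomorph.measurableEmbedding]
  refine integral_congr_ae (Filter.Eventually.of_forall fun q => ?_)
  simp only [hu, ← map_sub, hk.isometry]

lemma tendsto_conv (hk : IsPairKernel k) {u : ℕ → Space d → ℝ} {v w : Space d → ℝ} (hv : MemW v)
    (hm : ∀ n, Measurable (u n)) (h0 : ∀ n, 0 ≤ u n) (hle : ∀ n, u n ≤ v)
    (hlim : ∀ p, Filter.Tendsto (fun n => u n p) Filter.atTop (nhds (w p))) (p : Space d) :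
    Filter.Tendsto (fun n => conv k (u n) p) Filter.atTop (nhds (conv k w p)) := by
  have hkm : Measurable fun q => k (p - q) := (hk.continuous.comp (by fun_prop)).measurable
  refine tendsto_integral_of_dominated_convergence _
    (fun n => (hkm.mul (hm n)).aestronglyMeasurable) (hk.integrable_conv hv p)
    (fun n => Filter.Eventually.of_forall fun q => ?_)
    (Filter.Eventually.of_forall fun q => (hlim q).const_mul _)
  rw [Real.norm_of_nonneg (mul_nonneg (hk.nonneg _) (h0 n q))]
  exact mul_le_mul_of_nonneg_left (hle n q) (hk.nonneg _)

/-- The part of `u` in a ball is integrable and gives a continuous convolution by dominated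
convergence. The tail is small in the weighted norm, hence its convolution is uniformly small, and
uniform limits of continuous functions are continuous. -/
theorem conv_continuous (hk : IsPairKernel k) {u : Space d → ℝ} (hu : MemW u) :
    Continuous (conv k u) := by
  obtain ⟨C, hC, hconv⟩ := hk.conv_bound
  obtain ⟨M, hM⟩ := hk.bounded
  let v : ℕ → Space d → ℝ := fun n p => if ‖p‖ ≤ n then u p else 0
  let w : ℕ → Space d → ℝ := fun n p => if ‖p‖ ≤ n then 0 else u p
  have hs : ∀ n : ℕ, MeasurableSet {p : Space d | ‖p‖ ≤ n} := fun n =>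
    measurableSet_le measurable_norm measurable_const
  have hv : ∀ n, MemW (v n) := fun n => by
    refine hu.of_le (Measurable.ite (hs n) hu.measurable measurable_const) (fun p => ?_)
      fun p => ?_
    · have := hu.nonneg p
      simp only [v, Pi.zero_apply] at *
      split_ifs <;> simp [this]
    · have := hu.nonneg p
      simp only [v, Pi.zero_apply] at *
      split_ifs <;> simp [this]
  have hw : ∀ n, MemW (w n) := fun n => by
    refine hu.of_le (Measurable.ite (hs n) measurable_const hu.measurable) (fun p => ?_)
      fun p => ?_
    · have := hu.nonneg p
      simp only [w, Pi.zero_apply] at *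
      split_ifs <;> simp [this]
    · have := hu.nonneg p
      simp only [w, Pi.zero_apply] at *
      split_ifs <;> simp [this]
  have hvi : ∀ n, Integrable (v n) := fun n => by
    have e : v n = (Metric.closedBall 0 (n : ℝ)).indicator u := by
      ext p
      by_cases h : ‖p‖ ≤ n <;> simp [v, Set.indicator, h]
    rw [e, integrable_indicator_iff Metric.isClosed_closedBall.measurableSet]
    have : IsFiniteMeasure (volume.restrict (Metric.closedBall (0 : Space d) (n : ℝ))) :=
      ⟨by simpa using measure_closedBall_lt_top⟩
    have hL : MemLp u 2 := (memLp_two_iff_integrable_sq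
      hu.measurable.aestronglyMeasurable).2 hu.integrable_sq
    exact (hL.restrict _).integrable (by norm_num)
  have hcv : ∀ n, Continuous (conv k (v n)) := fun n => by
    unfold conv
    refine continuous_of_dominated (bound := fun q => M * v n q) (fun p => ?_) (fun p => ?_)
      ((hvi n).const_mul M) ?_
    · exact (hk.integrable_conv (hv n) p).1
    · refine Filter.Eventually.of_forall fun q => ?_
      rw [Real.norm_of_nonneg (mul_nonneg (hk.nonneg _) ((hv n).nonneg q))]
      exact mul_le_mul_of_nonneg_right (hM _) ((hv n).nonneg q)
    · exact Filter.Eventually.of_forall fun q =>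
        (hk.continuous.comp (continuous_id.sub continuous_const)).mul continuous_const
  have hwlim : Filter.Tendsto (fun n : ℕ => wsq (w n)) Filter.atTop (nhds 0) := by
    have h0 : ∫ _ : Space d, (0 : ℝ) = 0 := by simp
    rw [← h0]
    refine tendsto_integral_of_dominated_convergence _ (fun n => (hw n).integrable.1)
      hu.integrable (fun n => Filter.Eventually.of_forall fun p => ?_)
      (Filter.Eventually.of_forall fun p => ?_)
    · rw [Real.norm_of_nonneg (by positivity)]
      have := hu.nonneg p
      simp only [w, Pi.zero_apply] at *
      split_ifs
      · simp; positivity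
      · exact le_rfl
    · refine tendsto_const_nhds.congr' ?_
      filter_upwards [Filter.eventually_ge_atTop ⌈‖p‖⌉₊] with n hn
      have : ‖p‖ ≤ n := (Nat.le_ceil _).trans (by exact_mod_cast hn)
      simp [w, this]
  have hsplit : ∀ n p, conv k u p = conv k (v n) p + conv k (w n) p := fun n p => by
    unfold conv
    rw [← integral_add (hk.integrable_conv (hv n) p) (hk.integrable_conv (hw n) p)]
    refine integral_congr_ae (Filter.Eventually.of_forall fun q => ?_)
    simp only [v, w]
    split_ifs <;> ring
  have hunif : TendstoUniformly (fun n : ℕ => conv k (v n)) (conv k u) Filter.atTop := by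
    rw [Metric.tendstoUniformly_iff]
    intro ε hε
    have h1 : Filter.Tendsto (fun n : ℕ => C * Real.sqrt (wsq (w n))) Filter.atTop (nhds 0) := by
      simpa using ((Real.continuous_sqrt.tendsto 0).comp hwlim).const_mul C
    filter_upwards [h1.eventually (gt_mem_nhds hε)] with n hn p
    rw [Real.dist_eq, hsplit n p, add_sub_cancel_left,
      abs_of_nonneg (hk.conv_nonneg (hw n).nonneg p)]
    exact ((hconv (w n) (hw n) p).2).trans_lt hn
  exact hunif.continuous (Filter.Frequently.of_forall hcv)

lemma pos_near (hk : IsPairKernel k) : ∃ r > 0, ∀ p : Space d, ‖p‖ < r → 0 < k p := by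
  have := hk.continuous.continuousAt.eventually (lt_mem_nhds hk.zero_pos)
  obtain ⟨r, hr, h⟩ := Metric.eventually_nhds_iff.1 this
  exact ⟨r, hr, fun p hp => h (by simpa using hp)⟩

/-- Strict positivity of a convolution. -/
lemma conv_pos (hk : IsPairKernel k) {u : Space d → ℝ} (hu : MemW u) {r : ℝ}
    (hr : ∀ p : Space d, ‖p‖ < r → 0 < k p) {p : Space d} {U : Set (Space d)} (hU : IsOpen U)
    (hne : (U ∩ Metric.ball p r).Nonempty) (hpos : ∀ᵐ q, q ∈ U → 0 < u q) :
    0 < conv k u p := by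
  have h0 : 0 ≤ fun q => k (p - q) * u q := fun q => mul_nonneg (hk.nonneg _) (hu.nonneg q)
  unfold conv
  rw [integral_pos_iff_support_of_nonneg h0 (hk.integrable_conv hu p)]
  have hopen : 0 < volume (U ∩ Metric.ball p r) :=
    (hU.inter Metric.isOpen_ball).measure_pos volume hne
  refine hopen.trans_le (measure_mono_ae ?_)
  filter_upwards [hpos] with q hq hqU
  have h1 : 0 < k (p - q) := hr _ (by simpa [dist_eq_norm, norm_sub_rev] using hqU.2)
  exact (mul_pos h1 (hq hqU.1)).ne'

/-- Fubini for the products appearing in the ground state representation. -/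
lemma integrable_mul_conv (hk : IsPairKernel k) {a g : Space d → ℝ} (ha : MemW a)
    (hg : Measurable g) (hg0 : 0 ≤ g) (hI : Integrable fun p => g p * conv k a p) :
    Integrable (fun z : Space d × Space d => k (z.1 - z.2) * (g z.1 * a z.2))
      (volume.prod volume) ∧
    ∫ z : Space d × Space d, k (z.1 - z.2) * (g z.1 * a z.2) ∂(volume.prod volume)
      = ∫ p, g p * conv k a p := by
  have e : ∀ p, ∫ q, k (p - q) * (g p * a q) = g p * conv k a p := fun p => by
    unfold conv
    rw [← integral_const_mul]
    refine integral_congr_ae (Filter.Eventually.of_forall fun q => ?_)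
    ring
  have hInt : Integrable (fun z : Space d × Space d => k (z.1 - z.2) * (g z.1 * a z.2))
      (volume.prod volume) := by
    have hm : AEStronglyMeasurable (fun z : Space d × Space d => k (z.1 - z.2) * (g z.1 * a z.2))
        (volume.prod volume) := (hk.continuous_sub.measurable.mul ((hg.comp measurable_fst).mul
      (ha.measurable.comp measurable_snd))).aestronglyMeasurable
    rw [integrable_prod_iff hm]
    refine ⟨Filter.Eventually.of_forall fun p => ?_, ?_⟩
    · refine ((hk.integrable_conv ha p).const_mul (g p)).congr
        (Filter.Eventually.of_forall fun q => ?_)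
      ring
    · refine hI.congr (Filter.Eventually.of_forall fun p => ?_)
      simp only
      rw [← e]
      refine integral_congr_ae (Filter.Eventually.of_forall fun q => ?_)
      exact (Real.norm_of_nonneg (mul_nonneg (hk.nonneg _)
        (mul_nonneg (hg0 _) (ha.nonneg _)))).symm
  refine ⟨hInt, ?_⟩
  rw [integral_prod _ hInt]
  simp_rw [e]

lemma integrable_mul_conv_swap (hk : IsPairKernel k) {a g : Space d → ℝ} (ha : MemW a)
    (hg : Measurable g) (hg0 : 0 ≤ g) (hI : Integrable fun p => g p * conv k a p) :
    Integrable (fun z : Space d × Space d => k (z.1 - z.2) * (g z.2 * a z.1))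
      (volume.prod volume) ∧
    ∫ z : Space d × Space d, k (z.1 - z.2) * (g z.2 * a z.1) ∂(volume.prod volume)
      = ∫ p, g p * conv k a p := by
  obtain ⟨h1, h2⟩ := hk.integrable_mul_conv ha hg hg0 hI
  have e : (fun z : Space d × Space d => k (z.1 - z.2) * (g z.2 * a z.1))
      = (fun z : Space d × Space d => k (z.1 - z.2) * (g z.1 * a z.2)) ∘ Prod.swap := by
    ext z
    simp [hk.sub_comm z.1 z.2]
  refine ⟨by rw [e]; exact h1.swap, ?_⟩
  rw [← h2, ← integral_prod_swap]
  refine integral_congr_ae (Filter.Eventually.of_forall fun z => ?_)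
  simp [hk.sub_comm z.1 z.2]

/-- Schur test with a positive supersolution. -/
theorem pairForm_le_of_supersolution (hk : IsPairKernel k) {a u κ : Space d → ℝ} (ha : MemW a)
    (hu : MemW u) (hpos : ∀ p, u p ≠ 0 → 0 < a p)
    (hsup : ∀ p, u p ≠ 0 → conv k a p ≤ κ p * a p)
    (hI : Integrable fun p => κ p * u p ^ 2) :
    pairForm k u ≤ ∫ p, κ p * u p ^ 2 := by
  -- The arithmetic–geometric mean inequality gives `2 u(p) u(q) ≤ g(p) a(q) + g(q) a(p)`. By
  -- symmetry of `k` both terms integrate to `∫ g (k ⋆ a)`, which the supersolution property bounds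
  -- by `∫ κ u²`. Where `a` vanishes so does `u`, and the quotient is then `0`.
  let g : Space d → ℝ := fun p => u p ^ 2 / a p
  have hg : Measurable g := (hu.measurable.pow_const 2).div ha.measurable
  have hg0 : 0 ≤ g := fun p => div_nonneg (sq_nonneg _) (ha.nonneg p)
  have hle : ∀ p, g p * conv k a p ≤ κ p * u p ^ 2 := fun p => by
    by_cases h : u p = 0
    · simp [g, h]
    · have h1 := hpos p h
      calc g p * conv k a p ≤ g p * (κ p * a p) := mul_le_mul_of_nonneg_left (hsup p h) (hg0 p)
        _ = κ p * u p ^ 2 := by simp only [g]; field_simp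
  have hgc : Integrable fun p => g p * conv k a p := by
    refine hI.mono' (hg.mul (hk.conv_continuous ha).measurable).aestronglyMeasurable
      (Filter.Eventually.of_forall fun p => ?_)
    rw [Real.norm_of_nonneg (mul_nonneg (hg0 p) (hk.conv_nonneg ha.nonneg p))]
    exact hle p
  obtain ⟨h1, h2⟩ := hk.integrable_mul_conv ha hg hg0 hgc
  obtain ⟨h3, h4⟩ := hk.integrable_mul_conv_swap ha hg hg0 hgc
  have hpt : ∀ z : Space d × Space d, k (z.1 - z.2) * (u z.1 * u z.2)
      ≤ (k (z.1 - z.2) * (g z.1 * a z.2) + k (z.1 - z.2) * (g z.2 * a z.1)) / 2 := fun z => by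
    rw [← mul_add, mul_div_assoc]
    refine mul_le_mul_of_nonneg_left ?_ (hk.nonneg _)
    have ha1 := ha.nonneg z.1
    have ha2 := ha.nonneg z.2
    have hg1 := hg0 z.1
    have hg2 := hg0 z.2
    simp only [Pi.zero_apply] at ha1 ha2 hg1 hg2
    by_cases hu1 : u z.1 = 0
    · rw [hu1, zero_mul]; positivity
    by_cases hu2 : u z.2 = 0
    · rw [hu2, mul_zero]; positivity
    have hp1 := hpos _ hu1
    have hp2 := hpos _ hu2
    have : g z.1 * a z.2 + g z.2 * a z.1 - 2 * (u z.1 * u z.2)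
        = (u z.1 * a z.2 - u z.2 * a z.1) ^ 2 / (a z.1 * a z.2) := by
      simp only [g]
      field_simp
      ring
    have h5 : 0 ≤ (u z.1 * a z.2 - u z.2 * a z.1) ^ 2 / (a z.1 * a z.2) := by positivity
    linarith
  calc pairForm k u ≤ ∫ z : Space d × Space d, (k (z.1 - z.2) * (g z.1 * a z.2)
        + k (z.1 - z.2) * (g z.2 * a z.1)) / 2 ∂(volume.prod volume) :=
        integral_mono (hk.integrable_mul hu hu) ((h1.add h3).div_const 2) hpt
    _ = ∫ p, g p * conv k a p := by
        rw [integral_div, integral_add h1 h3, h2, h4]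
        ring
    _ ≤ _ := integral_mono hgc hI hle

end IsPairKernel

/-- A non-empty set that contains all points at distance `< r` from its elements is everything. -/
lemma eq_univ_of_ball_subset {N : Set (Space d)} {r : ℝ} (hr : 0 < r) (hne : N.Nonempty)
    (h : ∀ p ∈ N, ∀ y, dist y p < r → y ∈ N) : N = Set.univ := by
  refine IsClopen.eq_univ ⟨?_, ?_⟩ hne
  · rw [← closure_subset_iff_isClosed]
    intro y hy
    obtain ⟨p, hp, hpy⟩ := Metric.mem_closure_iff.1 hy r hr
    exact h p hp y hpy
  · rw [Metric.isOpen_iff]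
    exact fun p hp => ⟨r, hr, fun y hy => h p hp y hy⟩

end BCS

end

/-! ### The gap equation on a momentum ball, solved by monotone iteration. -/

noncomputable section

namespace BCS

variable {d : ℕ}

/-- The multiplier `K_T^Δ(p)` with `|Δ(p)| = 2b`. -/
def gapSymbol (μ T b : ℝ) (p : Space d) : ℝ :=
  kappa T (Real.sqrt ((‖p‖ ^ 2 - μ) ^ 2 + (2 * b) ^ 2))

/-- The nonlinear map `b ↦ b / K_T^{2b}` of the gap equation. -/
def gapMap (μ T b : ℝ) (p : Space d) : ℝ := b / gapSymbol μ T b p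

section symbol

variable {μ T : ℝ}

lemma gapSymbol_nonneg (hT : 0 ≤ T) (b : ℝ) (p : Space d) : 0 ≤ gapSymbol μ T b p :=
  kappa_nonneg hT (Real.sqrt_nonneg _)

lemma abs_le_gapSymbol (hT : 0 ≤ T) (b : ℝ) (p : Space d) :
    |‖p‖ ^ 2 - μ| ≤ gapSymbol μ T b p := by
  refine le_trans ?_ (le_kappa hT (Real.sqrt_nonneg _))
  rw [← Real.sqrt_sq_eq_abs]
  exact Real.sqrt_le_sqrt (by nlinarith [sq_nonneg (2 * b)])

lemma two_mul_le_gapSymbol (hT : 0 ≤ T) (b : ℝ) (p : Space d) :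
    2 * b ≤ gapSymbol μ T b p := by
  refine le_trans (le_abs_self _) (le_trans ?_ (le_kappa hT (Real.sqrt_nonneg _)))
  rw [← Real.sqrt_sq_eq_abs]
  exact Real.sqrt_le_sqrt (by nlinarith [sq_nonneg (‖p‖ ^ 2 - μ)])

lemma gapSymbol_le (hT : 0 ≤ T) {b : ℝ} (hb : 0 ≤ b) (p : Space d) :
    gapSymbol μ T b p ≤ |‖p‖ ^ 2 - μ| + 2 * b + 2 * T := by
  refine (kappa_le hT (Real.sqrt_nonneg _)).trans ?_
  have : Real.sqrt ((‖p‖ ^ 2 - μ) ^ 2 + (2 * b) ^ 2) ≤ |‖p‖ ^ 2 - μ| + 2 * b := by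
    rw [Real.sqrt_le_left (by positivity), add_sq, sq_abs]
    have := abs_nonneg (‖p‖ ^ 2 - μ)
    nlinarith
  linarith

lemma gapSymbol_pos_of_pos (hT : 0 ≤ T) {b : ℝ} (hb : 0 < b) (p : Space d) :
    0 < gapSymbol μ T b p := (by linarith : 0 < 2 * b).trans_le (two_mul_le_gapSymbol hT b p)

lemma gapMap_eq (b : ℝ) (p : Space d) : gapMap μ T b p
    = (2 * b) / (2 * kappa T (Real.sqrt ((‖p‖ ^ 2 - μ) ^ 2 + (2 * b) ^ 2))) := by
  rw [gapMap, gapSymbol, mul_div_mul_left _ _ two_ne_zero]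

lemma gapMap_le_gapMap (hT : 0 ≤ T) {b b' : ℝ} (hb : 0 ≤ b) (h : b ≤ b') (p : Space d) :
    gapMap μ T b p ≤ gapMap μ T b' p := by
  rw [gapMap_eq, gapMap_eq]
  exact gapMap_mono hT (by linarith) (by linarith)

lemma gapMap_nonneg (hT : 0 ≤ T) {b : ℝ} (hb : 0 ≤ b) (p : Space d) : 0 ≤ gapMap μ T b p :=
  div_nonneg hb (gapSymbol_nonneg hT b p)

lemma gapMap_pos (hT : 0 ≤ T) {b : ℝ} (hb : 0 < b) (p : Space d) : 0 < gapMap μ T b p :=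
  div_pos hb (gapSymbol_pos_of_pos hT hb p)

/-- The symbol dominates `2b`. Hence the constant `1/2` is a supersolution and a valid start of the
iteration. -/
lemma gapMap_le_half (hT : 0 ≤ T) {b : ℝ} (hb : 0 ≤ b) (p : Space d) :
    gapMap μ T b p ≤ 1 / 2 := by
  rcases hb.eq_or_lt' with rfl | hb
  · simp [gapMap]
  · rw [gapMap, div_le_iff₀ (gapSymbol_pos_of_pos hT hb p)]
    linarith [two_mul_le_gapSymbol (μ := μ) hT b p]

lemma gapSymbol_mul_gapMap (hT : 0 ≤ T) {b : ℝ} (hb : 0 ≤ b) (p : Space d) :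
    gapSymbol μ T b p * gapMap μ T b p = b := by
  rcases hb.eq_or_lt' with rfl | hb
  · simp [gapMap]
  · exact mul_div_cancel₀ _ (gapSymbol_pos_of_pos hT hb p).ne'

lemma measurable_gapSymbol {b : Space d → ℝ} (hb : Measurable b) :
    Measurable fun p => gapSymbol μ T (b p) p := by
  refine (measurable_kappa T).comp (Real.continuous_sqrt.measurable.comp ?_)
  exact (((measurable_norm.pow_const 2).sub_const μ).pow_const 2).add
    ((hb.const_mul 2).pow_const 2)

lemma measurable_gapMap {b : Space d → ℝ} (hb : Measurable b) :
    Measurable fun p => gapMap μ T (b p) p := hb.div (measurable_gapSymbol hb)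

lemma continuousAt_gapSymbol (hT : 0 ≤ T) {b : ℝ} {p : Space d}
    (h : ‖p‖ ^ 2 - μ ≠ 0 ∨ b ≠ 0) :
    ContinuousAt (fun z : ℝ × Space d => gapSymbol μ T z.1 z.2) (b, p) := by
  have hpos : 0 < Real.sqrt ((‖p‖ ^ 2 - μ) ^ 2 + (2 * b) ^ 2) := by
    rw [Real.sqrt_pos]
    rcases h with h | h <;> positivity
  exact ContinuousAt.comp (g := kappa T) (f := fun z : ℝ × Space d =>
    Real.sqrt ((‖z.2‖ ^ 2 - μ) ^ 2 + (2 * z.1) ^ 2)) (continuousAt_kappa hT hpos)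
    (by fun_prop : Continuous _).continuousAt

lemma tendsto_gapSymbol (hT : 0 ≤ T) {b : ℕ → ℝ} {b' : ℝ} {p : Space d} (h : ‖p‖ ^ 2 - μ ≠ 0)
    (hb : Filter.Tendsto b Filter.atTop (nhds b')) :
    Filter.Tendsto (fun n => gapSymbol μ T (b n) p) Filter.atTop (nhds (gapSymbol μ T b' p)) := by
  have hpos : 0 < Real.sqrt ((‖p‖ ^ 2 - μ) ^ 2 + (2 * b') ^ 2) :=
    Real.sqrt_pos.2 (by positivity)
  have h1 : Filter.Tendsto (fun n => Real.sqrt ((‖p‖ ^ 2 - μ) ^ 2 + (2 * b n) ^ 2)) Filter.atTop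
      (nhds (Real.sqrt ((‖p‖ ^ 2 - μ) ^ 2 + (2 * b') ^ 2))) :=
    (((hb.const_mul 2).pow 2).const_add _).sqrt
  exact (continuousAt_kappa hT hpos).tendsto.comp h1

lemma gapSymbol_pos_of_ne (hT : 0 ≤ T) (b : ℝ) {p : Space d} (h : ‖p‖ ^ 2 - μ ≠ 0) :
    0 < gapSymbol μ T b p := (abs_pos.2 h).trans_le (abs_le_gapSymbol hT b p)

lemma tendsto_gapMap (hT : 0 ≤ T) {b : ℕ → ℝ} {b' : ℝ} {p : Space d} (h : ‖p‖ ^ 2 - μ ≠ 0)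
    (hb : Filter.Tendsto b Filter.atTop (nhds b')) :
    Filter.Tendsto (fun n => gapMap μ T (b n) p) Filter.atTop (nhds (gapMap μ T b' p)) :=
  hb.div (tendsto_gapSymbol hT h hb) (gapSymbol_pos_of_ne hT b' h).ne'

/-- Spheres are null sets. Off this one the symbol is positive and continuous in `b` even at `b =
0`, so limits of the gap equation can be taken almost everywhere before positivity of the limit is
known. -/
lemma ae_kinetic_ne_zero (hd : 0 < d) (μ : ℝ) : ∀ᵐ p : Space d, ‖p‖ ^ 2 - μ ≠ 0 := by
  have : Nonempty (Fin d) := ⟨⟨0, hd⟩⟩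
  have h : volume (Metric.sphere (0 : Space d) (Real.sqrt μ)) = 0 :=
    Measure.addHaar_sphere volume 0 _
  rw [ae_iff]
  refine measure_mono_null (fun p hp => ?_) h
  have hp : ‖p‖ ^ 2 - μ = 0 := by simpa using hp
  rw [mem_sphere_zero_iff_norm, ← Real.sqrt_sq (norm_nonneg p), sub_eq_zero.1 hp]

end symbol

/-- The iteration for the gap equation restricted to momenta `|p| ≤ R`. -/
def gapIter (k : Space d → ℝ) (μ T R : ℝ) : ℕ → Space d → ℝ
  | 0 => fun p => if ‖p‖ ≤ R then 1 / 2 else 0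
  | n + 1 => fun p => if ‖p‖ ≤ R then gapMap μ T (conv k (gapIter k μ T R n) p) p else 0

/-- The maximal solution of the gap equation restricted to momenta `|p| ≤ R`. -/
def gapBall (k : Space d → ℝ) (μ T R : ℝ) (p : Space d) : ℝ := ⨅ n, gapIter k μ T R n p

section iteration

variable {k : Space d → ℝ} {μ T : ℝ}

lemma measurableSet_norm_le (R : ℝ) : MeasurableSet {p : Space d | ‖p‖ ≤ R} :=
  measurableSet_le measurable_norm measurable_const

lemma gapIter_props (hk : IsPairKernel k) (hT : 0 ≤ T) (R : ℝ) (n : ℕ) :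
    MemW (gapIter k μ T R n) ∧ ∀ p, gapIter k μ T R n p ≤ if ‖p‖ ≤ R then 1 / 2 else 0 := by
  induction n with
  | zero => exact ⟨memW_const_indicator _ (by norm_num) R, fun p => le_rfl⟩
  | succ n ih =>
    have h1 : ∀ p, gapIter k μ T R (n + 1) p ≤ if ‖p‖ ≤ R then 1 / 2 else 0 := fun p => by
      simp only [gapIter]
      split_ifs
      · exact gapMap_le_half hT (hk.conv_nonneg ih.1.nonneg p) p
      · exact le_rfl
    refine ⟨(memW_const_indicator (1 / 2) (by norm_num) R).of_le ?_ (fun p => ?_) h1, h1⟩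
    · exact Measurable.ite (measurableSet_norm_le R)
        (measurable_gapMap (hk.conv_continuous ih.1).measurable) measurable_const
    · simp only [gapIter, Pi.zero_apply]
      split_ifs
      · exact gapMap_nonneg hT (hk.conv_nonneg ih.1.nonneg p) p
      · exact le_rfl

/-- The start is a supersolution, and both the convolution and the pointwise nonlinearity preserve
order. -/
lemma gapIter_succ_le (hk : IsPairKernel k) (hT : 0 ≤ T) (R : ℝ) (n : ℕ) (p : Space d) :
    gapIter k μ T R (n + 1) p ≤ gapIter k μ T R n p := by
  induction n generalizing p with
  | zero => exact (gapIter_props hk hT R 1).2 p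
  | succ n ih =>
    have h1 := (gapIter_props (μ := μ) hk hT R n).1
    have h2 := (gapIter_props (μ := μ) hk hT R (n + 1)).1
    simp only [gapIter]
    split_ifs
    · exact gapMap_le_gapMap hT (hk.conv_nonneg h2.nonneg p) (hk.conv_mono h2 h1 ih p) p
    · exact le_rfl

lemma gapIter_antitone (hk : IsPairKernel k) (hT : 0 ≤ T) (R : ℝ) (p : Space d) :
    Antitone fun n => gapIter k μ T R n p :=
  antitone_nat_of_succ_le fun n => gapIter_succ_le hk hT R n p

lemma gapIter_mono_radius (hk : IsPairKernel k) (hT : 0 ≤ T) {R R' : ℝ} (h : R ≤ R') (n : ℕ)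
    (p : Space d) : gapIter k μ T R n p ≤ gapIter k μ T R' n p := by
  induction n generalizing p with
  | zero =>
    simp only [gapIter]
    split_ifs with h1 h2
    · exact le_rfl
    · exact absurd (h1.trans h) h2
    · norm_num
    · exact le_rfl
  | succ n ih =>
    have h1 := (gapIter_props (μ := μ) hk hT R n).1
    have h2 := (gapIter_props (μ := μ) hk hT R' n).1
    have h3 := (gapIter_props (μ := μ) hk hT R' (n + 1)).1.nonneg p
    simp only [gapIter, Pi.zero_apply] at h3 ⊢
    by_cases hp : ‖p‖ ≤ R
    · rw [if_pos hp, if_pos (hp.trans h)]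
      exact gapMap_le_gapMap hT (hk.conv_nonneg h1.nonneg p) (hk.conv_mono h1 h2 ih p) p
    · rw [if_neg hp]
      exact h3

lemma gapIter_isometry (hk : IsPairKernel k) (R : ℝ) (n : ℕ) (O : Space d ≃ₗᵢ[ℝ] Space d)
    (p : Space d) : gapIter k μ T R n (O p) = gapIter k μ T R n p := by
  induction n generalizing p with
  | zero => simp only [gapIter, O.norm_map]
  | succ n ih => simp only [gapIter, O.norm_map, hk.conv_isometry O ih, gapMap, gapSymbol]

lemma gapIter_bddBelow (hk : IsPairKernel k) (hT : 0 ≤ T) (R : ℝ) (p : Space d) :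
    BddBelow (Set.range fun n => gapIter k μ T R n p) := by
  refine ⟨0, ?_⟩
  rintro _ ⟨n, rfl⟩
  exact (gapIter_props hk hT R n).1.nonneg p

lemma tendsto_gapIter (hk : IsPairKernel k) (hT : 0 ≤ T) (R : ℝ) (p : Space d) :
    Filter.Tendsto (fun n => gapIter k μ T R n p) Filter.atTop (nhds (gapBall k μ T R p)) :=
  tendsto_atTop_ciInf (gapIter_antitone hk hT R p) (gapIter_bddBelow hk hT R p)

lemma gapBall_nonneg (hk : IsPairKernel k) (hT : 0 ≤ T) (R : ℝ) : 0 ≤ gapBall k μ T R := fun p =>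
  le_ciInf fun n => (gapIter_props hk hT R n).1.nonneg p

lemma gapBall_le (hk : IsPairKernel k) (hT : 0 ≤ T) (R : ℝ) (p : Space d) :
    gapBall k μ T R p ≤ if ‖p‖ ≤ R then 1 / 2 else 0 :=
  (ciInf_le (gapIter_bddBelow hk hT R p) 0).trans ((gapIter_props hk hT R 0).2 p)

lemma memW_gapBall (hk : IsPairKernel k) (hT : 0 ≤ T) (R : ℝ) : MemW (gapBall k μ T R) :=
  (memW_const_indicator (1 / 2) (by norm_num) R).of_le
    (measurable_of_tendsto_metrizable (fun n => (gapIter_props hk hT R n).1.measurable)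
      (tendsto_pi_nhds.2 fun p => tendsto_gapIter hk hT R p))
    (gapBall_nonneg hk hT R) (gapBall_le hk hT R)

lemma gapBall_mono (hk : IsPairKernel k) (hT : 0 ≤ T) {R R' : ℝ} (h : R ≤ R') (p : Space d) :
    gapBall k μ T R p ≤ gapBall k μ T R' p :=
  ciInf_mono (gapIter_bddBelow hk hT R p) fun n => gapIter_mono_radius hk hT h n p

lemma gapBall_isometry (hk : IsPairKernel k) (R : ℝ) (O : Space d ≃ₗᵢ[ℝ] Space d)
    (p : Space d) : gapBall k μ T R (O p) = gapBall k μ T R p := by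
  simp only [gapBall, gapIter_isometry hk]

lemma tendsto_conv_gapIter (hk : IsPairKernel k) (hT : 0 ≤ T) (R : ℝ) (p : Space d) :
    Filter.Tendsto (fun n => conv k (gapIter k μ T R n) p) Filter.atTop
      (nhds (conv k (gapBall k μ T R) p)) :=
  hk.tendsto_conv (memW_const_indicator (1 / 2) (by norm_num) R)
    (fun n => (gapIter_props hk hT R n).1.measurable)
    (fun n => (gapIter_props hk hT R n).1.nonneg) (fun n => (gapIter_props hk hT R n).2)
    (fun p => tendsto_gapIter hk hT R p) p

/-- The restricted gap equation. -/
lemma gapBall_eq (hk : IsPairKernel k) (hT : 0 ≤ T) (R : ℝ) {p : Space d}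
    (h : ‖p‖ ^ 2 - μ ≠ 0) (hp : ‖p‖ ≤ R) :
    gapBall k μ T R p = gapMap μ T (conv k (gapBall k μ T R) p) p := by
  have h1 := (tendsto_gapIter (μ := μ) hk hT R p).comp (Filter.tendsto_add_atTop_nat 1)
  refine tendsto_nhds_unique h1 ((tendsto_gapMap hT h (tendsto_conv_gapIter hk hT R p)).congr
    fun n => ?_)
  simp [gapIter, hp]

/-- Every point of the closed ball is close to interior points, where the previous iterate is
positive, and `k` is positive near `0`. Iterates must be positive to serve in the Schur test, even
if their limit vanishes. -/
lemma gapIter_pos (hk : IsPairKernel k) (hT : 0 ≤ T) {R : ℝ} (hR : 0 < R) (n : ℕ) (p : Space d)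
    (hp : ‖p‖ ≤ R) : 0 < gapIter k μ T R n p := by
  obtain ⟨r, hr, hkr⟩ := hk.pos_near
  induction n generalizing p with
  | zero => simp [gapIter, hp]
  | succ n ih =>
    simp only [gapIter, hp, if_true]
    refine gapMap_pos hT (hk.conv_pos (gapIter_props hk hT R n).1 hkr
      (Metric.isOpen_ball (x := 0) (ε := R)) ?_ (Filter.Eventually.of_forall fun q hq =>
        ih q (mem_ball_zero_iff.1 hq).le)) p
    have hcl : p ∈ closure (Metric.ball (0 : Space d) R) := by
      rw [closure_ball 0 hR.ne']
      simpa using hp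
    obtain ⟨q, hq, hqp⟩ := Metric.mem_closure_iff.1 hcl r hr
    exact ⟨q, hq, by rwa [Metric.mem_ball, dist_comm]⟩

/-- If the restricted gap equation has only the trivial solution, then the linear operator is
non-negative on functions supported in the ball. -/
theorem pairForm_le_of_gapBall_eq_zero (hd : 0 < d) (hk : IsPairKernel k) (hT : 0 ≤ T) {R : ℝ}
    (hR : 0 < R) (h0 : gapBall k μ T R =ᵐ[volume] 0) {u : Space d → ℝ} (hu : MemW u)
    (hsupp : ∀ p, R < ‖p‖ → u p = 0) :
    pairForm k u ≤ ∫ p, gapSymbol μ T 0 p * u p ^ 2 := by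
  obtain ⟨C, hC, hconv⟩ := hk.conv_bound
  let b : ℕ → Space d → ℝ := fun n => conv k (gapIter k μ T R n)
  have hmem := fun n => (gapIter_props (μ := μ) hk hT R n).1
  have hb0 : ∀ n p, 0 ≤ b n p := fun n p => hk.conv_nonneg (hmem n).nonneg p
  have hbm : ∀ n, Measurable (b n) := fun n => (hk.conv_continuous (hmem n)).measurable
  set B := C * Real.sqrt (wsq (gapIter k μ T R 0))
  have hB : 0 ≤ B := by positivity
  have hbB : ∀ n p, b n p ≤ B := fun n p =>
    (hk.conv_mono (hmem n) (hmem 0)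
      (fun q => gapIter_antitone hk hT R q (Nat.zero_le n)) p).trans (hconv _ (hmem 0) p).2
  have hbound : Integrable fun p => (1 + |μ| + 2 * B + 2 * T) * ((1 + ‖p‖ ^ 2) * u p ^ 2) :=
    hu.integrable.const_mul _
  have hle : ∀ n p, ‖gapSymbol μ T (b n p) p * u p ^ 2‖
      ≤ (1 + |μ| + 2 * B + 2 * T) * ((1 + ‖p‖ ^ 2) * u p ^ 2) := fun n p => by
    rw [Real.norm_of_nonneg (mul_nonneg (gapSymbol_nonneg hT _ _) (sq_nonneg _)), ← mul_assoc]
    refine mul_le_mul_of_nonneg_right ?_ (sq_nonneg _)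
    refine (gapSymbol_le hT (hb0 n p) p).trans ?_
    have h1 := hbB n p
    have h2 : |‖p‖ ^ 2 - μ| ≤ ‖p‖ ^ 2 + |μ| := by
      refine (abs_sub _ _).trans ?_
      rw [abs_of_nonneg (by positivity)]
    have h3 := abs_nonneg μ
    have h4 : 0 ≤ (|μ| + 2 * B + 2 * T) * ‖p‖ ^ 2 := by positivity
    nlinarith
  have hm : ∀ n, Measurable fun p => gapSymbol μ T (b n p) p * u p ^ 2 := fun n =>
    (measurable_gapSymbol (hbm n)).mul (hu.measurable.pow_const 2)
  -- In the ball `K_T^{2bₙ} aₙ₊₁ = bₙ = k ⋆ aₙ ≥ k ⋆ aₙ₊₁`, so `aₙ₊₁` is a positive supersolution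
  -- for the linear operator with symbol `K_T^{2bₙ}`.
  have hstep : ∀ n, pairForm k u ≤ ∫ p, gapSymbol μ T (b n p) p * u p ^ 2 := fun n => by
    have hin : ∀ p, u p ≠ 0 → ‖p‖ ≤ R := fun p hp => not_lt.1 fun h => hp (hsupp p h)
    refine hk.pairForm_le_of_supersolution (hmem (n + 1)) hu
      (fun p hp => gapIter_pos hk hT hR (n + 1) p (hin p hp)) (fun p hp => ?_)
      (hbound.mono' (hm n).aestronglyMeasurable (Filter.Eventually.of_forall (hle n)))
    have e : gapIter k μ T R (n + 1) p = gapMap μ T (b n p) p := by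
      simp only [gapIter, hin p hp, if_true, b]
    rw [e, gapSymbol_mul_gapMap hT (hb0 n p)]
    exact hk.conv_mono (hmem (n + 1)) (hmem n) (gapIter_succ_le hk hT R n) p
  -- Since the iterates tend to zero almost everywhere, `bₙ → 0` and the symbols converge to
  -- `K_T^0`.
  have hlim : Filter.Tendsto (fun n => ∫ p, gapSymbol μ T (b n p) p * u p ^ 2) Filter.atTop
      (nhds (∫ p, gapSymbol μ T 0 p * u p ^ 2)) := by
    refine tendsto_integral_of_dominated_convergence _ (fun n => (hm n).aestronglyMeasurable)
      hbound (fun n => Filter.Eventually.of_forall (hle n)) ?_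
    filter_upwards [ae_kinetic_ne_zero hd μ] with p hp
    refine (tendsto_gapSymbol hT hp ?_).mul_const _
    have h1 := tendsto_conv_gapIter (μ := μ) hk hT R p
    rw [IsPairKernel.conv_congr h0] at h1
    have h2 : conv k 0 p = 0 := by simp [conv]
    rw [h2] at h1
    exact h1
  exact ge_of_tendsto' hlim hstep

end iteration

end BCS

end

/-! ### A priori bound, removal of the ball, and positivity of the solution. -/

noncomputable section

namespace BCS

variable {d : ℕ} {k : Space d → ℝ} {μ T : ℝ}

lemma IsPairKernel.pairForm_eq (hk : IsPairKernel k) {u : Space d → ℝ} (hu : MemW u) :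
    Integrable (fun p => u p * conv k u p) ∧ pairForm k u = ∫ p, u p * conv k u p := by
  have h := hk.integrable_mul hu hu
  have e : ∀ p, ∫ q, k (p - q) * (u p * u q) = u p * conv k u p := fun p => by
    unfold conv
    rw [← integral_const_mul]
    refine integral_congr_ae (Filter.Eventually.of_forall fun q => ?_)
    ring
  have h1 := h.integral_prod_left
  simp_rw [e] at h1
  refine ⟨h1, ?_⟩
  rw [pairForm, integral_prod _ h]
  simp_rw [e]

/-- The restricted solutions are bounded in the weighted `L²` space, uniformly in the radius. -/
lemma wsq_gapBall_le (hd : 0 < d) (hk : IsPairKernel k) (hμ : 0 < μ) (hT : 0 ≤ T) :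
    ∃ B, 0 ≤ B ∧ ∀ R, wsq (gapBall k μ T R) ≤ B := by
  obtain ⟨C, hC, hform⟩ := hk.form_bound (1 / 2) (by norm_num)
  -- `D` collects all coefficients of `∫ a²`: the gap equation and the form bound give `wsq a ≤ wsq
  -- a / 2 + D ∫ a²`. Splitting momenta at `ρ ^ 2 = 4 * D`, with `a ≤ 1/2` inside and the weight
  -- exceeding `4 * D` outside, gives `D ∫ a² ≤ D * J + wsq a / 4`. As `wsq a` is finite, it can be
  -- absorbed, leaving `4 * D * J`.
  set D := C + 1 + μ
  have hD : 0 < D := by positivity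
  set ρ := Real.sqrt (4 * D)
  have hρ : ρ ^ 2 = 4 * D := Real.sq_sqrt (by positivity)
  set J := ∫ p : Space d, ((if ‖p‖ ≤ ρ then 1 / 2 else 0 : ℝ)) ^ 2
  have hJi : Integrable fun p : Space d => ((if ‖p‖ ≤ ρ then 1 / 2 else 0 : ℝ)) ^ 2 :=
    (memW_const_indicator (1 / 2) (by norm_num) ρ).integrable_sq
  have hJ : 0 ≤ J := integral_nonneg fun p => sq_nonneg _
  refine ⟨4 * D * J, by positivity, fun R => ?_⟩
  set a := gapBall k μ T R
  have ha : MemW a := memW_gapBall hk hT R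
  obtain ⟨hi, he⟩ := hk.pairForm_eq ha
  have h1 : wsq a ≤ pairForm k a + (1 + μ) * ∫ p, a p ^ 2 := by
    rw [he, ← integral_const_mul, ← integral_add hi (ha.integrable_sq.const_mul _)]
    refine integral_mono_ae ha.integrable (hi.add (ha.integrable_sq.const_mul _)) ?_
    filter_upwards [ae_kinetic_ne_zero hd μ] with p hp
    have h2 : |‖p‖ ^ 2 - μ| * a p ^ 2 ≤ a p * conv k a p := by
      by_cases hpR : ‖p‖ ≤ R
      · have e1 := gapBall_eq hk hT R hp hpR
        have h0 := hk.conv_nonneg ha.nonneg p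
        have e2 := gapSymbol_mul_gapMap (μ := μ) hT h0 p
        rw [← e1] at e2
        have h3 := abs_le_gapSymbol (μ := μ) hT (conv k a p) p
        calc |‖p‖ ^ 2 - μ| * a p ^ 2 ≤ gapSymbol μ T (conv k a p) p * a p ^ 2 := by gcongr
          _ = a p * conv k a p := by
            conv_rhs => rw [← e2]
            ring
      · have h3 := gapBall_le (μ := μ) hk hT R p
        rw [if_neg hpR] at h3
        have : a p = 0 := le_antisymm h3 (ha.nonneg p)
        simp [this]
    have h4 := le_abs_self (‖p‖ ^ 2 - μ)
    have h5 : 0 ≤ (|‖p‖ ^ 2 - μ| - (‖p‖ ^ 2 - μ)) * a p ^ 2 :=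
      mul_nonneg (by linarith) (sq_nonneg _)
    nlinarith
  have h2 := (hform a ha).2
  have h3 : ∫ p, a p ^ 2 ≤ J + (4 * D)⁻¹ * wsq a := by
    rw [wsq, ← integral_const_mul, ← integral_add hJi (ha.integrable.const_mul _)]
    refine integral_mono ha.integrable_sq (hJi.add (ha.integrable.const_mul _)) fun p => ?_
    beta_reduce
    have h0 := ha.nonneg p
    simp only [Pi.zero_apply] at h0
    have hhalf : a p ≤ 1 / 2 := (gapBall_le (μ := μ) hk hT R p).trans (by split_ifs <;> norm_num)
    by_cases hp : ‖p‖ ≤ ρ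
    · rw [if_pos hp]
      have : 0 ≤ (4 * D)⁻¹ * ((1 + ‖p‖ ^ 2) * a p ^ 2) := by positivity
      have : a p ^ 2 ≤ (1 / 2) ^ 2 := by gcongr
      linarith
    · have hp' : 4 * D ≤ ‖p‖ ^ 2 := by
        rw [← hρ]
        exact pow_le_pow_left₀ (Real.sqrt_nonneg _) (not_le.1 hp).le 2
      rw [if_neg hp]
      have : 1 ≤ (4 * D)⁻¹ * (1 + ‖p‖ ^ 2) := by
        rw [← div_eq_inv_mul, le_div_iff₀ (by positivity)]
        linarith
      nlinarith [sq_nonneg (a p)]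
  have h4 : D * ∫ p, a p ^ 2 ≤ D * J + 1 / 4 * wsq a := by
    refine (mul_le_mul_of_nonneg_left h3 hD.le).trans_eq ?_
    field_simp
  have h5 : pairForm k a ≤ 1 / 2 * wsq a + C * ∫ p, a p ^ 2 := h2
  have h6 : D * ∫ p, a p ^ 2 = C * (∫ p, a p ^ 2) + (1 + μ) * ∫ p, a p ^ 2 := by
    rw [show D = C + 1 + μ from rfl]; ring
  linarith

/-- The supremum of the restricted solutions. -/
def gapSup (k : Space d → ℝ) (μ T : ℝ) (p : Space d) : ℝ := ⨆ n : ℕ, gapBall k μ T n p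

lemma gapBall_bddAbove (hk : IsPairKernel k) (hT : 0 ≤ T) (p : Space d) :
    BddAbove (Set.range fun n : ℕ => gapBall k μ T n p) := by
  refine ⟨1 / 2, ?_⟩
  rintro _ ⟨n, rfl⟩
  exact (gapBall_le hk hT n p).trans (by split_ifs <;> norm_num)

lemma gapBall_le_gapSup (hk : IsPairKernel k) (hT : 0 ≤ T) (n : ℕ) (p : Space d) :
    gapBall k μ T n p ≤ gapSup k μ T p := le_ciSup (gapBall_bddAbove hk hT p) n

lemma gapBall_monotone (hk : IsPairKernel k) (hT : 0 ≤ T) (p : Space d) :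
    Monotone fun n : ℕ => gapBall k μ T n p := fun _ _ h =>
  gapBall_mono hk hT (by exact_mod_cast h) p

lemma tendsto_gapBall (hk : IsPairKernel k) (hT : 0 ≤ T) (p : Space d) :
    Filter.Tendsto (fun n : ℕ => gapBall k μ T n p) Filter.atTop (nhds (gapSup k μ T p)) :=
  tendsto_atTop_ciSup (gapBall_monotone hk hT p) (gapBall_bddAbove hk hT p)

lemma memW_gapSup (hd : 0 < d) (hk : IsPairKernel k) (hμ : 0 < μ) (hT : 0 ≤ T) :
    MemW (gapSup k μ T) := by
  obtain ⟨B, hB, h⟩ := wsq_gapBall_le hd hk hμ hT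
  have hm : Measurable (gapSup k μ T) :=
    measurable_of_tendsto_metrizable (fun n : ℕ => (memW_gapBall hk hT n).measurable)
      (tendsto_pi_nhds.2 fun p => tendsto_gapBall hk hT p)
  have h0 : 0 ≤ gapSup k μ T := fun p =>
    (gapBall_nonneg hk hT (0 : ℕ) p).trans (gapBall_le_gapSup hk hT 0 p)
  have hwm : ∀ {u : Space d → ℝ}, Measurable u →
      Measurable fun p : Space d => (1 + ‖p‖ ^ 2) * u p ^ 2 := fun hu =>
    ((measurable_norm.pow_const 2).const_add 1).mul (hu.pow_const 2)
  refine ⟨hm, h0, (integrable_and_integral_le (hwm hm).aestronglyMeasurable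
    (fun p => mul_nonneg (by positivity) (sq_nonneg _)) hB ?_).1⟩
  have hlim : Filter.Tendsto (fun n : ℕ => ∫⁻ p : Space d,
      ENNReal.ofReal ((1 + ‖p‖ ^ 2) * gapBall k μ T n p ^ 2)) Filter.atTop
      (nhds (∫⁻ p : Space d, ENNReal.ofReal ((1 + ‖p‖ ^ 2) * gapSup k μ T p ^ 2))) := by
    refine lintegral_tendsto_of_tendsto_of_monotone
      (fun n => (hwm (memW_gapBall hk hT n).measurable).ennreal_ofReal.aemeasurable)
      (Filter.Eventually.of_forall fun p n m hnm => ?_)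
      (Filter.Eventually.of_forall fun p => ?_)
    · have h1 := gapBall_monotone (μ := μ) hk hT p hnm
      have h2 := gapBall_nonneg (μ := μ) hk hT n p
      simp only [Pi.zero_apply] at h1 h2
      exact ENNReal.ofReal_le_ofReal (by gcongr)
    · exact (ENNReal.continuous_ofReal.tendsto _).comp
        (((tendsto_gapBall hk hT p).pow 2).const_mul _)
  refine le_of_tendsto' hlim fun n => ?_
  rw [← ofReal_integral_eq_lintegral_ofReal (memW_gapBall hk hT n).integrable
    (Filter.Eventually.of_forall fun p => by positivity)]
  exact ENNReal.ofReal_le_ofReal (h n)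

lemma gapSup_eq (hd : 0 < d) (hk : IsPairKernel k) (hμ : 0 < μ) (hT : 0 ≤ T) {p : Space d}
    (hp : ‖p‖ ^ 2 - μ ≠ 0) : gapSup k μ T p = gapMap μ T (conv k (gapSup k μ T) p) p := by
  have ha := memW_gapSup hd hk hμ hT
  have hc := hk.tendsto_conv (w := gapSup k μ T) ha
    (fun n : ℕ => (memW_gapBall hk hT n).measurable)
    (fun n : ℕ => gapBall_nonneg hk hT n) (fun n : ℕ => gapBall_le_gapSup hk hT n)
    (tendsto_gapBall hk hT) p
  refine tendsto_nhds_unique (tendsto_gapBall hk hT p) ((tendsto_gapMap hT hp hc).congr' ?_)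
  filter_upwards [Filter.eventually_ge_atTop ⌈‖p‖⌉₊] with n hn
  exact (gapBall_eq hk hT n hp ((Nat.le_ceil _).trans (by exact_mod_cast hn))).symm

lemma IsPairKernel.tendsto_pairForm_cutoff (hk : IsPairKernel k) {u : Space d → ℝ}
    (hu : MemW u) : Filter.Tendsto (fun n : ℕ => pairForm k fun p => if ‖p‖ ≤ n then u p else 0)
      Filter.atTop (nhds (pairForm k u)) := by
  have hm : ∀ n : ℕ, Measurable fun p : Space d => if ‖p‖ ≤ n then u p else 0 := fun n =>
    Measurable.ite (measurableSet_norm_le n) hu.measurable measurable_const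
  have hb : ∀ (n : ℕ) (p : Space d), 0 ≤ (if ‖p‖ ≤ n then u p else 0) ∧
      (if ‖p‖ ≤ n then u p else 0) ≤ u p := fun n p => by
    have := hu.nonneg p
    simp only [Pi.zero_apply] at this
    split_ifs <;> simp [this]
  refine tendsto_integral_of_dominated_convergence _ (fun n => ?_) (hk.integrable_mul hu hu)
    (fun n => Filter.Eventually.of_forall fun z => ?_) (Filter.Eventually.of_forall fun z => ?_)
  · exact (hk.continuous_sub.measurable.mul (((hm n).comp measurable_fst).mul
      ((hm n).comp measurable_snd))).aestronglyMeasurable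
  · have h1 := hb n z.1
    have h2 := hb n z.2
    rw [Real.norm_of_nonneg (mul_nonneg (hk.nonneg _) (mul_nonneg h1.1 h2.1))]
    exact mul_le_mul_of_nonneg_left (mul_le_mul h1.2 h2.2 h2.1 (h1.1.trans h1.2)) (hk.nonneg _)
  · refine tendsto_const_nhds.congr' ?_
    filter_upwards [Filter.eventually_ge_atTop (max ⌈‖z.1‖⌉₊ ⌈‖z.2‖⌉₊)] with n hn
    have h1 : ‖z.1‖ ≤ n := (Nat.le_ceil _).trans (by exact_mod_cast (le_max_left _ _).trans hn)
    have h2 : ‖z.2‖ ≤ n := (Nat.le_ceil _).trans (by exact_mod_cast (le_max_right _ _).trans hn)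
    simp [h1, h2]

/-- Truncating the trial function to a large ball lowers the kinetic term and barely changes the
pair term, so the strict inequality survives. If the supremum vanished, the solution in that ball
would vanish too, contradicting `pairForm_le_of_gapBall_eq_zero`. -/
lemma gapSup_ne_zero (hd : 0 < d) (hk : IsPairKernel k) (hT : 0 ≤ T)
    {u : Space d → ℝ} (hu : MemW u)
    (hneg : ∫ p, gapSymbol μ T 0 p * u p ^ 2 < pairForm k u) :
    ¬ gapSup k μ T =ᵐ[volume] 0 := by
  intro h0
  obtain ⟨n, hn, hn1⟩ := (((hk.tendsto_pairForm_cutoff hu).eventually (lt_mem_nhds hneg)).and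
    (Filter.eventually_ge_atTop 1)).exists
  set v : Space d → ℝ := fun p => if ‖p‖ ≤ n then u p else 0
  have hvu : ∀ p, 0 ≤ v p ∧ v p ≤ u p := fun p => by
    have := hu.nonneg p
    simp only [Pi.zero_apply] at this
    simp only [v]
    split_ifs <;> simp [this]
  have hv : MemW v := hu.of_le
    (Measurable.ite (measurableSet_norm_le n) hu.measurable measurable_const)
    (fun p => (hvu p).1) fun p => (hvu p).2
  have hball : gapBall k μ T n =ᵐ[volume] 0 := by
    filter_upwards [h0] with p hp
    exact le_antisymm ((gapBall_le_gapSup hk hT n p).trans_eq hp) (gapBall_nonneg hk hT n p)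
  have h1 := pairForm_le_of_gapBall_eq_zero (μ := μ) hd hk hT (R := n)
    (by exact_mod_cast hn1) hball hv fun p hp => if_neg (not_le.2 hp)
  have hI : Integrable fun p => gapSymbol μ T 0 p * u p ^ 2 := by
    refine (hu.integrable.const_mul (1 + |μ| + 2 * T)).mono'
      ((measurable_gapSymbol measurable_const).mul (hu.measurable.pow_const 2)).aestronglyMeasurable
      (Filter.Eventually.of_forall fun p => ?_)
    rw [Real.norm_of_nonneg (mul_nonneg (gapSymbol_nonneg hT _ _) (sq_nonneg _)), ← mul_assoc]
    refine mul_le_mul_of_nonneg_right ?_ (sq_nonneg _)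
    refine (gapSymbol_le hT le_rfl p).trans ?_
    have h2 : |‖p‖ ^ 2 - μ| ≤ ‖p‖ ^ 2 + |μ| := by
      refine (abs_sub _ _).trans ?_
      rw [abs_of_nonneg (by positivity)]
    have h4 : 0 ≤ (|μ| + 2 * T) * ‖p‖ ^ 2 := by positivity
    nlinarith
  have h2 : ∫ p, gapSymbol μ T 0 p * v p ^ 2 ≤ ∫ p, gapSymbol μ T 0 p * u p ^ 2 := by
    refine integral_mono_of_nonneg (Filter.Eventually.of_forall fun p =>
      mul_nonneg (gapSymbol_nonneg hT _ _) (sq_nonneg _)) hI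
      (Filter.Eventually.of_forall fun p => ?_)
    exact mul_le_mul_of_nonneg_left (pow_le_pow_left₀ (hvu p).1 (hvu p).2 2)
      (gapSymbol_nonneg hT _ _)
  linarith

/-- A positive solution of the gap equation `a = (k ⋆ a) / K_T^{2 k ⋆ a}`. -/
structure IsGapSolution (k : Space d → ℝ) (μ T : ℝ) (a : Space d → ℝ) : Prop where
  memW : MemW a
  continuous : Continuous a
  pos : ∀ p, 0 < a p
  conv_pos : ∀ p, 0 < conv k a p
  eq : ∀ p, gapSymbol μ T (conv k a p) p * a p = conv k a p
  isometry : ∀ (O : Space d ≃ₗᵢ[ℝ] Space d) p, a (O p) = a p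

/-- Existence of a positive solution of the gap equation below the critical temperature. -/
theorem exists_gapSolution (hd : 0 < d) (hk : IsPairKernel k) (hμ : 0 < μ) (hT : 0 ≤ T)
    {u : Space d → ℝ} (hu : MemW u) (hneg : ∫ p, gapSymbol μ T 0 p * u p ^ 2 < pairForm k u) :
    ∃ a, IsGapSolution k μ T a := by
  set a := gapSup k μ T
  have ha : MemW a := memW_gapSup hd hk hμ hT
  set b := conv k a
  have hbc : Continuous b := hk.conv_continuous ha
  have hb0 : ∀ p, 0 ≤ b p := hk.conv_nonneg ha.nonneg
  have hae : ∀ᵐ p, a p = gapMap μ T (b p) p := by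
    filter_upwards [ae_kinetic_ne_zero hd μ] with p hp
    exact gapSup_eq hd hk hμ hT hp
  obtain ⟨r, hr, hkr⟩ := hk.pos_near
  have hne : (Set.Nonempty {p | 0 < b p}) := by
    by_contra hemp
    refine gapSup_ne_zero hd hk hT hu hneg ?_
    filter_upwards [hae] with p hp
    have : b p = 0 := by
      by_contra h
      exact hemp ⟨p, lt_of_le_of_ne (hb0 p) (Ne.symm h)⟩
    change a p = 0
    rw [hp, this]
    simp [gapMap]
  -- Near a point with `b > 0` also `a > 0` almost everywhere, and convolving with `k`, positive
  -- within distance `r`, makes `b` positive on the whole `r`-ball. Connectedness finishes.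
  have huniv : {p | 0 < b p} = Set.univ := by
    refine eq_univ_of_ball_subset hr hne fun p hp y hy => ?_
    refine hk.conv_pos ha hkr (isOpen_lt continuous_const hbc) ⟨p, hp, ?_⟩ ?_
    · rwa [Metric.mem_ball, dist_comm]
    · filter_upwards [hae] with q hq hqb
      rw [hq]
      exact gapMap_pos hT hqb q
  have hbpos : ∀ p, 0 < b p := fun p => (huniv ▸ Set.mem_univ p : p ∈ {p | 0 < b p})
  have hmeas : Continuous fun p => gapMap μ T (b p) p := by
    rw [continuous_iff_continuousAt]
    intro p
    refine hbc.continuousAt.div ?_ (gapSymbol_pos_of_pos hT (hbpos p) p).ne'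
    exact ContinuousAt.comp (g := fun z : ℝ × Space d => gapSymbol μ T z.1 z.2)
      (f := fun p => (b p, p)) (continuousAt_gapSymbol hT (Or.inr (hbpos p).ne'))
      (hbc.prodMk continuous_id).continuousAt
  -- The solution is redefined as `gapMap` of `b`. This changes it only on a null set, hence not its
  -- convolution, and makes it continuous and the equation valid at every point.
  have hconv : ∀ p, conv k (fun p => gapMap μ T (b p) p) p = b p := fun p =>
    (IsPairKernel.conv_congr hae p).symm
  refine ⟨fun p => gapMap μ T (b p) p, ⟨hmeas.measurable, fun p => gapMap_nonneg hT (hb0 p) p,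
    ha.integrable.congr ?_⟩, hmeas, fun p => gapMap_pos hT (hbpos p) p, fun p => ?_, fun p => ?_,
    fun O p => ?_⟩
  · filter_upwards [hae] with p hp
    rw [hp]
  · rw [hconv]
    exact hbpos p
  · rw [hconv]
    exact gapSymbol_mul_gapMap hT (hb0 p) p
  · have h1 : b (O p) = b p := hk.conv_isometry O (fun q => by
      simp only [a, gapSup, gapBall_isometry hk]) p
    simp only [gapMap, gapSymbol, h1, O.norm_map]

end BCS

end

/-! ### Ground state representation and uniqueness of the ground state. -/

noncomputable section

namespace BCS

variable {d : ℕ} {k : Space d → ℝ} {μ T : ℝ} {a : Space d → ℝ}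

/-- The momentum space symbol `K` associated with a solution of the gap equation. -/
def gapK (k : Space d → ℝ) (μ T : ℝ) (a : Space d → ℝ) (p : Space d) : ℝ :=
  gapSymbol μ T (conv k a p) p

namespace IsGapSolution

lemma gapK_mul (ha : IsGapSolution k μ T a) (p : Space d) : gapK k μ T a p * a p = conv k a p :=
  ha.eq p

lemma gapK_pos (ha : IsGapSolution k μ T a) (hT : 0 ≤ T) (p : Space d) : 0 < gapK k μ T a p :=
  gapSymbol_pos_of_pos hT (ha.conv_pos p) p

lemma measurable_gapK (ha : IsGapSolution k μ T a) (hk : IsPairKernel k) :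
    Measurable (gapK k μ T a) :=
  measurable_gapSymbol (hk.conv_continuous ha.memW).measurable

lemma exists_gapK_le (ha : IsGapSolution k μ T a) (hk : IsPairKernel k) (hT : 0 ≤ T) :
    ∃ C, 0 ≤ C ∧ ∀ p, gapK k μ T a p ≤ C * (1 + ‖p‖ ^ 2) := by
  obtain ⟨C, hC, h⟩ := hk.conv_bound
  refine ⟨1 + |μ| + 2 * (C * Real.sqrt (wsq a)) + 2 * T, by positivity, fun p => ?_⟩
  have h1 := gapSymbol_le (μ := μ) hT (ha.conv_pos p).le p
  have h2 : conv k a p ≤ C * Real.sqrt (wsq a) := (h a ha.memW p).2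
  have h3 : |‖p‖ ^ 2 - μ| ≤ ‖p‖ ^ 2 + |μ| := by
    refine (abs_sub _ _).trans ?_
    rw [abs_of_nonneg (sq_nonneg ‖p‖)]
  have h4 : 0 ≤ C * Real.sqrt (wsq a) := by positivity
  have h5 := abs_nonneg μ
  unfold gapK
  nlinarith [sq_nonneg ‖p‖, mul_nonneg h4 (sq_nonneg ‖p‖), mul_nonneg h5 (sq_nonneg ‖p‖),
    mul_nonneg hT (sq_nonneg ‖p‖)]

lemma integrable_gapK_mul (ha : IsGapSolution k μ T a) (hk : IsPairKernel k) (hT : 0 ≤ T)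
    {u : Space d → ℝ} (hu : MemW u) : Integrable fun p => gapK k μ T a p * u p ^ 2 := by
  obtain ⟨C, hC, h⟩ := ha.exists_gapK_le hk hT
  refine (hu.integrable.const_mul C).mono' ((ha.measurable_gapK hk).mul
    (hu.measurable.pow_const 2)).aestronglyMeasurable (Filter.Eventually.of_forall fun p => ?_)
  rw [Real.norm_of_nonneg (mul_nonneg (ha.gapK_pos hT p).le (sq_nonneg _)), ← mul_assoc]
  exact mul_le_mul_of_nonneg_right (h p) (sq_nonneg _)

/-- Ground state representation of the form of `K - k ⋆`. -/
theorem ground_state_representation (ha : IsGapSolution k μ T a) (hk : IsPairKernel k)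
    (hT : 0 ≤ T) {f : Space d → ℂ} (hf : Measurable f) (hfW : MemW fun p => ‖f p‖)
    (hI : Integrable (fun z : Space d × Space d =>
      k (z.1 - z.2) * (star (f z.1) * f z.2).re) (volume.prod volume)) :
    Integrable (fun z : Space d × Space d => k (z.1 - z.2) * (a z.1 * a z.2) *
      ‖f z.1 / a z.1 - f z.2 / a z.2‖ ^ 2) (volume.prod volume) ∧
    ∫ z : Space d × Space d, k (z.1 - z.2) * (a z.1 * a z.2) *
      ‖f z.1 / a z.1 - f z.2 / a z.2‖ ^ 2 ∂(volume.prod volume)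
      = 2 * ((∫ p, gapK k μ T a p * ‖f p‖ ^ 2) -
        ∫ z : Space d × Space d, k (z.1 - z.2) * (star (f z.1) * f z.2).re
          ∂(volume.prod volume)) := by
  let g : Space d → ℝ := fun p => ‖f p‖ ^ 2 / a p
  have hg : Measurable g := (hf.norm.pow_const 2).div ha.memW.measurable
  have hg0 : 0 ≤ g := fun p => div_nonneg (sq_nonneg _) (ha.pos p).le
  -- The gap equation enters here. Expanding the square gives `k (g(p) a(q) + g(q) a(p))` minus
  -- twice the pair term, and each of the two diagonal contributions integrates to `∫ K |f|²`.
  have hgc : (fun p => g p * conv k a p) = fun p => gapK k μ T a p * ‖f p‖ ^ 2 := by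
    ext p
    rw [← ha.gapK_mul]
    simp only [g]
    have := (ha.pos p).ne'
    field_simp
  have hgI : Integrable fun p => g p * conv k a p := by
    rw [hgc]
    exact ha.integrable_gapK_mul hk hT hfW
  obtain ⟨h1, h2⟩ := hk.integrable_mul_conv ha.memW hg hg0 hgI
  obtain ⟨h3, h4⟩ := hk.integrable_mul_conv_swap ha.memW hg hg0 hgI
  have e : (fun z : Space d × Space d => k (z.1 - z.2) * (a z.1 * a z.2) *
      ‖f z.1 / a z.1 - f z.2 / a z.2‖ ^ 2) = fun z => k (z.1 - z.2) * (g z.1 * a z.2)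
      + k (z.1 - z.2) * (g z.2 * a z.1) - 2 * (k (z.1 - z.2) * (star (f z.1) * f z.2).re) := by
    ext z
    have p1 := (ha.pos z.1).ne'
    have p2 := (ha.pos z.2).ne'
    have hn : ∀ w : ℂ, ‖w‖ ^ 2 = w.re ^ 2 + w.im ^ 2 := fun w => by
      rw [← Complex.normSq_eq_norm_sq, Complex.normSq_apply]; ring
    simp only [g, hn, Complex.sub_re, Complex.sub_im, Complex.div_ofReal_re,
      Complex.div_ofReal_im, Complex.star_def, Complex.mul_re, Complex.conj_re, Complex.conj_im]
    field_simp
    ring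
  rw [e]
  refine ⟨(h1.add h3).sub (hI.const_mul 2), ?_⟩
  have h5 := integral_sub (h1.add h3) (hI.const_mul 2)
  simp only [Pi.add_apply] at h5
  rw [h5, integral_add h1 h3, h2, h4, integral_const_mul, hgc]
  ring

/-- A function on which the ground state representation vanishes is a multiple of `a`. -/
theorem eq_const_mul (ha : IsGapSolution k μ T a) (hk : IsPairKernel k) {f : Space d → ℂ}
    (h0 : ∀ᵐ z : Space d × Space d ∂(volume.prod volume), k (z.1 - z.2) * (a z.1 * a z.2) *
      ‖f z.1 / a z.1 - f z.2 / a z.2‖ ^ 2 = 0) :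
    ∃ c : ℂ, f =ᵐ[volume] fun p => c * a p := by
  obtain ⟨r, hr, hkr⟩ := hk.pos_near
  set w : Space d → ℂ := fun p => f p / a p
  -- By Fubini almost every `p` sees a constant quotient `w = f / a` on the ball where `k` is
  -- positive.
  have hgood : ∀ᵐ p : Space d, ∀ᵐ q : Space d, q ∈ Metric.ball p r → w q = w p := by
    filter_upwards [Measure.ae_ae_of_ae_prod h0] with p hp
    filter_upwards [hp] with q hq hqp
    have h1 : 0 < k (p - q) := hkr _ (by simpa [dist_eq_norm, norm_sub_rev] using hqp)
    have h2 := ha.pos p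
    have h3 := ha.pos q
    have h4 : ‖w p - w q‖ ^ 2 = 0 := (mul_eq_zero.1 hq).resolve_left (by positivity)
    exact (sub_eq_zero.1 (norm_eq_zero.1 (pow_eq_zero_iff (two_ne_zero)|>.1 h4))).symm
  obtain ⟨p₀, hp₀⟩ := hgood.exists
  -- The radius is halved so that the constant can be passed from `x` to `y`: a good point `p` in
  -- both half-balls has an `r`-ball containing the half-ball around `y`. Such `p` exists because
  -- the intersection is open and non-empty.
  have huniv : {x : Space d | ∀ᵐ q : Space d, q ∈ Metric.ball x (r / 2) → w q = w p₀}
      = Set.univ := by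
    refine eq_univ_of_ball_subset hr ⟨p₀, ?_⟩ fun x hx y hy => ?_
    · filter_upwards [hp₀] with q hq hqp
      exact hq (Metric.ball_subset_ball (by linarith) hqp)
    · have hne : (Metric.ball x (r / 2) ∩ Metric.ball y (r / 2)).Nonempty := by
        refine ⟨midpoint ℝ x y, ?_, ?_⟩
        · rw [Metric.mem_ball, dist_midpoint_left, Real.norm_ofNat, dist_comm]
          linarith
        · rw [Metric.mem_ball, dist_midpoint_right, Real.norm_ofNat, dist_comm]
          linarith
      have hm : 0 < volume (Metric.ball x (r / 2) ∩ Metric.ball y (r / 2)) :=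
        (Metric.isOpen_ball.inter Metric.isOpen_ball).measure_pos volume hne
      obtain ⟨p, ⟨hpx, hpy⟩, hpg, hpw⟩ : ∃ p ∈ Metric.ball x (r / 2) ∩ Metric.ball y (r / 2),
          (∀ᵐ q : Space d, q ∈ Metric.ball p r → w q = w p) ∧
          (p ∈ Metric.ball x (r / 2) → w p = w p₀) := by
        by_contra hcon
        push Not at hcon
        refine hm.ne' (measure_mono_null ?_ (hgood.and hx))
        intro p hp hp2
        obtain ⟨h5, h6⟩ := hcon p hp hp2.1
        exact h6 (hp2.2 h5)
      filter_upwards [hpg] with q hq hqy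
      rw [← hpw hpx]
      refine hq ?_
      rw [Metric.mem_ball] at *
      calc dist q p ≤ dist q y + dist p y := dist_triangle_right _ _ _
        _ < r := by linarith
  refine ⟨w p₀, ?_⟩
  have : ∀ᵐ q : Space d, w q = w p₀ := by
    refine measure_null_of_locally_null _ fun x _ => ?_
    have hx : x ∈ {x : Space d | ∀ᵐ q : Space d, q ∈ Metric.ball x (r / 2) → w q = w p₀} :=
      huniv ▸ Set.mem_univ x
    refine ⟨{q | w q = w p₀}ᶜ ∩ Metric.ball x (r / 2),
      Filter.inter_mem self_mem_nhdsWithin (mem_nhdsWithin_of_mem_nhds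
        (Metric.ball_mem_nhds x (by linarith))), ?_⟩
    refine measure_mono_null ?_ hx
    rintro q ⟨h1, h2⟩ h3
    exact h1 (h3 h2)
  filter_upwards [this] with q hq
  rw [← hq]
  have : (a q : ℂ) ≠ 0 := by exact_mod_cast (ha.pos q).ne'
  simp only [w]
  field_simp

end IsGapSolution

/-! ### Consequences for `K + V`, and existence of a gap solution below the critical temperature. -/

section Potential

variable {V : Space d → ℝ}

lemma form_re_eq (hd : d = 1 ∨ d = 2 ∨ d = 3) (hV : IsAdmissible V) (hneg : IsNegativeType V)
    {K : Space d → ℝ} {ψ : L2 d} (hψ : MemH1 ψ) :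
    Integrable (fun z : Space d × Space d =>
      pairKernel V (z.1 - z.2) * (star (hat ψ z.1) * hat ψ z.2).re) (volume.prod volume) ∧
    (form K V ψ ψ).re = (∫ p, K p * ‖hat ψ p‖ ^ 2) - ∫ z : Space d × Space d,
      pairKernel V (z.1 - z.2) * (star (hat ψ z.1) * hat ψ z.2).re ∂(volume.prod volume) := by
  obtain ⟨h1, h2⟩ := potential_form_eq hd hV hneg hψ hψ
  have e : ∀ z : Space d × Space d, ((pairKernel V (z.1 - z.2) : ℂ) *
      (star (hat ψ z.1) * hat ψ z.2)).re
      = pairKernel V (z.1 - z.2) * (star (hat ψ z.1) * hat ψ z.2).re := fun z =>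
    Complex.re_ofReal_mul _ _
  have h3 := h1.re
  simp only [RCLike.re_eq_complex_re, e] at h3
  refine ⟨h3, ?_⟩
  have e2 : (fun p => (K p : ℂ) * (star (hat ψ p) * hat ψ p))
      = fun p => ((K p * ‖hat ψ p‖ ^ 2 : ℝ) : ℂ) := by
    ext p
    rw [Complex.star_def, ← Complex.normSq_eq_conj_mul_self, Complex.normSq_eq_norm_sq]
    push_cast
    rfl
  have h4 : (∫ z : Space d × Space d, (pairKernel V (z.1 - z.2) : ℂ) *
      (star (hat ψ z.1) * hat ψ z.2) ∂(volume.prod volume)).re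
      = ∫ z : Space d × Space d, pairKernel V (z.1 - z.2) * (star (hat ψ z.1) * hat ψ z.2).re
        ∂(volume.prod volume) := by
    simp_rw [← e]
    exact (integral_re h1).symm
  rw [form, h2, e2, integral_complex_ofReal, Complex.add_re, Complex.ofReal_re, Complex.neg_re, h4]
  ring

lemma form_self_re {K : Space d → ℝ} (ψ : L2 d) :
    (form K V ψ ψ).re = (∫ p, K p * ‖hat ψ p‖ ^ 2) + ∫ x, V x * ‖ψ x‖ ^ 2 := by
  have e : ∀ (r : ℝ) (w : ℂ), (r : ℂ) * (star w * w) = ((r * ‖w‖ ^ 2 : ℝ) : ℂ) := fun r w => by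
    rw [Complex.star_def, ← Complex.normSq_eq_conj_mul_self, Complex.normSq_eq_norm_sq]
    push_cast
    rfl
  simp only [form, e, integral_complex_ofReal, Complex.add_re, Complex.ofReal_re]

namespace IsGapSolution

/-- The form is half of a double integral with non-negative integrand; if it is zero, the quotient
`ψ̂ / a` is constant. -/
theorem form_re_nonneg (ha : IsGapSolution (pairKernel V) μ T a)
    (hd : d = 1 ∨ d = 2 ∨ d = 3) (hV : IsAdmissible V) (hneg : IsNegativeType V) (hT : 0 ≤ T)
    {ψ : L2 d} (hψ : MemH1 ψ) : 0 ≤ (form (gapK (pairKernel V) μ T a) V ψ ψ).re ∧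
    ((form (gapK (pairKernel V) μ T a) V ψ ψ).re = 0 →
      ∃ c : ℂ, hat ψ =ᵐ[volume] fun p => c * a p) := by
  have hk := isPairKernel hd hV hneg
  obtain ⟨h1, h2⟩ := form_re_eq hd hV hneg (K := gapK (pairKernel V) μ T a) hψ
  obtain ⟨h3, h4⟩ := ha.ground_state_representation hk hT (hat_measurable ψ) (memW_norm_hat hψ) h1
  rw [← h2] at h4
  have hQ : ∀ z : Space d × Space d, 0 ≤ pairKernel V (z.1 - z.2) * (a z.1 * a z.2) *
      ‖hat ψ z.1 / a z.1 - hat ψ z.2 / a z.2‖ ^ 2 := fun z =>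
    mul_nonneg (mul_nonneg (hk.nonneg _) (mul_nonneg (ha.pos _).le (ha.pos _).le)) (sq_nonneg _)
  refine ⟨?_, fun h => ha.eq_const_mul hk ?_⟩
  · have : 0 ≤ 2 * (form (gapK (pairKernel V) μ T a) V ψ ψ).re := by
      rw [← h4]
      exact integral_nonneg hQ
    linarith
  · rw [h, mul_zero] at h4
    exact (integral_eq_zero_iff_of_nonneg hQ h3).1 h4

/-- Read linearly in `a` with `K` fixed, the gap equation is the eigenvalue equation `(K + V) ψ =
0`, here tested against `H¹` functions. -/
theorem form_eq_zero (ha : IsGapSolution (pairKernel V) μ T a)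
    (hd : d = 1 ∨ d = 2 ∨ d = 3) (hV : IsAdmissible V) (hneg : IsNegativeType V)
    {ψ : L2 d} (hψ : MemH1 ψ) {c : ℂ} (hc : hat ψ =ᵐ[volume] fun p => c * a p)
    {φ : L2 d} (hφ : MemH1 φ) : form (gapK (pairKernel V) μ T a) V φ ψ = 0 := by
  obtain ⟨h1, h2⟩ := potential_form_eq hd hV hneg hφ hψ
  rw [form, h2, integral_prod _ h1, ← sub_eq_add_neg, sub_eq_zero]
  refine integral_congr_ae ?_
  filter_upwards [hc] with p hp
  have e : ∫ q, (pairKernel V (p - q) : ℂ) * (star (hat φ p) * hat ψ q)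
      = ∫ q, (star (hat φ p) * c) * ((pairKernel V (p - q) * a q : ℝ) : ℂ) := by
    refine integral_congr_ae ?_
    filter_upwards [hc] with q hq
    rw [hq]
    push_cast
    ring
  rw [e, integral_const_mul, integral_complex_ofReal, hp]
  have := ha.gapK_mul p
  rw [conv] at this
  rw [← this]
  push_cast
  ring

end IsGapSolution

/-- Here `Δ = 2 c (k ⋆ a)`, and only its modulus matters, so the phase drops out. Equality holds at
every point because a convolution ignores null sets. -/
lemma symbolK_gap (hneg : IsNegativeType V)
    {Γ : State d} {c : ℂ} (hc : ‖c‖ = 1) (hΓ : Γ.alphaHat =ᵐ[volume] fun p => c * a p) :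
    symbolK μ T (gap V Γ) = gapK (pairKernel V) μ T a := by
  ext p
  have e : gap V Γ p = 2 * c * (conv (pairKernel V) a p : ℝ) := by
    rw [gap, mul_assoc, ← integral_const_mul, conv, ← integral_complex_ofReal,
      ← integral_const_mul, ← integral_const_mul]
    refine integral_congr_ae ?_
    filter_upwards [hΓ] with q hq
    rw [hq, Complex.ofReal_mul, ofReal_pairKernel hneg]
    ring
  rw [symbolK_eq, dispersion, e, gapK, gapSymbol]
  congr 3
  rw [norm_mul, norm_mul, hc, Complex.norm_real, Real.norm_eq_abs, mul_pow, mul_pow, mul_pow,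
    sq_abs]
  norm_num

lemma symbolK_zero (p : Space d) : symbolK μ T (fun _ => 0) p = gapSymbol μ T 0 p := by
  rw [symbolK_eq, dispersion, gapSymbol]
  simp

/-- Below the critical temperature the form of `K_T^0 - k ⋆` takes negative values. -/
theorem exists_trial (hd : d = 1 ∨ d = 2 ∨ d = 3) (hV : IsAdmissible V)
    (hneg : IsNegativeType V) (hT0 : 0 ≤ T) (hT : T < criticalTemperature μ V) :
    ∃ u, MemW u ∧ ∫ p, gapSymbol μ T 0 p * u p ^ 2 < pairForm (pairKernel V) u := by
  have hk := isPairKernel hd hV hneg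
  have hmem : ∀ t, 0 < t → t < criticalTemperature μ V →
      ¬ OperatorNonneg (symbolK μ t (fun _ => 0)) V := fun t ht htc hn =>
    htc.not_ge (csInf_le ⟨0, fun s hs => hs.1.le⟩ ⟨ht, hn⟩)
  -- The critical temperature only involves positive temperatures. For `T = 0` one uses `T_c / 2`
  -- and the inequality `K_0 ≤ K_t`.
  obtain ⟨t, ht, htc, hκ⟩ : ∃ t, 0 < t ∧ t < criticalTemperature μ V ∧
      ∀ E, 0 ≤ E → kappa T E ≤ kappa t E := by
    rcases hT0.eq_or_lt with rfl | h
    · refine ⟨criticalTemperature μ V / 2, by linarith, by linarith, fun E hE => ?_⟩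
      rw [show kappa 0 E = E by simp [kappa]]
      exact le_kappa (by linarith) hE
    · exact ⟨T, h, hT, fun E _ => le_rfl⟩
  have h := hmem t ht htc
  simp only [OperatorNonneg, not_forall, not_le] at h
  obtain ⟨ψ, hψ, h⟩ := h
  obtain ⟨h1, h2⟩ := form_re_eq hd hV hneg (K := symbolK μ t (fun _ => 0)) hψ
  have hu := memW_norm_hat hψ
  -- The trial function is `|ψ̂|`: the kinetic term is unchanged and, as `k ≥ 0`, the pair term can
  -- only grow.
  refine ⟨_, hu, ?_⟩
  have h3 : ∫ z : Space d × Space d, pairKernel V (z.1 - z.2) * (star (hat ψ z.1) * hat ψ z.2).re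
      ∂(volume.prod volume) ≤ pairForm (pairKernel V) fun p => ‖hat ψ p‖ := by
    refine integral_mono h1 (hk.integrable_mul hu hu) fun z => ?_
    refine mul_le_mul_of_nonneg_left ((Complex.re_le_norm _).trans_eq ?_) (hk.nonneg _)
    rw [norm_mul, norm_star]
  have h4 : ∫ p, gapSymbol μ T 0 p * ‖hat ψ p‖ ^ 2
      ≤ ∫ p, symbolK μ t (fun _ => 0) p * ‖hat ψ p‖ ^ 2 := by
    simp only [symbolK_zero]
    refine integral_mono_of_nonneg (Filter.Eventually.of_forall fun p =>
      mul_nonneg (gapSymbol_nonneg hT0 _ _) (sq_nonneg _)) ?_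
      (Filter.Eventually.of_forall fun p =>
        mul_le_mul_of_nonneg_right (hκ _ (Real.sqrt_nonneg _)) (sq_nonneg _))
    refine (hu.integrable.const_mul (1 + |μ| + 2 * t)).mono'
      ((measurable_gapSymbol measurable_const).mul
        (hu.measurable.pow_const 2)).aestronglyMeasurable (Filter.Eventually.of_forall fun p => ?_)
    rw [Real.norm_of_nonneg (mul_nonneg (gapSymbol_nonneg ht.le _ _) (sq_nonneg _)), ← mul_assoc]
    refine mul_le_mul_of_nonneg_right ?_ (sq_nonneg _)
    have h1 := gapSymbol_le (μ := μ) ht.le le_rfl p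
    have h3 : |‖p‖ ^ 2 - μ| ≤ ‖p‖ ^ 2 + |μ| := by
      refine (abs_sub _ _).trans ?_
      rw [abs_of_nonneg (sq_nonneg ‖p‖)]
    nlinarith [sq_nonneg ‖p‖, mul_nonneg (abs_nonneg μ) (sq_nonneg ‖p‖),
      mul_nonneg ht.le (sq_nonneg ‖p‖)]
  linarith

/-- Existence of a positive solution of the gap equation below the critical temperature. -/
theorem exists_isGapSolution (hd : d = 1 ∨ d = 2 ∨ d = 3) (hμ : 0 < μ) (hV : IsAdmissible V)
    (hneg : IsNegativeType V) (hT0 : 0 ≤ T) (hT : T < criticalTemperature μ V) :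
    ∃ a, IsGapSolution (pairKernel V) μ T a := by
  obtain ⟨u, hu, h⟩ := exists_trial hd hV hneg hT0 hT
  exact exists_gapSolution (by omega) (isPairKernel hd hV hneg) hμ hT0 hu h

end Potential
end BCS

end

/-! ### Spectral calculus of the matrices `Γ̂(p)`. -/

noncomputable section

namespace BCS

/-- The Hermitian matrix with rows `(x, w)` and `(conj w, 1 - x)`. -/
def pairMatrix (x : ℝ) (w : ℂ) : Matrix (Fin 2) (Fin 2) ℂ :=
  !![(x : ℂ), w; star w, 1 - (x : ℂ)]

/-- The distance of the eigenvalues of `pairMatrix x w` to `1/2`. -/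
def pairRadius (x : ℝ) (w : ℂ) : ℝ := Real.sqrt ((x - 1 / 2) ^ 2 + ‖w‖ ^ 2)

lemma pairRadius_nonneg (x : ℝ) (w : ℂ) : 0 ≤ pairRadius x w := Real.sqrt_nonneg _

lemma sq_pairRadius (x : ℝ) (w : ℂ) : pairRadius x w ^ 2 = (x - 1 / 2) ^ 2 + ‖w‖ ^ 2 :=
  Real.sq_sqrt (by positivity)

lemma pairMatrix_isHermitian (x : ℝ) (w : ℂ) : (pairMatrix x w).IsHermitian := by
  ext i j
  fin_cases i <;> fin_cases j <;> simp [pairMatrix]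

lemma pairMatrix_det (x : ℝ) (w : ℂ) :
    (pairMatrix x w).det = ((1 / 4 - pairRadius x w ^ 2 : ℝ) : ℂ) := by
  have : w * star w = ((‖w‖ ^ 2 : ℝ) : ℂ) := by
    rw [Complex.star_def, Complex.mul_conj, Complex.normSq_eq_norm_sq]
  rw [sq_pairRadius, pairMatrix, Matrix.det_fin_two_of, this]
  push_cast
  ring

/-- Trace `1` and determinant `1/4 - r²` determine the eigenvalues as `1/2 ± r`. The disjunction
avoids having to know their order. -/
lemma pairMatrix_eigenvalues (x : ℝ) (w : ℂ) :
    (pairMatrix_isHermitian x w).eigenvalues 1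
      = 1 - (pairMatrix_isHermitian x w).eigenvalues 0 ∧
    ((pairMatrix_isHermitian x w).eigenvalues 0 = 1 / 2 + pairRadius x w ∨
      (pairMatrix_isHermitian x w).eigenvalues 0 = 1 - (1 / 2 + pairRadius x w)) := by
  set l := (pairMatrix_isHermitian x w).eigenvalues
  have h1 : (l 0 : ℂ) + l 1 = 1 := by
    have := (pairMatrix_isHermitian x w).trace_eq_sum_eigenvalues
    rw [Fin.sum_univ_two] at this
    rw [← Complex.coe_algebraMap]
    refine this.symm.trans ?_
    simp [pairMatrix, Matrix.trace, Fin.sum_univ_two]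
  have h2 : (l 0 : ℂ) * l 1 = ((1 / 4 - pairRadius x w ^ 2 : ℝ) : ℂ) := by
    have := (pairMatrix_isHermitian x w).det_eq_prod_eigenvalues
    rw [Fin.prod_univ_two, pairMatrix_det] at this
    exact this.symm
  have h3 : l 0 + l 1 = 1 := by exact_mod_cast h1
  have h4 : l 0 * l 1 = 1 / 4 - pairRadius x w ^ 2 := by exact_mod_cast h2
  refine ⟨by linarith, ?_⟩
  have h5 : (l 0 - (1 / 2 + pairRadius x w)) * (l 0 - (1 - (1 / 2 + pairRadius x w))) = 0 := by
    rw [show l 1 = 1 - l 0 by linarith] at h4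
    linear_combination -h4
  rcases mul_eq_zero.1 h5 with h | h
  · exact Or.inl (by linarith)
  · exact Or.inr (by linarith)

lemma pairMatrix_posSemidef_iff (x : ℝ) (w : ℂ) :
    (pairMatrix x w).PosSemidef ↔ pairRadius x w ≤ 1 / 2 := by
  rw [(pairMatrix_isHermitian x w).posSemidef_iff_eigenvalues_nonneg]
  obtain ⟨h1, h2⟩ := pairMatrix_eigenvalues x w
  have h0 := pairRadius_nonneg x w
  constructor
  · intro h
    have h3 := h 0
    have h4 := h 1
    simp only [Pi.zero_apply] at h3 h4
    rcases h2 with h2 | h2 <;> linarith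
  · intro h i
    fin_cases i
    · change 0 ≤ (pairMatrix_isHermitian x w).eigenvalues 0
      rcases h2 with h2 | h2 <;> linarith
    · change 0 ≤ (pairMatrix_isHermitian x w).eigenvalues 1
      rcases h2 with h2 | h2 <;> linarith

lemma one_sub_pairMatrix (x : ℝ) (w : ℂ) : 1 - pairMatrix x w = pairMatrix (1 - x) (-w) := by
  ext i j
  fin_cases i <;> fin_cases j <;> simp [pairMatrix]

/-- Passing to `1 - Γ̂` only exchanges the two eigenvalues, so `0 ≤ Γ̂` and `Γ̂ ≤ 1` are the same
condition on the radius. -/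
lemma pairRadius_one_sub (x : ℝ) (w : ℂ) : pairRadius (1 - x) (-w) = pairRadius x w := by
  rw [pairRadius, pairRadius, norm_neg]
  congr 2
  ring

lemma trace_mul_cfc (x : ℝ) (w : ℂ) :
    (Matrix.trace (pairMatrix x w * cfc Real.log (pairMatrix x w))).re
      = hfun (pairRadius x w) := by
  have hA := pairMatrix_isHermitian x w
  obtain ⟨h1, h2⟩ := pairMatrix_eigenvalues x w
  have e : pairMatrix x w * cfc Real.log (pairMatrix x w)
      = cfc (fun t : ℝ => t * Real.log t) (pairMatrix x w) := by
    -- A finite spectrum makes the logarithm continuous on it, even if `0` is an eigenvalue.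
    have hf : (spectrum ℝ (pairMatrix x w)).Finite := Matrix.finite_real_spectrum
    rw [cfc_mul (fun t : ℝ => t) Real.log (pairMatrix x w) (hf.continuousOn _) (hf.continuousOn _),
      cfc_id' ℝ (pairMatrix x w) hA.isSelfAdjoint]
  have htr : Matrix.trace (cfc (fun t : ℝ => t * Real.log t) (pairMatrix x w))
      = ((hA.eigenvalues 0 * Real.log (hA.eigenvalues 0)
        + hA.eigenvalues 1 * Real.log (hA.eigenvalues 1) : ℝ) : ℂ) := by
    rw [hA.cfc_eq, Matrix.IsHermitian.cfc]
    rw [Unitary.conjStarAlgAut_apply, Matrix.trace_mul_cycle, Unitary.coe_star_mul_self, one_mul,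
      Matrix.trace_diagonal, Fin.sum_univ_two]
    simp
  rw [e, htr, Complex.ofReal_re, h1, hfun]
  rcases h2 with h2 | h2
  · rw [h2, Real.binEntropy]
    simp only [Real.log_inv]
    ring
  · rw [h2, Real.binEntropy]
    simp only [Real.log_inv]
    ring_nf

end BCS

end

/-! ### Integrability of the free energy density and its excess over the gap state. -/

noncomputable section

namespace BCS

variable {d : ℕ} {μ T : ℝ} {V : Space d → ℝ}

lemma integrable_exp_neg_sq {b : ℝ} (hb : 0 < b) :
    Integrable fun p : Space d => Real.exp (-b * ‖p‖ ^ 2) := by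
  have h := (GaussianFourier.integrable_cexp_neg_mul_sq_norm_add (V := Space d)
    (b := (b : ℂ)) (by simpa) 0 0).norm
  refine h.congr (Filter.Eventually.of_forall fun p => ?_)
  simp only [Complex.norm_exp]
  congr 1
  norm_cast
  simp

lemma integrable_mul_exp_neg_kinetic (μ : ℝ) {t : ℝ} (ht : 0 < t) :
    Integrable fun p : Space d => (1 + ‖p‖ ^ 2) * Real.exp (-((‖p‖ ^ 2 - μ) / t)) := by
  refine ((integrable_exp_neg_sq (d := d) (b := 1 / (2 * t)) (by positivity)).const_mul
    ((1 + 2 * t) * Real.exp (μ / t))).mono' (by fun_prop) (Filter.Eventually.of_forall fun p => ?_)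
  rw [Real.norm_of_nonneg (by positivity)]
  -- Half of the Gaussian decay is spent on the polynomial weight.
  have h1 : 1 + ‖p‖ ^ 2 ≤ (1 + 2 * t) * Real.exp (‖p‖ ^ 2 / (2 * t)) := by
    have e1 := Real.add_one_le_exp (‖p‖ ^ 2 / (2 * t))
    have e2 : 0 ≤ ‖p‖ ^ 2 / (2 * t) := by positivity
    have e3 : ‖p‖ ^ 2 / (2 * t) * (2 * t) = ‖p‖ ^ 2 := by field_simp
    nlinarith
  calc (1 + ‖p‖ ^ 2) * Real.exp (-((‖p‖ ^ 2 - μ) / t))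
      ≤ (1 + 2 * t) * Real.exp (‖p‖ ^ 2 / (2 * t)) * Real.exp (-((‖p‖ ^ 2 - μ) / t)) := by gcongr
    _ = (1 + 2 * t) * Real.exp (μ / t) * Real.exp (-(1 / (2 * t)) * ‖p‖ ^ 2) := by
        rw [mul_assoc, mul_assoc, ← Real.exp_add, ← Real.exp_add]
        congr 2
        field_simp
        ring

/-- The binary entropy is controlled by the energy. -/
lemma binEntropy_le {x t : ℝ} (h0 : 0 ≤ x) (h1 : x ≤ 1) :
    Real.binEntropy x ≤ (t + 1) * x + Real.exp (-t) := by
  rw [Real.binEntropy]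
  -- This is `log y ≤ y - 1` at `y = exp (-t) / x`. With `t = p²` the resulting bound is integrable.
  have e1 : x * Real.log x⁻¹ ≤ t * x + Real.exp (-t) - x := by
    rcases h0.eq_or_lt with rfl | hx
    · simpa using (Real.exp_pos _).le
    · have h := Real.log_le_sub_one_of_pos (show 0 < x⁻¹ * Real.exp (-t) by positivity)
      rw [Real.log_mul (by positivity) (by positivity), Real.log_exp] at h
      have h2 := mul_le_mul_of_nonneg_left h hx.le
      have h3 : x * (x⁻¹ * Real.exp (-t) - 1) = Real.exp (-t) - x := by field_simp
      rw [h3] at h2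
      linarith
  have e2 : (1 - x) * Real.log (1 - x)⁻¹ ≤ x := by
    rcases h1.eq_or_lt with rfl | hx
    · simp
    · have h := Real.log_le_sub_one_of_pos (show 0 < (1 - x)⁻¹ by
        have : 0 < 1 - x := by linarith
        positivity)
      have h2 := mul_le_mul_of_nonneg_left h (by linarith : 0 ≤ 1 - x)
      have h3 : (1 - x) * ((1 - x)⁻¹ - 1) = x := by
        have : 1 - x ≠ 0 := by linarith
        field_simp
        ring
      rwa [h3] at h2
  linarith [Real.exp_pos (-t)]

/-- The off-diagonal entry pushes the eigenvalues away from `1/2`, where binary entropy is largest;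
the entropy is thus controlled by `γ̂` alone. -/
lemma neg_hfun_le {x : ℝ} {w : ℂ} (h : pairRadius x w ≤ 1 / 2) :
    -hfun (pairRadius x w) ≤ Real.binEntropy x := by
  have h0 := pairRadius_nonneg x w
  have h1 : |x - 1 / 2| ≤ pairRadius x w := by
    rw [← Real.sqrt_sq_eq_abs]
    exact Real.sqrt_le_sqrt (by nlinarith [sq_nonneg ‖w‖])
  have h2 := abs_le.1 h1
  rw [hfun, neg_neg]
  rcases le_total (1 / 2) x with hx | hx
  · exact Real.binEntropy_strictAntiOn.antitoneOn ⟨by linarith, by linarith⟩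
      ⟨by linarith, by linarith⟩ (by linarith)
  · rw [← Real.binEntropy_one_sub x]
    exact Real.binEntropy_strictAntiOn.antitoneOn ⟨by linarith, by linarith⟩
      ⟨by linarith, by linarith⟩ (by linarith)

lemma mem_Icc_of_pairRadius_le {x : ℝ} {w : ℂ} (h : pairRadius x w ≤ 1 / 2) :
    0 ≤ x ∧ x ≤ 1 := by
  have h1 : |x - 1 / 2| ≤ pairRadius x w := by
    rw [← Real.sqrt_sq_eq_abs]
    exact Real.sqrt_le_sqrt (by nlinarith [sq_nonneg ‖w‖])
  have h2 := abs_le.1 h1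
  constructor <;> linarith

/-- The distance of the eigenvalues of `Γ̂(p)` to `1/2`. -/
def State.radius (Γ : State d) (p : Space d) : ℝ := pairRadius (Γ.gammaHat p) (Γ.alphaHat p)

lemma State.memDomain_of_radius {Γ : State d} (h1 : ∀ᵐ p, Γ.radius p ≤ 1 / 2)
    (h2 : Integrable (fun p : Space d => (1 + ‖p‖ ^ 2) * Γ.gammaHat p)) (h3 : MemH1 Γ.alpha)
    (h4 : ∀ᵐ p, Γ.alphaHat (-p) = Γ.alphaHat p) : Γ.MemDomain := by
  refine ⟨?_, ?_, h2, h3, h4⟩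
  · filter_upwards [h1] with p hp
    exact (pairMatrix_posSemidef_iff _ _).2 hp
  · filter_upwards [h1] with p hp
    change (1 - pairMatrix _ _).PosSemidef
    rw [one_sub_pairMatrix, pairMatrix_posSemidef_iff, pairRadius_one_sub]
    exact hp

namespace State.MemDomain

variable {Γ : State d}

lemma radius_le (h : Γ.MemDomain) : ∀ᵐ p, Γ.radius p ≤ 1 / 2 := by
  filter_upwards [h.nonneg] with p hp
  exact (pairMatrix_posSemidef_iff _ _).1 hp

/-- Measurability is recovered from the weighted integrability by dividing out the continuous
positive weight. -/
lemma aestronglyMeasurable_gammaHat (h : Γ.MemDomain) : AEStronglyMeasurable Γ.gammaHat := by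
  have h1 : Continuous fun p : Space d => (1 + ‖p‖ ^ 2)⁻¹ :=
    Continuous.inv₀ (by fun_prop) fun p => by positivity
  refine (h1.aestronglyMeasurable.mul h.integrable_gamma.1).congr
    (Filter.Eventually.of_forall fun p => ?_)
  have : 1 + ‖p‖ ^ 2 ≠ 0 := by positivity
  simp only [Pi.mul_apply]
  field_simp

lemma aestronglyMeasurable_radius (h : Γ.MemDomain) : AEStronglyMeasurable Γ.radius := by
  have h1 := h.aestronglyMeasurable_gammaHat
  have h2 : AEStronglyMeasurable Γ.alphaHat volume :=
    (hat_measurable Γ.alpha).aestronglyMeasurable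
  exact Real.continuous_sqrt.comp_aestronglyMeasurable
    (((h1.sub aestronglyMeasurable_const).pow 2).add (h2.norm.pow 2))

lemma integrable_kinetic (h : Γ.MemDomain) (μ : ℝ) :
    Integrable fun p => (‖p‖ ^ 2 - μ) * Γ.gammaHat p := by
  refine (h.integrable_gamma.norm.const_mul (1 + |μ|)).mono'
    ((by fun_prop : Continuous fun p : Space d => ‖p‖ ^ 2 - μ).aestronglyMeasurable.mul
      h.aestronglyMeasurable_gammaHat) (Filter.Eventually.of_forall fun p => ?_)
  rw [norm_mul, norm_mul, ← mul_assoc]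
  refine mul_le_mul_of_nonneg_right ?_ (norm_nonneg _)
  rw [Real.norm_eq_abs, Real.norm_of_nonneg (by positivity : 0 ≤ 1 + ‖p‖ ^ 2)]
  have h3 : |‖p‖ ^ 2 - μ| ≤ ‖p‖ ^ 2 + |μ| := by
    refine (abs_sub _ _).trans ?_
    rw [abs_of_nonneg (sq_nonneg ‖p‖)]
  nlinarith [sq_nonneg ‖p‖, mul_nonneg (abs_nonneg μ) (sq_nonneg ‖p‖)]

/-- The density is dominated by `(1 + p²) γ̂ + exp (-p²)`. The entropy of every admissible state is
therefore a convergent integral, and free energies may be subtracted term by term. -/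
lemma integrable_hfun (h : Γ.MemDomain) : Integrable fun p => hfun (Γ.radius p) := by
  refine (h.integrable_gamma.add (integrable_exp_neg_sq one_pos)).mono'
    (continuous_hfun.comp_aestronglyMeasurable h.aestronglyMeasurable_radius) ?_
  filter_upwards [h.radius_le] with p hp
  rw [State.radius] at hp ⊢
  rw [Real.norm_of_nonpos (hfun_nonpos (pairRadius_nonneg _ _) hp)]
  obtain ⟨h0, h1⟩ := mem_Icc_of_pairRadius_le hp
  refine (neg_hfun_le hp).trans ((binEntropy_le (t := ‖p‖ ^ 2) h0 h1).trans_eq ?_)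
  simp [add_comm]

end State.MemDomain

lemma freeEnergy_eq (Γ : State d) (μ T : ℝ) (V : Space d → ℝ) : freeEnergy μ T V Γ
    = (∫ p, (‖p‖ ^ 2 - μ) * Γ.gammaHat p) + T * (∫ p, hfun (Γ.radius p))
      + ∫ x, V x * ‖Γ.alpha x‖ ^ 2 := by
  have e : ∀ p, (Matrix.trace (Γ.matrix p * cfc Real.log (Γ.matrix p))).re = hfun (Γ.radius p) :=
    fun p => trace_mul_cfc _ _
  rw [freeEnergy, entropy]
  simp_rw [e]
  ring

/-- The momentum distribution of the minimizer. -/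
def gapGamma (k : Space d → ℝ) (μ T : ℝ) (a : Space d → ℝ) (p : Space d) : ℝ :=
  1 / 2 - (‖p‖ ^ 2 - μ) / (2 * gapK k μ T a p)

/-- The dispersion relation belonging to a solution of the gap equation. -/
def gapE (k : Space d → ℝ) (μ : ℝ) (a : Space d → ℝ) (p : Space d) : ℝ :=
  Real.sqrt ((‖p‖ ^ 2 - μ) ^ 2 + (2 * conv k a p) ^ 2)

namespace IsGapSolution

variable {k a : Space d → ℝ}

lemma gapE_nonneg (p : Space d) : 0 ≤ gapE k μ a p := Real.sqrt_nonneg _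

lemma gapE_pos (ha : IsGapSolution k μ T a) (p : Space d) : 0 < gapE k μ a p := by
  have := ha.conv_pos p
  exact Real.sqrt_pos.2 (by positivity)

lemma gapK_eq_kappa (p : Space d) : gapK k μ T a p = kappa T (gapE k μ a p) := rfl

/-- With `ξ = p² - μ` and `b = k ⋆ a`, the entries are `γ̂ - 1/2 = -ξ / 2K` and `|w| = 2b / 2K`, and
`ξ² + (2b)² = E²`. -/
lemma pairRadius_gapGamma (ha : IsGapSolution k μ T a) (hT : 0 ≤ T) (p : Space d) {w : ℂ}
    (hw : ‖w‖ = a p) :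
    pairRadius (gapGamma k μ T a p) w = gapE k μ a p / (2 * gapK k μ T a p) := by
  have hK := ha.gapK_pos hT p
  have hE : gapE k μ a p ^ 2 = (‖p‖ ^ 2 - μ) ^ 2 + (2 * conv k a p) ^ 2 :=
    Real.sq_sqrt (by positivity)
  rw [pairRadius, hw, Real.sqrt_eq_iff_mul_self_eq (by positivity)
    (div_nonneg (gapE_nonneg p) (by positivity)), ← sq, div_pow, hE, ← ha.gapK_mul, gapGamma]
  field_simp
  ring

lemma pairRadius_gapGamma_le (ha : IsGapSolution k μ T a) (hT : 0 ≤ T) (p : Space d) {w : ℂ}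
    (hw : ‖w‖ = a p) : pairRadius (gapGamma k μ T a p) w ≤ 1 / 2 := by
  rw [ha.pairRadius_gapGamma hT p hw, gapK_eq_kappa]
  exact div_kappa_le hT (gapE_nonneg p)

lemma abs_kinetic_le_gapE (p : Space d) : |‖p‖ ^ 2 - μ| ≤ gapE k μ a p := by
  rw [← Real.sqrt_sq_eq_abs]
  exact Real.sqrt_le_sqrt (by nlinarith [sq_nonneg (2 * conv k a p)])

/-- Outside the Fermi ball `γ ≤ 1/2`, so `γ ≤ 2 γ (1 - γ) = 2 (1/4 - r₀²) + 2 a²`, and the first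
term decays exponentially. Inside, the exponential is at least `1` and `γ ≤ 1`. -/
lemma exists_gapGamma_le (ha : IsGapSolution k μ T a) (hT : 0 ≤ T) : ∃ t, 0 < t ∧ ∀ p,
    gapGamma k μ T a p ≤ 2 * Real.exp (-((‖p‖ ^ 2 - μ) / t)) + 2 * a p ^ 2 := by
  obtain ⟨t, ht, h⟩ : ∃ t, 0 < t ∧ ∀ p, 1 / 4 - (gapE k μ a p / (2 * gapK k μ T a p)) ^ 2
      ≤ Real.exp (-((‖p‖ ^ 2 - μ) / t)) := by
    rcases hT.eq_or_lt with rfl | hT'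
    · refine ⟨1, one_pos, fun p => ?_⟩
      rw [gapK_eq_kappa, div_kappa_zero (ha.gapE_pos p)]
      refine le_trans ?_ (Real.exp_pos _).le
      norm_num
    · refine ⟨T, hT', fun p => ?_⟩
      rw [gapK_eq_kappa]
      refine (quarter_sub_sq_le hT' (gapE_nonneg p)).trans (Real.exp_le_exp.2 ?_)
      have := (le_abs_self _).trans (abs_kinetic_le_gapE (k := k) (μ := μ) (a := a) p)
      gcongr
  refine ⟨t, ht, fun p => ?_⟩
  have hK := ha.gapK_pos hT p
  have hw : ‖(a p : ℂ)‖ = a p := by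
    rw [Complex.norm_real, Real.norm_of_nonneg (ha.pos p).le]
  have h1 := ha.pairRadius_gapGamma hT p hw
  obtain ⟨h2, h3⟩ := mem_Icc_of_pairRadius_le (ha.pairRadius_gapGamma_le hT p hw)
  rcases le_total (‖p‖ ^ 2 - μ) 0 with hξ | hξ
  · have : 1 ≤ Real.exp (-((‖p‖ ^ 2 - μ) / t)) :=
      Real.one_le_exp (neg_nonneg.2 (div_nonpos_of_nonpos_of_nonneg hξ ht.le))
    nlinarith [sq_nonneg (a p)]
  · have h4 : gapGamma k μ T a p ≤ 1 / 2 := by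
      rw [gapGamma]
      have : 0 ≤ (‖p‖ ^ 2 - μ) / (2 * gapK k μ T a p) := by positivity
      linarith
    have h5 := sq_pairRadius (gapGamma k μ T a p) (a p : ℂ)
    rw [h1, hw] at h5
    have h6 := h p
    nlinarith

lemma measurable_gapGamma (ha : IsGapSolution k μ T a) (hk : IsPairKernel k) :
    Measurable (gapGamma k μ T a) :=
  (((measurable_norm.pow_const 2).sub_const μ).div
    ((ha.measurable_gapK hk).const_mul 2)).const_sub _

lemma integrable_gapGamma (ha : IsGapSolution k μ T a) (hk : IsPairKernel k) (hT : 0 ≤ T) :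
    Integrable fun p : Space d => (1 + ‖p‖ ^ 2) * gapGamma k μ T a p := by
  obtain ⟨t, ht, h⟩ := ha.exists_gapGamma_le hT
  refine (((integrable_mul_exp_neg_kinetic μ ht).const_mul 2).add
    (ha.memW.integrable.const_mul 2)).mono'
    (((measurable_norm.pow_const 2).const_add 1).mul
      (ha.measurable_gapGamma hk)).aestronglyMeasurable (Filter.Eventually.of_forall fun p => ?_)
  have hw : ‖(a p : ℂ)‖ = a p := by
    rw [Complex.norm_real, Real.norm_of_nonneg (ha.pos p).le]
  have h2 := (mem_Icc_of_pairRadius_le (ha.pairRadius_gapGamma_le hT p hw)).1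
  rw [Real.norm_of_nonneg (by positivity), Pi.add_apply]
  calc (1 + ‖p‖ ^ 2) * gapGamma k μ T a p
      ≤ (1 + ‖p‖ ^ 2) * (2 * Real.exp (-((‖p‖ ^ 2 - μ) / t)) + 2 * a p ^ 2) := by
        have := h p
        gcongr
    _ = _ := by ring

/-- The excess of the free energy density over the one of the minimizer. -/
def excess (k : Space d → ℝ) (μ T : ℝ) (a : Space d → ℝ) (Γ : State d) (p : Space d) : ℝ :=
  (‖p‖ ^ 2 - μ) * (Γ.gammaHat p - gapGamma k μ T a p)
    + T * (hfun (Γ.radius p) - hfun (gapE k μ a p / (2 * gapK k μ T a p)))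
    - gapK k μ T a p * (‖Γ.alphaHat p‖ ^ 2 - a p ^ 2)

/-- Since `p² - μ = -2K (γ_* - 1/2)`, the term linear in `γ̂` completes a square, and `|α̂|² - a²`
is replaced by a difference of squared radii. What remains is the defect in the convexity inequality
for the entropy. -/
lemma excess_eq (ha : IsGapSolution k μ T a) (hT : 0 ≤ T) (Γ : State d) (p : Space d) :
    excess k μ T a Γ p = gapK k μ T a p * (Γ.gammaHat p - gapGamma k μ T a p) ^ 2
      + (T * (hfun (Γ.radius p) - hfun (gapE k μ a p / (2 * gapK k μ T a p)))
        - gapK k μ T a p * (Γ.radius p ^ 2 - (gapE k μ a p / (2 * gapK k μ T a p)) ^ 2)) := by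
  have hK := ha.gapK_pos hT p
  have hw : ‖(a p : ℂ)‖ = a p := by
    rw [Complex.norm_real, Real.norm_of_nonneg (ha.pos p).le]
  have h1 := ha.pairRadius_gapGamma hT p hw
  have h5 := sq_pairRadius (gapGamma k μ T a p) (a p : ℂ)
  rw [h1, hw] at h5
  have h6 : Γ.radius p ^ 2 = _ := sq_pairRadius (Γ.gammaHat p) (Γ.alphaHat p)
  have h7 : ‖p‖ ^ 2 - μ = -2 * gapK k μ T a p * (gapGamma k μ T a p - 1 / 2) := by
    rw [gapGamma]; field_simp; ring
  rw [excess, h5, h6]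
  linear_combination (Γ.gammaHat p - gapGamma k μ T a p) * h7

lemma excess_nonneg (ha : IsGapSolution k μ T a) (hT : 0 ≤ T) {Γ : State d} {p : Space d}
    (hp : Γ.radius p ≤ 1 / 2) : 0 ≤ excess k μ T a Γ p := by
  have hK := ha.gapK_pos hT p
  have h1 := (entropy_convexity hT (gapE_nonneg (k := k) (μ := μ) (a := a) p)
    (by rwa [← gapK_eq_kappa]) (pairRadius_nonneg _ _) hp).1
  rw [← gapK_eq_kappa] at h1
  change gapK k μ T a p * (Γ.radius p ^ 2 - _) ≤ T * (hfun (Γ.radius p) - _) at h1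
  rw [ha.excess_eq hT]
  have : 0 ≤ gapK k μ T a p * (Γ.gammaHat p - gapGamma k μ T a p) ^ 2 := by positivity
  linarith

lemma eq_of_excess_eq_zero (ha : IsGapSolution k μ T a) (hT : 0 ≤ T) {Γ : State d} {p : Space d}
    (hp : Γ.radius p ≤ 1 / 2) (h : excess k μ T a Γ p = 0) :
    Γ.gammaHat p = gapGamma k μ T a p ∧ ‖Γ.alphaHat p‖ = a p := by
  have hK := ha.gapK_pos hT p
  obtain ⟨h1, h2⟩ := entropy_convexity hT (gapE_nonneg (k := k) (μ := μ) (a := a) p)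
    (by rwa [← gapK_eq_kappa]) (pairRadius_nonneg _ _) hp
  rw [← gapK_eq_kappa] at h1 h2
  change gapK k μ T a p * (Γ.radius p ^ 2 - _) ≤ T * (hfun (Γ.radius p) - _) at h1
  change T * (hfun (Γ.radius p) - _) = gapK k μ T a p * (Γ.radius p ^ 2 - _) →
    Γ.radius p = _ at h2
  rw [ha.excess_eq hT] at h
  have h3 : 0 ≤ gapK k μ T a p * (Γ.gammaHat p - gapGamma k μ T a p) ^ 2 := by positivity
  have h4 : gapK k μ T a p * (Γ.gammaHat p - gapGamma k μ T a p) ^ 2 = 0 := by linarith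
  have h5 : Γ.gammaHat p = gapGamma k μ T a p := by
    have := (mul_eq_zero.1 h4).resolve_left hK.ne'
    linarith [pow_eq_zero_iff (two_ne_zero) |>.1 this]
  refine ⟨h5, ?_⟩
  have h6 := h2 (by linarith)
  have hw : ‖(a p : ℂ)‖ = a p := by
    rw [Complex.norm_real, Real.norm_of_nonneg (ha.pos p).le]
  have h7 := ha.pairRadius_gapGamma hT p hw
  have h8 := sq_pairRadius (gapGamma k μ T a p) (a p : ℂ)
  have h9 : Γ.radius p ^ 2 = _ := sq_pairRadius (Γ.gammaHat p) (Γ.alphaHat p)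
  rw [h6, h5, ← h7, h8, hw] at h9
  exact (sq_eq_sq₀ (norm_nonneg _) (ha.pos p).le).1 (by linarith)

lemma excess_eq_zero (ha : IsGapSolution k μ T a) (hT : 0 ≤ T) {Γ : State d} {p : Space d}
    (h1 : Γ.gammaHat p = gapGamma k μ T a p) (h2 : ‖Γ.alphaHat p‖ = a p) :
    excess k μ T a Γ p = 0 := by
  rw [excess, State.radius, h1, h2, ha.pairRadius_gapGamma hT p h2]
  ring

end IsGapSolution

end BCS

end

/-! ### Comparison of free energies and characterization of the minimizers. -/

noncomputable section

namespace BCS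

variable {d : ℕ} {μ T : ℝ} {V : Space d → ℝ}

/-- `Γ` is the state obtained from a solution of the gap equation and a phase. -/
structure IsGapState (k : Space d → ℝ) (μ T : ℝ) (a : Space d → ℝ) (c : ℂ) (Γ : State d) :
    Prop where
  gammaHat : Γ.gammaHat =ᵐ[volume] gapGamma k μ T a
  alphaHat : Γ.alphaHat =ᵐ[volume] fun p => c * a p

namespace IsGapSolution

variable {a : Space d → ℝ}

lemma norm_mul_eq (ha : IsGapSolution (pairKernel V) μ T a) {c : ℂ} (hc : ‖c‖ = 1) (p : Space d) :
    ‖c * (a p : ℂ)‖ = a p := by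
  rw [norm_mul, hc, one_mul, Complex.norm_real, Real.norm_of_nonneg (ha.pos p).le]

lemma memDomain (ha : IsGapSolution (pairKernel V) μ T a) (hk : IsPairKernel (pairKernel V))
    (hT : 0 ≤ T) {c : ℂ} (hc : ‖c‖ = 1)
    {Γ : State d} (hΓ : IsGapState (pairKernel V) μ T a c Γ) : Γ.MemDomain := by
  refine State.memDomain_of_radius ?_ ?_ ?_ ?_
  · filter_upwards [hΓ.gammaHat, hΓ.alphaHat] with p h1 h2
    rw [State.radius, h1, h2]
    exact ha.pairRadius_gapGamma_le hT p (ha.norm_mul_eq hc p)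
  · refine (ha.integrable_gapGamma hk hT).congr ?_
    filter_upwards [hΓ.gammaHat] with p h1
    rw [h1]
  · refine ha.memW.integrable.congr ?_
    filter_upwards [hΓ.alphaHat] with p h2
    change hat Γ.alpha p = _ at h2
    rw [h2, ha.norm_mul_eq hc]
  · have h3 := (Measure.measurePreserving_neg (volume : Measure (Space d))).quasiMeasurePreserving.ae
      hΓ.alphaHat
    filter_upwards [hΓ.alphaHat, h3] with p h1 h2
    rw [h1, h2]
    rw [show a (-p) = a p from ha.isometry (LinearIsometryEquiv.neg ℝ) p]

lemma integrable_excess (ha : IsGapSolution (pairKernel V) μ T a)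
    (hk : IsPairKernel (pairKernel V)) (hT : 0 ≤ T) {Γ Γs : State d} (hΓ : Γ.MemDomain)
    (hΓs : Γs.MemDomain) (hs : IsGapState (pairKernel V) μ T a 1 Γs) :
    Integrable (excess (pairKernel V) μ T a Γ) ∧
    ∫ p, excess (pairKernel V) μ T a Γ p
      = ((∫ p, (‖p‖ ^ 2 - μ) * Γ.gammaHat p) - ∫ p, (‖p‖ ^ 2 - μ) * Γs.gammaHat p)
        + T * ((∫ p, hfun (Γ.radius p)) - ∫ p, hfun (Γs.radius p))
        - ((∫ p, gapK (pairKernel V) μ T a p * ‖hat Γ.alpha p‖ ^ 2)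
          - ∫ p, gapK (pairKernel V) μ T a p * ‖hat Γs.alpha p‖ ^ 2) := by
  have i1 := hΓ.integrable_kinetic μ
  have i2 := hΓs.integrable_kinetic μ
  have i3 := hΓ.integrable_hfun
  have i4 := hΓs.integrable_hfun
  have i5 := ha.integrable_gapK_mul hk hT (memW_norm_hat hΓ.alpha_mem)
  have i6 := ha.integrable_gapK_mul hk hT (memW_norm_hat hΓs.alpha_mem)
  have e : excess (pairKernel V) μ T a Γ =ᵐ[volume] fun p =>
      ((‖p‖ ^ 2 - μ) * Γ.gammaHat p - (‖p‖ ^ 2 - μ) * Γs.gammaHat p)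
      + T * (hfun (Γ.radius p) - hfun (Γs.radius p))
      - (gapK (pairKernel V) μ T a p * ‖hat Γ.alpha p‖ ^ 2
          - gapK (pairKernel V) μ T a p * ‖hat Γs.alpha p‖ ^ 2) := by
    filter_upwards [hs.gammaHat, hs.alphaHat] with p h1 h2
    have h3 := ha.norm_mul_eq (c := 1) (by simp) p
    change hat Γs.alpha p = _ at h2
    rw [excess, show Γs.radius p = pairRadius (Γs.gammaHat p) (hat Γs.alpha p) from rfl, h1, h2,
      ha.pairRadius_gapGamma hT p h3, h3]
    change _ - gapK (pairKernel V) μ T a p * (‖hat Γ.alpha p‖ ^ 2 - _) = _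
    ring
  refine ⟨(((i1.sub i2).add ((i3.sub i4).const_mul T)).sub (i5.sub i6)).congr e.symm, ?_⟩
  rw [integral_congr_ae e]
  have s1 := integral_sub ((i1.sub i2).add ((i3.sub i4).const_mul T)) (i5.sub i6)
  have s2 := integral_add (i1.sub i2) ((i3.sub i4).const_mul T)
  simp only [Pi.add_apply, Pi.sub_apply] at s1 s2
  rw [s1, s2, integral_const_mul, integral_sub i1 i2, integral_sub i3 i4, integral_sub i5 i6]

/-- The free energy relative to the state given by the gap equation. -/
theorem freeEnergy_sub (ha : IsGapSolution (pairKernel V) μ T a)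
    (hd : d = 1 ∨ d = 2 ∨ d = 3) (hV : IsAdmissible V) (hneg : IsNegativeType V)
    (hT : 0 ≤ T) {Γ Γs : State d} (hΓ : Γ.MemDomain)
    (hs : IsGapState (pairKernel V) μ T a 1 Γs) :
    freeEnergy μ T V Γ - freeEnergy μ T V Γs = (∫ p, excess (pairKernel V) μ T a Γ p)
      + (form (gapK (pairKernel V) μ T a) V Γ.alpha Γ.alpha).re := by
  have hk := isPairKernel hd hV hneg
  have hΓs := ha.memDomain hk hT (by simp) hs
  have h1 := (ha.integrable_excess hk hT hΓ hΓs hs).2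
  -- At the gap state kinetic and potential terms of the form cancel, so the `a²` term in the excess
  -- accounts exactly for its interaction energy.
  have h2 := ha.form_eq_zero hd hV hneg hΓs.alpha_mem hs.alphaHat hΓs.alpha_mem
  have h3 := form_self_re (K := gapK (pairKernel V) μ T a) (V := V) Γs.alpha
  rw [h2, Complex.zero_re] at h3
  rw [h1, form_self_re, freeEnergy_eq Γ, freeEnergy_eq Γs]
  linarith

/-- The minimizers are the states given by the gap equation. -/
theorem isMinimizer_iff (ha : IsGapSolution (pairKernel V) μ T a)
    (hd : d = 1 ∨ d = 2 ∨ d = 3) (hV : IsAdmissible V) (hneg : IsNegativeType V)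
    (hT : 0 ≤ T) {Γs : State d} (hs : IsGapState (pairKernel V) μ T a 1 Γs) (Γ : State d) :
    IsMinimizer μ T V Γ ↔ ∃ c : ℂ, ‖c‖ = 1 ∧ IsGapState (pairKernel V) μ T a c Γ := by
  have hk := isPairKernel hd hV hneg
  have hΓs := ha.memDomain hk hT (by simp) hs
  have hex : ∀ Γ' : State d, Γ'.MemDomain →
      0 ≤ᵐ[volume] excess (pairKernel V) μ T a Γ' := fun Γ' h' => by
    filter_upwards [h'.radius_le] with p hp
    exact ha.excess_nonneg hT hp
  have hmin : ∀ Γ' : State d, Γ'.MemDomain → freeEnergy μ T V Γs ≤ freeEnergy μ T V Γ' :=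
    fun Γ' h' => by
      have h1 := ha.freeEnergy_sub hd hV hneg hT h' hs
      have h2 := integral_nonneg_of_ae (hex Γ' h')
      have h3 := (ha.form_re_nonneg hd hV hneg hT h'.alpha_mem).1
      linarith
  constructor
  · intro h
    have h1 := ha.freeEnergy_sub hd hV hneg hT h.1 hs
    have h2 := integral_nonneg_of_ae (hex Γ h.1)
    obtain ⟨h3, h4⟩ := ha.form_re_nonneg hd hV hneg hT h.1.alpha_mem
    have h5 := h.2 Γs hΓs
    -- Excess and form are both non-negative and their sum is not positive, so each vanishes. The
    -- form gives `α̂ = c a`; the excess gives `γ̂ = γ_*` and `|α̂| = a`, hence `|c| = 1`.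
    have h6 : ∫ p, excess (pairKernel V) μ T a Γ p = 0 := by linarith
    obtain ⟨c, hc⟩ := h4 (by linarith)
    rw [integral_eq_zero_iff_of_nonneg_ae (hex Γ h.1)
      (ha.integrable_excess hk hT h.1 hΓs hs).1] at h6
    have h7 : ∀ᵐ p, Γ.gammaHat p = gapGamma (pairKernel V) μ T a p ∧ ‖Γ.alphaHat p‖ = a p := by
      filter_upwards [h6, h.1.radius_le] with p hp1 hp2
      exact ha.eq_of_excess_eq_zero hT hp2 hp1
    refine ⟨c, ?_, h7.mono fun p hp => hp.1, hc⟩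
    obtain ⟨p, hp1, hp2⟩ := (h7.and hc).exists
    have h8 := hp1.2
    change ‖hat Γ.alpha p‖ = _ at h8
    have h9 := ha.pos p
    rw [hp2, norm_mul, Complex.norm_real, Real.norm_of_nonneg h9.le] at h8
    exact mul_right_cancel₀ h9.ne' (by linarith)
  · rintro ⟨c, hc, hcs⟩
    have hΓ := ha.memDomain hk hT hc hcs
    refine ⟨hΓ, fun Γ' h' => le_trans ?_ (hmin Γ' h')⟩
    have h1 := ha.freeEnergy_sub hd hV hneg hT hΓ hs
    rw [ha.form_eq_zero hd hV hneg hΓ.alpha_mem hcs.alphaHat hΓ.alpha_mem, Complex.zero_re] at h1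
    have h2 : excess (pairKernel V) μ T a Γ =ᵐ[volume] 0 := by
      filter_upwards [hcs.gammaHat, hcs.alphaHat] with p hp1 hp2
      refine ha.excess_eq_zero hT hp1 ?_
      rw [hp2, ha.norm_mul_eq hc]
    rw [integral_congr_ae h2] at h1
    simp at h1
    linarith

end IsGapSolution

end BCS

end

/-! ### Radiality, and the ground state property. -/

noncomputable section

namespace BCS

variable {d : ℕ} {μ T : ℝ} {V : Space d → ℝ}

lemma IsRadial.congr {β : Type*} {f g : Space d → β} (hf : IsRadial f) (h : g =ᵐ[volume] f) :
    IsRadial g := by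
  obtain ⟨F, hF⟩ := hf
  exact ⟨F, h.trans hF⟩

/-- A function invariant under all isometries is radial. -/
lemma isRadial_of_isometry {β : Type*} (hd : 0 < d) {f : Space d → β}
    (h : ∀ (O : Space d ≃ₗᵢ[ℝ] Space d) p, f (O p) = f p) : IsRadial f := by
  let e : Space d := EuclideanSpace.single ⟨0, hd⟩ 1
  have he : ‖e‖ = 1 := by simp [e]
  refine ⟨fun r => f (r • e), Filter.Eventually.of_forall fun x => ?_⟩
  have hn : ‖‖x‖ • e‖ = ‖x‖ := by rw [norm_smul, he, mul_one, norm_norm]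
  -- Two vectors of equal length are exchanged by a reflection.
  exact (congrArg f (Submodule.reflection_sub hn)).symm.trans (h _ _)

lemma integral_fourier_isometry {f : Space d → ℂ} {g : Space d → ℂ} (hfg : f =ᵐ[volume] g)
    (h : ∀ (O : Space d ≃ₗᵢ[ℝ] Space d) p, g (O p) = g p) (O : Space d ≃ₗᵢ[ℝ] Space d)
    (x : Space d) :
    ∫ p, f p * Complex.exp (Complex.I * (inner ℝ p (O x) : ℝ))
      = ∫ p, f p * Complex.exp (Complex.I * (inner ℝ p x : ℝ)) := by
  have e : ∀ y : Space d, ∫ p, f p * Complex.exp (Complex.I * (inner ℝ p y : ℝ))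
      = ∫ p, g p * Complex.exp (Complex.I * (inner ℝ p y : ℝ)) := fun y => by
    refine integral_congr_ae ?_
    filter_upwards [hfg] with p hp
    rw [hp]
  rw [e, e, ← O.measurePreserving.integral_comp O.toHomeomorph.measurableEmbedding]
  simp only [h, O.inner_map_map]

/-- A function in `H¹` with invariant Fourier transform is radial. -/
theorem isRadial_of_hat (hd : 0 < d) {ψ : L2 d} (hψ : MemH1 ψ) {g : Space d → ℂ}
    (hg : hat ψ =ᵐ[volume] g) (h : ∀ (O : Space d ≃ₗᵢ[ℝ] Space d) p, g (O p) = g p) :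
    IsRadial fun x => ψ x := by
  -- The inversion integral need not converge for `ψ` itself. For cutoffs it does and is exactly
  -- invariant; `ψ` is an almost everywhere limit of a subsequence.
  let G : ℕ → Space d → ℂ := fun n x => (fourierNorm d : ℂ) *
    ∫ p, hat (cutoff ψ n) p * Complex.exp (Complex.I * (inner ℝ p x : ℝ))
  have hG : ∀ (n : ℕ) (O : Space d ≃ₗᵢ[ℝ] Space d) x, G n (O x) = G n x := fun n O x => by
    have h1 : hat (cutoff ψ n) =ᵐ[volume] (Metric.closedBall 0 (n : ℝ)).indicator g := by
      filter_upwards [hat_cutoff ψ n, hg] with p h1 h2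
      rw [h1]
      by_cases hp : p ∈ Metric.closedBall (0 : Space d) (n : ℝ) <;> simp [hp, h2]
    simp only [G]
    rw [integral_fourier_isometry h1 (fun O p => ?_) O x]
    by_cases hp : ‖p‖ ≤ n <;> simp [Set.indicator, hp, h]
  have hlim : Filter.Tendsto (fun n : ℕ => cutoff ψ n) Filter.atTop (nhds ψ) := by
    rw [tendsto_iff_norm_sub_tendsto_zero]
    have h1 : Filter.Tendsto (fun n : ℕ => Real.sqrt (h1sq (ψ - cutoff ψ n))) Filter.atTop
        (nhds 0) := by
      simpa using (tendsto_h1sq_sub_cutoff hψ).sqrt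
    refine squeeze_zero (fun n => norm_nonneg _) (fun n => ?_) h1
    rw [norm_sub_rev]
    refine Real.le_sqrt_of_sq_le ?_
    rw [norm_sq_eq_integral, ← integral_hat_sq]
    exact integral_hat_sq_le_h1sq (memH1_sub_cutoff hψ n)
  obtain ⟨ns, -, hns⟩ := (tendstoInMeasure_of_tendsto_Lp hlim).exists_seq_tendsto_ae
  -- `limUnder` is defined at every point and depends only on the sequence, so `L` is invariant even
  -- where the sequence diverges.
  let L : Space d → ℂ := fun x => Filter.atTop.limUnder fun n => G (ns n) x
  refine (isRadial_of_isometry hd (f := L) fun O x => ?_).congr ?_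
  · simp only [L, hG]
  · have hall : ∀ᵐ x, ∀ n : ℕ, cutoff ψ n x = G n x :=
      ae_all_iff.2 fun n => ae_eq_integral_hat _ (integrable_hat_cutoff ψ n)
    filter_upwards [hns, hall] with x h1 h2
    simp only [h2] at h1
    exact h1.limUnder_eq.symm

/-- Two functions whose Fourier transforms are multiples of `a` are proportional. -/
lemma hat_eq_smul {a : Space d → ℝ} {ψ φ : L2 d} {c c' : ℂ} (hc : c ≠ 0)
    (hφ : hat φ =ᵐ[volume] fun p => c * a p) (hψ : hat ψ =ᵐ[volume] fun p => c' * a p) :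
    ψ = (c' / c) • φ := by
  refine hat_injective ?_
  filter_upwards [hφ, hψ, hat_smul (c' / c) φ] with p h1 h2 h3
  rw [h3, h2, h1]
  field_simp

namespace IsGapSolution

variable {a : Space d → ℝ}

lemma gapGamma_isometry {k : Space d → ℝ} (ha : IsGapSolution k μ T a) (hk : IsPairKernel k)
    (O : Space d ≃ₗᵢ[ℝ] Space d) (p : Space d) :
    gapGamma k μ T a (O p) = gapGamma k μ T a p := by
  simp only [gapGamma, gapK, gapSymbol, O.norm_map, hk.conv_isometry O (ha.isometry O) p]

lemma isRadial (ha : IsGapSolution (pairKernel V) μ T a) (hd : 0 < d)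
    (hk : IsPairKernel (pairKernel V)) {c : ℂ} {Γ : State d} (hα : MemH1 Γ.alpha)
    (hΓ : IsGapState (pairKernel V) μ T a c Γ) :
    IsRadial Γ.gamma ∧ IsRadial Γ.gammaHat ∧ IsRadial (fun x => Γ.alpha x) ∧
      IsRadial Γ.alphaHat := by
  have h1 := ha.gapGamma_isometry hk
  have h2 : ∀ (O : Space d ≃ₗᵢ[ℝ] Space d) p, c * (a (O p) : ℂ) = c * a p := fun O p => by
    rw [ha.isometry]
  refine ⟨isRadial_of_isometry hd fun O x => ?_, (isRadial_of_isometry hd h1).congr hΓ.gammaHat,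
    isRadial_of_hat hd hα hΓ.alphaHat h2, (isRadial_of_isometry hd h2).congr hΓ.alphaHat⟩
  rw [State.gamma, State.gamma, integral_fourier_isometry
    (g := fun p => (gapGamma (pairKernel V) μ T a p : ℂ)) ?_ (fun O p => by rw [h1]) O x]
  filter_upwards [hΓ.gammaHat] with p hp
  rw [hp]

/-- The form of `K - k ⋆` has `0` as its lowest eigenvalue, with `α` as unique eigenvector. -/
theorem isGroundState (ha : IsGapSolution (pairKernel V) μ T a)
    (hd : d = 1 ∨ d = 2 ∨ d = 3) (hV : IsAdmissible V) (hneg : IsNegativeType V) (hT : 0 ≤ T)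
    {ψ : L2 d} (hψ : MemH1 ψ) {c : ℂ} (hc0 : c ≠ 0) (hc : hat ψ =ᵐ[volume] fun p => c * a p) :
    IsGroundState (gapK (pairKernel V) μ T a) V 0 ψ ∧
    ∀ φ : L2 d, IsGroundState (gapK (pairKernel V) μ T a) V 0 φ → ∃ c' : ℂ, φ = c' • ψ := by
  refine ⟨⟨fun h => ?_, ⟨hψ, fun φ hφ => ?_⟩, fun φ hφ => ?_⟩, fun φ hφ => ?_⟩
  · have h1 := hat_smul 0 ψ
    rw [zero_smul, ← h] at h1
    obtain ⟨p, h2, h3⟩ := (h1.and hc).exists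
    rw [h2] at h3
    replace h3 : 0 * hat ψ p = c * a p := h3
    rw [zero_mul, eq_comm, mul_eq_zero] at h3
    have := (ha.pos p).ne'
    rcases h3 with h3 | h3
    · exact hc0 h3
    · exact this (by exact_mod_cast h3)
  · rw [ha.form_eq_zero hd hV hneg hψ hc hφ]
    simp
  · rw [zero_mul]
    exact (ha.form_re_nonneg hd hV hneg hT hφ).1
  · obtain ⟨hφ1, hφ2⟩ := hφ.eigen
    have h1 := hφ2 φ hφ1
    simp only [Complex.ofReal_zero, zero_smul, inner_zero_right] at h1
    obtain ⟨c', hc'⟩ := (ha.form_re_nonneg hd hV hneg hT hφ1).2 (by rw [h1, Complex.zero_re])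
    exact ⟨_, BCS.hat_eq_smul hc0 hc hc'⟩

end IsGapSolution

end BCS

end

/-! ### Assembly of the theorem from a single positive gap solution. -/

theorem proposition1p5 {d : ℕ} (hd : d = 1 ∨ d = 2 ∨ d = 3) (μ : ℝ) (hμ : 0 < μ)
    (V : BCS.Space d → ℝ) (hV : BCS.IsAdmissible V) (hneg : BCS.IsNegativeType V)
    (T : ℝ) (hT0 : 0 ≤ T) (hT : T < BCS.criticalTemperature μ V) :
    (∀ Γ : BCS.State d, BCS.IsMinimizer μ T V Γ →
      BCS.OperatorNonneg (BCS.symbolK μ T (BCS.gap V Γ)) V ∧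
      BCS.IsGroundState (BCS.symbolK μ T (BCS.gap V Γ)) V 0 Γ.alpha ∧
      ∀ ψ : BCS.L2 d, BCS.IsGroundState (BCS.symbolK μ T (BCS.gap V Γ)) V 0 ψ →
        ∃ c : ℂ, ψ = c • Γ.alpha) ∧
    (∃ Γs : BCS.State d, BCS.IsMinimizer μ T V Γs ∧
      (∃ a : BCS.Space d → ℝ, Continuous a ∧ (∀ p, 0 < a p) ∧
        Γs.alphaHat =ᵐ[volume] fun p => (a p : ℂ)) ∧
      ∀ Γ : BCS.State d, BCS.IsMinimizer μ T V Γ ↔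
        Γ.gammaHat =ᵐ[volume] Γs.gammaHat ∧
        ∃ θ : ℝ, Γ.alpha = Complex.exp (Complex.I * θ) • Γs.alpha) ∧
    (∀ Γ : BCS.State d, BCS.IsMinimizer μ T V Γ →
      BCS.IsRadial Γ.gamma ∧ BCS.IsRadial Γ.gammaHat ∧
      BCS.IsRadial (fun x => Γ.alpha x) ∧ BCS.IsRadial Γ.alphaHat) := by
  obtain ⟨a, ha⟩ := BCS.exists_isGapSolution hd hμ hV hneg hT0 hT
  have hk := BCS.isPairKernel hd hV hneg
  obtain ⟨α, hα, -, -, -⟩ := ha.memW.exists_hat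
  let Γs : BCS.State d := ⟨BCS.gapGamma (BCS.pairKernel V) μ T a, α⟩
  have hs : BCS.IsGapState (BCS.pairKernel V) μ T a 1 Γs := by
    refine ⟨Filter.EventuallyEq.rfl, ?_⟩
    filter_upwards [hα] with p hp
    rw [one_mul]
    exact hp
  have hmin := ha.isMinimizer_iff hd hV hneg hT0 hs
  refine ⟨fun Γ hΓ => ?_, ⟨Γs, (hmin Γs).2 ⟨1, by simp, hs⟩,
    ⟨a, ha.continuous, ha.pos, hα⟩, fun Γ => ?_⟩, fun Γ hΓ => ?_⟩
  · obtain ⟨c, hc, hcs⟩ := (hmin Γ).1 hΓ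
    rw [BCS.symbolK_gap hneg hc hcs.alphaHat]
    exact ⟨fun ψ hψ => (ha.form_re_nonneg hd hV hneg hT0 hψ).1,
      ha.isGroundState hd hV hneg hT0 hΓ.1.alpha_mem (norm_ne_zero_iff.1 (by rw [hc]; simp))
        hcs.alphaHat⟩
  · rw [hmin]
    constructor
    · rintro ⟨c, hc, hcs⟩
      refine ⟨hcs.gammaHat, c.arg, ?_⟩
      have h1 : Complex.exp (Complex.I * c.arg) = c := by
        have := Complex.norm_mul_exp_arg_mul_I c
        rwa [hc, Complex.ofReal_one, one_mul, mul_comm] at this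
      rw [h1]
      simpa using BCS.hat_eq_smul one_ne_zero hs.alphaHat hcs.alphaHat
    · rintro ⟨h1, θ, h2⟩
      refine ⟨Complex.exp (Complex.I * θ), ?_, h1, ?_⟩
      · rw [mul_comm, Complex.norm_exp_ofReal_mul_I]
      · rw [BCS.State.alphaHat, h2]
        filter_upwards [BCS.hat_smul (Complex.exp (Complex.I * θ)) Γs.alpha, hα] with p h3 h4
        rw [h3]
        exact congrArg _ h4
  · obtain ⟨c, -, hcs⟩ := (hmin Γ).1 hΓ
    exact ha.isRadial (by omega) hk hΓ.1.alpha_mem hcs
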